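/- **Words.** For a set $A$ let $T(A)$ be the $\mathbb{Q}$-vector space spanned by the words over $A$ (empty word $1$), with the shuffle product $\ast $, i.e. the bilinear product with $1 \ast w = w \ast 1 = w$ and $(\sigma u) \ast (\tau v) = \sigma(u \ast \tau v)+\tau(\sigma u \ast v)$ for letters $\sigma,\tau$ and words $u,v$. **Hyperlogarithms.** For a word $w$ in letters from $\mathbb{C}\setminus(0,\infty)$ and real $z>0$ put $L_{0^n}(z)=\frac{\log^n z}{n!}$ for the word $0^n$ ($n\ge 0$), and $L_{\sigma w'}(z)=\int_0^z \frac{L_{w'}(x)}{x-\sigma}\,dx$ if $w=\sigma w'$ is not of this form; extend $w\mapsto L_w(z)$ linearly. **Regularized limits.** If for all large real $z$ one has $F(z)=\sum_{i=0}^n f_i(1/z)\log^i z$ with $f_0,\dots,f_n$ holomorphic at $0$, put $\operatorname{Reg}_{z\to\infty}F(z)=f_0(0)$. If for all small $t>0$ one has $F(t)=\sum_{i=0}^n f_i(t)\log^i t$ with $f_0,\dots,f_n$ holomorphic at $0$, put $\operatorname{Reg}_{t\to0}F(t)=f_0(0)$. (These values do not depend on the choice of the $f_i$.) **Leading coefficients.**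 For $0\ne\sigma\in\mathbb{C}(t)$ with Laurent series $\sigma=\sum_{n\ge N}a_nt^n$ at $t=0$, $a_N\neq0$, put $\deg\sigma=N$ and $\operatorname{lc}(\sigma)=a_N$; put $\deg 0=\infty$. For a word, $\deg(\sigma_1\cdots\sigma_n)=\min_i\deg\sigma_i$. For $\Sigma\subset\mathbb{C}(t)$ put $\operatorname{lc}(\Sigma)=\{0\}\cup\{\operatorname{lc}(\sigma):\sigma\in\Sigma\setminus\{0\}\}$. **Theorem.** Let $\Sigma\subset\mathbb{C}(t)$ contain no positive real constant, and suppose $\operatorname{lc}(\Sigma)\cap(0,\infty)=\emptyset$. Then there is a unique $\mathbb{Q}$-linear map $\ell\colon T(\Sigma)\to T(\operatorname{lc}(\Sigma))$ such that * $\ell(1)=1$ and $\ell(u\ast v)=\ell(u)\ast \ell(v)$ for all $u,v\in T(\Sigma)$; * $\ell(0)=0$ for the one-letter word $0$, if $0\in\Sigma$; * $\ell(\sigma_1\cdots\sigma_n)=\sigma_1'\cdots\sigma_n'$ with $\sigma_i'=\lim_{t\to0}t^{-d}\sigma_i(t)$, whenever $n\ge1$, $\sigma_n\neq0$ and $d=\deg(\sigma_1\cdots\sigma_n)=\deg\sigma_n$.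 For every $w\in T(\Sigma)$, let $w(t)$ be obtained from $w$ by evaluating all letters at $t$. Then $\operatorname{Reg}_{z\to\infty}L_{w(t)}(z)$ exists for all sufficiently small $t>0$, this function of $t$ has a regularized limit at $t\to0$, $\operatorname{Reg}_{z\to\infty}L_{\ell(w)}(z)$ exists, and $$\operatorname{Reg}_{t\to0}\ \operatorname{Reg}_{z\to\infty}L_{w(t)}(z)=\operatorname{Reg}_{z\to\infty}L_{\ell(w)}(z).$$ -/

import Mathlib

namespace Hyperlogarithm

noncomputable section

/-! ### The shuffle algebra -/

/-- `T(Σ)`: rational linear combinations of words over the alphabet `α`.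
The empty word `single [] 1` is the unit. -/
abbrev WordSpace (α : Type*) : Type _ := List α →₀ ℚ

/-- A word, as an element of `T(Σ)`. -/
def ofWord {α : Type*} (w : List α) : WordSpace α := Finsupp.single w 1

/-- The shuffle product of two words,
`(a u) ⧢ (b v) = a (u ⧢ b v) + b (a u ⧢ v)`. -/
def shuffleWord {α : Type*} : List α → List α → WordSpace α
  | [], v => ofWord v
  | a :: u, [] => ofWord (a :: u)
  | a :: u, b :: v =>
      Finsupp.mapDomain (List.cons a) (shuffleWord u (b :: v)) +
        Finsupp.mapDomain (List.cons b) (shuffleWord (a :: u) v)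
termination_by u v => u.length + v.length

/-- The shuffle product on `T(Σ)`, the bilinear extension of `shuffleWord`. -/
def shuffle {α : Type*} (x y : WordSpace α) : WordSpace α :=
  x.sum fun u p => y.sum fun v q => (p * q) • shuffleWord u v

/-! ### Hyperlogarithms on the positive real axis -/

open Classical in
/-- The hyperlogarithm `L_w(z)` for `z > 0`: `L_{0^n}(z) = log^n z / n!`, and
`L_{σ w}(z) = ∫_0^z L_w(x) / (x - σ) dx` for any other nonempty word. -/
def hyperlogWord : List ℂ → ℝ → ℂ
  | [], _ => 1
  | σ :: w, z =>
      if ∀ τ ∈ σ :: w, τ = 0 then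
        (Real.log z : ℂ) ^ (σ :: w).length / ((σ :: w).length.factorial : ℂ)
      else
        ∫ x in (0 : ℝ)..z, hyperlogWord w x / ((x : ℂ) - σ)

/-- The linear extension of `w ↦ L_w(z)` to `T(Σ)`. The letters are read as complex numbers
through `ev`. -/
def hyperlog {α : Type*} (ev : α → ℂ) (w : WordSpace α) (z : ℝ) : ℂ :=
  w.sum fun v q => (q : ℂ) * hyperlogWord (v.map ev) z

/-! ### Regularized limits -/

/-- `c` is a regularized limit of `F(z)` as `z → ∞`: for all large `z` one has
`F(z) = ∑ i ≤ n, f i (1 / z) * log^i z` with all `f i` holomorphic at `0`, and `c = f 0 0`. -/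
def HasRegLimAtTop (F : ℝ → ℂ) (c : ℂ) : Prop :=
  ∃ (n : ℕ) (f : ℕ → ℂ → ℂ),
    (∀ i, AnalyticAt ℂ (f i) 0) ∧
    (∀ᶠ z : ℝ in Filter.atTop,
      F z = ∑ i ∈ Finset.range (n + 1), f i (1 / (z : ℂ)) * (Real.log z : ℂ) ^ i) ∧
    f 0 0 = c

/-- `c` is a regularized limit of `F(t)` as `t → 0` through positive values: for all small `t > 0`
one has `F(t) = ∑ i ≤ n, f i t * log^i t` with all `f i` holomorphic at `0`, and `c = f 0 0`. -/
def HasRegLimAtZero (F : ℝ → ℂ) (c : ℂ) : Prop :=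
  ∃ (n : ℕ) (f : ℕ → ℂ → ℂ),
    (∀ i, AnalyticAt ℂ (f i) 0) ∧
    (∀ᶠ t : ℝ in nhdsWithin 0 (Set.Ioi 0),
      F t = ∑ i ∈ Finset.range (n + 1), f i (t : ℂ) * (Real.log t : ℂ) ^ i) ∧
    f 0 0 = c

/-- The regularized limit of `F(z)` as `z → ∞` (meaningful if one exists). -/
def regLimAtTop (F : ℝ → ℂ) : ℂ := Classical.epsilon (HasRegLimAtTop F)

/-- The regularized limit of `F(t)` as `t → 0` (meaningful if one exists). -/
def regLimAtZero (F : ℝ → ℂ) : ℂ := Classical.epsilon (HasRegLimAtZero F)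

/-! ### Letters that depend rationally on `t` -/

/-- The Laurent series at `t = 0` of a rational function of `t`. -/
def laurent (σ : RatFunc ℂ) : LaurentSeries ℂ := (σ : LaurentSeries ℂ)

/-- The vanishing degree of `σ` at `t = 0`, with `deg 0 = ⊤`. -/
def vanishingDeg (σ : RatFunc ℂ) : WithTop ℤ := (laurent σ).orderTop

/-- The leading coefficient of `σ` at `t = 0`. -/
def leadingCoeff (σ : RatFunc ℂ) : ℂ := (laurent σ).leadingCoeff

/-- The vanishing degree of a word, the minimum over its letters. -/
def wordDeg (w : List (RatFunc ℂ)) : WithTop ℤ := (w.map vanishingDeg).foldr min ⊤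

/-- The alphabet of leading coefficients: `0` and the leading coefficients of all nonzero
letters. -/
def leadingAlphabet (S : Set (RatFunc ℂ)) : Set ℂ :=
  {0} ∪ leadingCoeff '' (S \ {0})

/-- The value at a point `t` of a rational function of `t`. -/
def evalAt {S : Set (RatFunc ℂ)} (t : ℝ) (σ : S) : ℂ :=
  RatFunc.eval (RingHom.id ℂ) (t : ℂ) (σ : RatFunc ℂ)

/-- The limit at `t → 0` of the rescaled letter `t ^ (-d) * σ`, for `d` at most the vanishing
degree of `σ`: it is the coefficient of `t ^ d` in the Laurent series of `σ`. -/
def rescaledLimit (d : ℤ) (σ : RatFunc ℂ) : ℂ := (laurent σ).coeff d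

/-- `ℓ` is a morphism of shuffle algebras `T(S) → T(leadingAlphabet S)` with `ℓ(0) = 0` that sends
each word whose final letter is nonzero and has the vanishing degree `d` of the whole word to the
limit at `t → 0` of the word with all letters rescaled by `t ^ (-d)`. -/
structure IsReglimWord {S : Set (RatFunc ℂ)}
    (ℓ : WordSpace S →ₗ[ℚ] WordSpace (leadingAlphabet S)) : Prop where
  map_one : ℓ (ofWord []) = ofWord []
  map_shuffle : ∀ x y : WordSpace S, ℓ (shuffle x y) = shuffle (ℓ x) (ℓ y)
  map_zero_letter : ∀ σ : S, (σ : RatFunc ℂ) = 0 → ℓ (ofWord [σ]) = 0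
  map_minimal : ∀ (u : List S) (σ : S) (d : ℤ),
    vanishingDeg (σ : RatFunc ℂ) = d →
    wordDeg ((u ++ [σ]).map Subtype.val) = d →
    Finsupp.mapDomain (List.map Subtype.val) (ℓ (ofWord (u ++ [σ]))) =
      ofWord ((u ++ [σ]).map fun τ => rescaledLimit d (τ : RatFunc ℂ))

end

end Hyperlogarithm

/-!
The letter `0` of infinite degree together with the words whose last letter has minimal degree
generate the shuffle algebra, so a shuffle homomorphism is determined by its values there, and it
suffices to compare both sides of the limit formula on such words. The homomorphism itself is a
convolution, over the degrees that occur, of homomorphisms reading off the leading coefficients at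
one degree at a time.

For a word with letters `σ₁, …, σₙ` and `d = deg σₙ` minimal, substituting `x ↦ t ^ d * x` in the
iterated integral turns the letters into `t ^ (-d) * σᵢ(t)`, which converge to the leading letters.
The scaling acts on regularized values by a sum over the suffixes of the word, weighted by the
divided powers of `-d * log t`, all of which except the zeroth are killed by the regularized limit
at `t → 0`. The regularized values of the suffixes have a log-Laurent expansion in `t`, because
their derivative in the letters is a combination of regularized values of shorter words with
logarithmic differentials as coefficients.
-/

namespace Hyperlogarithm

noncomputable section

open Filter Topology MeasureTheory

variable {α β M : Type*}

/-! ### The shuffle algebra -/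

section ShuffleAlgebra

/-- Prepending a letter to every word. -/
def consₗ (a : α) : WordSpace α →ₗ[ℚ] WordSpace α := Finsupp.lmapDomain ℚ ℚ (List.cons a)

lemma consₗ_ofWord (a : α) (w : List α) : consₗ a (ofWord w) = ofWord (a :: w) := by
  simp [consₗ, ofWord]

/-- The shuffle product as a bilinear map. -/
def shuffleₗ : WordSpace α →ₗ[ℚ] WordSpace α →ₗ[ℚ] WordSpace α :=
  Finsupp.linearCombination ℚ fun u => Finsupp.linearCombination ℚ (shuffleWord u)

lemma shuffleₗ_apply (x y : WordSpace α) : shuffleₗ x y = shuffle x y := by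
  simp only [shuffleₗ, shuffle, Finsupp.linearCombination_apply, Finsupp.sum,
    LinearMap.sum_apply, LinearMap.smul_apply, Finset.smul_sum, smul_smul]

@[simp] lemma shuffleₗ_ofWord (u v : List α) :
    shuffleₗ (ofWord u) (ofWord v) = shuffleWord u v := by
  simp [shuffleₗ, ofWord, Finsupp.linearCombination_single]

lemma shuffleWord_nil_left (v : List α) : shuffleWord [] v = ofWord v := by
  rw [shuffleWord]

lemma shuffleWord_nil_right (u : List α) : shuffleWord u [] = ofWord u := by
  cases u <;> rw [shuffleWord]

lemma shuffleWord_cons_cons (a b : α) (u v : List α) :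
    shuffleWord (a :: u) (b :: v) =
      consₗ a (shuffleWord u (b :: v)) + consₗ b (shuffleWord (a :: u) v) := by
  rw [shuffleWord]; rfl

lemma WordSpace.hom_ext [AddCommGroup M] [Module ℚ M] {f g : WordSpace α →ₗ[ℚ] M}
    (h : ∀ w, f (ofWord w) = g (ofWord w)) : f = g :=
  Finsupp.lhom_ext' fun w => LinearMap.ext_ring (h w)

@[simp] lemma shuffleₗ_one_left (x : WordSpace α) : shuffleₗ (ofWord []) x = x := by
  have : shuffleₗ (ofWord ([] : List α)) = LinearMap.id :=
    WordSpace.hom_ext fun w => by simp [shuffleWord_nil_left]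
  exact LinearMap.congr_fun this x

@[simp] lemma shuffleₗ_one_right (x : WordSpace α) : shuffleₗ x (ofWord []) = x := by
  have : shuffleₗ.flip (ofWord ([] : List α)) = LinearMap.id :=
    WordSpace.hom_ext fun w => by simp [shuffleWord_nil_right]
  exact LinearMap.congr_fun this x

lemma shuffleₗ_consₗ_consₗ (a b : α) (x y : WordSpace α) :
    shuffleₗ (consₗ a x) (consₗ b y) =
      consₗ a (shuffleₗ x (consₗ b y)) + consₗ b (shuffleₗ (consₗ a x) y) := by
  have : shuffleₗ.compl₁₂ (consₗ a) (consₗ b) =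
      (shuffleₗ.compl₁₂ LinearMap.id (consₗ b)).compr₂ (consₗ a) +
        (shuffleₗ.compl₁₂ (consₗ a) LinearMap.id).compr₂ (consₗ b) := by
    refine WordSpace.hom_ext fun u => WordSpace.hom_ext fun v => ?_
    simp [consₗ_ofWord, shuffleWord_cons_cons]
  exact LinearMap.congr_fun₂ this x y

lemma shuffleWord_comm (u v : List α) : shuffleWord u v = shuffleWord v u := by
  induction u generalizing v with
  | nil => rw [shuffleWord_nil_left, shuffleWord_nil_right]
  | cons a u ihu =>
    induction v with
    | nil => rw [shuffleWord_nil_left, shuffleWord_nil_right]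
    | cons b v ihv => rw [shuffleWord_cons_cons, shuffleWord_cons_cons, ihu, ihv, add_comm]

lemma shuffleₗ_comm (x y : WordSpace α) : shuffleₗ x y = shuffleₗ y x := by
  have : (shuffleₗ : WordSpace α →ₗ[ℚ] _) = shuffleₗ.flip :=
    WordSpace.hom_ext fun u => WordSpace.hom_ext fun v => by simp [shuffleWord_comm u v]
  exact LinearMap.congr_fun₂ this x y

lemma shuffleₗ_assoc_ofWord (u v w : List α) :
    shuffleₗ (shuffleₗ (ofWord u) (ofWord v)) (ofWord w) =
      shuffleₗ (ofWord u) (shuffleₗ (ofWord v) (ofWord w)) := by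
  induction u generalizing v w with
  | nil => simp [shuffleWord_nil_left]
  | cons a u ihu =>
    induction v generalizing w with
    | nil => simp [shuffleWord_nil_left]
    | cons b v ihv =>
      induction w with
      | nil => simp only [shuffleₗ_one_right]
      | cons c w ihw =>
        have hu := congrArg (consₗ a) (ihu (b :: v) (c :: w))
        have hv := congrArg (consₗ b) (ihv (c :: w))
        have hw := congrArg (consₗ c) ihw
        simp only [← consₗ_ofWord, shuffleₗ_consₗ_consₗ, map_add, LinearMap.add_apply]
          at hu hv hw ⊢
        linear_combination (norm := abel) hu + hv + hw

lemma shuffleₗ_assoc (x y z : WordSpace α) :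
    shuffleₗ (shuffleₗ x y) z = shuffleₗ x (shuffleₗ y z) := by
  have : (shuffleₗ : WordSpace α →ₗ[ℚ] _).compr₂ shuffleₗ =
      ((LinearMap.llcomp ℚ (WordSpace α) (WordSpace α) (WordSpace α)).flip.comp
        shuffleₗ).flip.comp (shuffleₗ : WordSpace α →ₗ[ℚ] _) := by
    refine WordSpace.hom_ext fun u => WordSpace.hom_ext fun v => WordSpace.hom_ext fun w => ?_
    exact shuffleₗ_assoc_ofWord u v w
  exact LinearMap.congr_fun (LinearMap.congr_fun₂ this x y) z

lemma shuffleₗ_shuffleₗ_shuffleₗ_comm (x y z w : WordSpace α) :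
    shuffleₗ (shuffleₗ x y) (shuffleₗ z w) = shuffleₗ (shuffleₗ x z) (shuffleₗ y w) := by
  rw [shuffleₗ_assoc, ← shuffleₗ_assoc y z w, shuffleₗ_comm y z, shuffleₗ_assoc z y w,
    ← shuffleₗ_assoc]

lemma shuffleWord_replicate (a : α) (m n : ℕ) :
    shuffleWord (List.replicate m a) (List.replicate n a) =
      ((m + n).choose m : ℚ) • ofWord (List.replicate (m + n) a) := by
  induction m generalizing n with
  | zero => simp [shuffleWord_nil_left]
  | succ m ihm =>
    induction n with
    | zero => simp [shuffleWord_nil_right]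
    | succ n ihn =>
      have hm := ihm (n + 1)
      rw [← add_assoc] at hm
      have pascal := Nat.choose_succ_succ' (m + n + 1) m
      rw [List.replicate_succ] at hm ihn ⊢
      rw [List.replicate_succ, shuffleWord_cons_cons, hm, ihn, map_smul, map_smul, consₗ_ofWord,
        consₗ_ofWord, ← List.replicate_succ, ← List.replicate_succ,
        show m + 1 + (n + 1) = m + n + 1 + 1 by ring, show m + 1 + n = m + n + 1 by ring,
        ← add_smul, pascal]
      push_cast
      rfl

end ShuffleAlgebra

/-! ### Deconcatenation and convolution -/

section Convolution

/-- The sum of `h p s` over all factorizations `w = p ++ s`. -/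
def cutSum [AddCommMonoid M] (h : List α → List α → M) (w : List α) : M :=
  ∑ i ∈ Finset.range (w.length + 1), h (w.take i) (w.drop i)

@[simp] lemma cutSum_nil [AddCommMonoid M] (h : List α → List α → M) : cutSum h [] = h [] [] := by
  simp [cutSum]

lemma cutSum_cons [AddCommMonoid M] (h : List α → List α → M) (a : α) (w : List α) :
    cutSum h (a :: w) = h [] (a :: w) + cutSum (fun p s => h (a :: p) s) w := by
  rw [cutSum, List.length_cons, Finset.sum_range_succ', add_comm]
  simp [cutSum]

lemma cutSum_congr [AddCommMonoid M] {h h' : List α → List α → M} {w : List α}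
    (H : ∀ p s, p ++ s = w → h p s = h' p s) : cutSum h w = cutSum h' w :=
  Finset.sum_congr rfl fun i _ => H _ _ (List.take_append_drop i w)

lemma cutSum_eq_zero [AddCommMonoid M] {h : List α → List α → M} {w : List α}
    (H : ∀ p s, p ++ s = w → h p s = 0) : cutSum h w = 0 :=
  Finset.sum_eq_zero fun i _ => H _ _ (List.take_append_drop i w)

lemma cutSum_add [AddCommMonoid M] (h h' : List α → List α → M) (w : List α) :
    cutSum (fun p s => h p s + h' p s) w = cutSum h w + cutSum h' w :=
  Finset.sum_add_distrib

lemma map_cutSum {N F : Type*} [AddCommMonoid M] [AddCommMonoid N] [FunLike F M N]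
    [AddMonoidHomClass F M N] (φ : F) (h : List α → List α → M) (w : List α) :
    φ (cutSum h w) = cutSum (fun p s => φ (h p s)) w :=
  map_sum φ _ _

lemma cutSum_eq_right [AddCommMonoid M] {h : List α → List α → M} {w : List α}
    (H : ∀ p s, p ++ s = w → p ≠ [] → h p s = 0) : cutSum h w = h [] w := by
  refine (Finset.sum_eq_single_of_mem 0 (by simp) fun i hi hi0 => ?_).trans (by simp)
  refine H _ _ (List.take_append_drop i w) fun hnil => ?_
  have : w = [] := by simpa [List.take_eq_nil_iff, hi0] using hnil
  simp_all

lemma cutSum_eq_left [AddCommMonoid M] {h : List α → List α → M} {w : List α}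
    (H : ∀ p s, p ++ s = w → s ≠ [] → h p s = 0) : cutSum h w = h w [] := by
  refine (Finset.sum_eq_single_of_mem w.length (by simp) fun i hi hi0 => ?_).trans (by simp)
  refine H _ _ (List.take_append_drop i w) fun hnil => hi0 ?_
  exact le_antisymm (Finset.mem_range_succ_iff.1 hi) (List.drop_eq_nil_iff.1 hnil)

/-- The linear extension of `w ↦ ∑_{w = p ++ s} H p s`. -/
def cutSumₗ [AddCommGroup M] [Module ℚ M] (H : WordSpace α →ₗ[ℚ] WordSpace α →ₗ[ℚ] M) :
    WordSpace α →ₗ[ℚ] M :=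
  Finsupp.linearCombination ℚ (cutSum fun p s => H (ofWord p) (ofWord s))

lemma cutSumₗ_ofWord [AddCommGroup M] [Module ℚ M]
    (H : WordSpace α →ₗ[ℚ] WordSpace α →ₗ[ℚ] M) (w : List α) :
    cutSumₗ H (ofWord w) = cutSum (fun p s => H (ofWord p) (ofWord s)) w := by
  simp [cutSumₗ, ofWord, Finsupp.linearCombination_single]

lemma cutSumₗ_consₗ [AddCommGroup M] [Module ℚ M]
    (H : WordSpace α →ₗ[ℚ] WordSpace α →ₗ[ℚ] M) (a : α) (x : WordSpace α) :
    cutSumₗ H (consₗ a x) = H (ofWord []) (consₗ a x) + cutSumₗ (H.comp (consₗ a)) x := by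
  have : (cutSumₗ H).comp (consₗ a) =
      (H (ofWord [])).comp (consₗ a) + cutSumₗ (H.comp (consₗ a)) :=
    WordSpace.hom_ext fun w => by simp [consₗ_ofWord, cutSumₗ_ofWord, cutSum_cons]
  exact LinearMap.congr_fun this x

lemma cutSumₗ_shuffleWord [AddCommGroup M] [Module ℚ M]
    (H : WordSpace α →ₗ[ℚ] WordSpace α →ₗ[ℚ] M) (u v : List α) :
    cutSumₗ H (shuffleWord u v) =
      cutSum (fun p₁ s₁ =>
        cutSum (fun p₂ s₂ => H (shuffleWord p₁ p₂) (shuffleWord s₁ s₂)) v) u := by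
  induction u generalizing v H with
  | nil => simp [shuffleWord_nil_left, cutSumₗ_ofWord]
  | cons a u ihu =>
    induction v generalizing H with
    | nil => simp [shuffleWord_nil_right, cutSumₗ_ofWord]
    | cons b v ihv =>
      rw [shuffleWord_cons_cons, map_add, cutSumₗ_consₗ, cutSumₗ_consₗ, ihu, ihv]
      simp only [cutSum_cons, LinearMap.comp_apply, shuffleWord_nil_left, shuffleWord_nil_right,
        consₗ_ofWord, shuffleWord_cons_cons, map_add, LinearMap.add_apply, cutSum_add]
      abel

/-- A morphism of shuffle algebras: a linear map compatible with the units and with shuffles. -/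
structure IsShuffleHom (f : WordSpace α →ₗ[ℚ] WordSpace β) : Prop where
  map_one : f (ofWord []) = ofWord []
  map_shuffleWord : ∀ u v, f (shuffleWord u v) = shuffleₗ (f (ofWord u)) (f (ofWord v))

lemma IsShuffleHom.map_shuffleₗ {f : WordSpace α →ₗ[ℚ] WordSpace β} (hf : IsShuffleHom f)
    (x y : WordSpace α) : f (shuffleₗ x y) = shuffleₗ (f x) (f y) := by
  have : shuffleₗ.compr₂ f = shuffleₗ.compl₁₂ f f :=
    WordSpace.hom_ext fun u => WordSpace.hom_ext fun v => by simp [hf.map_shuffleWord]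
  exact LinearMap.congr_fun₂ this x y

/-- The convolution product of two linear maps, with respect to deconcatenation of words on the
source and the shuffle product on the target. -/
def convolution (f g : WordSpace α →ₗ[ℚ] WordSpace β) : WordSpace α →ₗ[ℚ] WordSpace β :=
  cutSumₗ (shuffleₗ.compl₁₂ f g)

lemma convolution_ofWord (f g : WordSpace α →ₗ[ℚ] WordSpace β) (w : List α) :
    convolution f g (ofWord w) =
      cutSum (fun p s => shuffleₗ (f (ofWord p)) (g (ofWord s))) w := by
  simp [convolution, cutSumₗ_ofWord]

lemma IsShuffleHom.convolution {f g : WordSpace α →ₗ[ℚ] WordSpace β}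
    (hf : IsShuffleHom f) (hg : IsShuffleHom g) : IsShuffleHom (convolution f g) where
  map_one := by simp [convolution_ofWord, hf.map_one, hg.map_one]
  map_shuffleWord u v := by
    rw [convolution_ofWord, convolution_ofWord, Hyperlogarithm.convolution, cutSumₗ_shuffleWord,
      ← LinearMap.flip_apply, map_cutSum]
    refine cutSum_congr fun p₁ s₁ _ => ?_
    rw [LinearMap.flip_apply, map_cutSum]
    refine cutSum_congr fun p₂ s₂ _ => ?_
    rw [LinearMap.compl₁₂_apply, hf.map_shuffleWord, hg.map_shuffleWord,
      shuffleₗ_shuffleₗ_shuffleₗ_comm]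

end Convolution

/-! ### Substitution of letters -/

section Substitution

/-- Prepending a linear combination of letters. -/
def prependₗ : (α →₀ ℚ) →ₗ[ℚ] WordSpace α →ₗ[ℚ] WordSpace α :=
  Finsupp.linearCombination ℚ consₗ

@[simp] lemma prependₗ_single (a : α) (c : ℚ) : prependₗ (Finsupp.single a c) = c • consₗ a := by
  simp [prependₗ]

lemma shuffleₗ_prependₗ_prependₗ (p q : α →₀ ℚ) (x y : WordSpace α) :
    shuffleₗ (prependₗ p x) (prependₗ q y) =
      prependₗ p (shuffleₗ x (prependₗ q y)) + prependₗ q (shuffleₗ (prependₗ p x) y) := by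
  induction p using Finsupp.induction_linear with
  | zero => simp
  | add p p' hp hp' => simp only [map_add, LinearMap.add_apply, hp, hp']; abel
  | single a c =>
    induction q using Finsupp.induction_linear with
    | zero => simp
    | add q q' hq hq' => simp only [map_add, LinearMap.add_apply, hq, hq']; abel
    | single b d => simp [shuffleₗ_consₗ_consₗ, smul_comm c d]

/-- The image of a word under the substitution of each letter by a linear combination of
letters. -/
def substWord (φ : α → β →₀ ℚ) : List α → WordSpace β
  | [] => ofWord []
  | a :: w => prependₗ (φ a) (substWord φ w)

/-- The linear extension of `substWord`. -/
def subst (φ : α → β →₀ ℚ) : WordSpace α →ₗ[ℚ] WordSpace β :=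
  Finsupp.linearCombination ℚ (substWord φ)

variable {φ : α → β →₀ ℚ}

@[simp] lemma subst_ofWord (w : List α) : subst φ (ofWord w) = substWord φ w := by
  simp [subst, ofWord]

lemma subst_consₗ (a : α) (x : WordSpace α) :
    subst φ (consₗ a x) = prependₗ (φ a) (subst φ x) := by
  have : (subst φ).comp (consₗ a) = (prependₗ (φ a)).comp (subst φ) :=
    WordSpace.hom_ext fun w => by simp [consₗ_ofWord, substWord]
  exact LinearMap.congr_fun this x

variable (φ) in
lemma isShuffleHom_subst : IsShuffleHom (subst φ) where
  map_one := by simp [substWord]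
  map_shuffleWord u v := by
    induction u generalizing v with
    | nil => simp [shuffleWord_nil_left, substWord]
    | cons a u ihu =>
      induction v with
      | nil => simp [shuffleWord_nil_right, substWord]
      | cons b v ihv =>
        rw [shuffleWord_cons_cons, map_add, subst_consₗ, subst_consₗ, ihu, ihv]
        simp only [subst_ofWord, substWord, shuffleₗ_prependₗ_prependₗ]

lemma substWord_congr {ψ : α → β →₀ ℚ} {w : List α} (h : ∀ a ∈ w, φ a = ψ a) :
    substWord φ w = substWord ψ w := by
  induction w with
  | nil => rfl
  | cons a w ih => rw [substWord, substWord, h a (by simp), ih fun b hb => h b (by simp [hb])]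

lemma substWord_eq_zero {w : List α} {a : α} (ha : a ∈ w) (h : φ a = 0) : substWord φ w = 0 := by
  induction w with
  | nil => simp at ha
  | cons b w ih =>
    rcases List.mem_cons.1 ha with rfl | ha
    · simp [substWord, h]
    · simp [substWord, ih ha]

lemma substWord_eq_smul_ofWord_map (c : ℚ) (f : α → β) {w : List α}
    (h : ∀ a ∈ w, φ a = Finsupp.single (f a) c) :
    substWord φ w = c ^ w.length • ofWord (w.map f) := by
  induction w with
  | nil => simp [substWord]
  | cons b w ih =>
    rw [substWord, h b (by simp), ih fun a ha => h a (by simp [ha])]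
    simp [consₗ_ofWord, pow_succ, smul_smul]

/-- The counit of the shuffle algebra, followed by the unit of another one. -/
def counit : WordSpace α →ₗ[ℚ] WordSpace β := subst 0

lemma counit_one : (counit : WordSpace α →ₗ[ℚ] WordSpace β) (ofWord []) = ofWord [] :=
  (isShuffleHom_subst 0).map_one

lemma counit_of_ne_nil {w : List α} (hw : w ≠ []) :
    (counit : WordSpace α →ₗ[ℚ] WordSpace β) (ofWord w) = 0 := by
  rw [counit, subst_ofWord, substWord_eq_zero (List.head_mem hw) rfl]

lemma convolution_of_left_eq_counit {f g : WordSpace α →ₗ[ℚ] WordSpace β} {w : List α}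
    (hf : ∀ p s, p ++ s = w → f (ofWord p) = counit (ofWord p)) :
    convolution f g (ofWord w) = g (ofWord w) := by
  rw [convolution_ofWord, cutSum_eq_right, hf [] w rfl, counit_one, shuffleₗ_one_left]
  intro p s hps hp
  rw [hf p s hps, counit_of_ne_nil hp, map_zero, LinearMap.zero_apply]

lemma convolution_const_subst_neg (z : β) {w : List α} (hw : w ≠ []) :
    convolution (subst fun _ => Finsupp.single z 1) (subst fun _ => Finsupp.single z (-1))
      (ofWord w) = (0 : WordSpace β) := by
  have hterm : ∀ i ∈ Finset.range (w.length + 1),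
      shuffleₗ (substWord (fun _ => Finsupp.single z 1) (w.take i))
        (substWord (fun _ => Finsupp.single z (-1)) (w.drop i)) =
      ((-1 : ℚ) ^ w.length * ((-1 : ℤ) ^ i * w.length.choose i : ℤ)) •
        ofWord (List.replicate w.length z) := by
    intro i hi
    obtain ⟨k, hk⟩ := Nat.exists_eq_add_of_le (Finset.mem_range_succ_iff.1 hi)
    have hsign : (-1 : ℚ) ^ i * (-1) ^ i = 1 := by rw [← mul_pow]; simp
    rw [substWord_eq_smul_ofWord_map 1 (fun _ => z) fun _ _ => rfl,
      substWord_eq_smul_ofWord_map (-1) (fun _ => z) fun _ _ => rfl]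
    simp only [List.map_const', List.length_take, List.length_drop, hk, one_pow, one_smul,
      min_eq_left (Nat.le_add_right i k), Nat.add_sub_cancel_left, map_smul, shuffleₗ_ofWord,
      shuffleWord_replicate, smul_smul]
    congr 1
    push_cast
    rw [pow_add]
    linear_combination (-((-1 : ℚ) ^ k) * (i + k).choose i) * hsign
  simp only [convolution_ofWord, subst_ofWord]
  rw [cutSum, Finset.sum_congr rfl hterm, ← Finset.sum_smul, ← Finset.mul_sum, ← Int.cast_sum,
    Int.alternating_sum_range_choose_of_ne (by simpa using hw)]
  simp

end Substitution

section Generation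

/-- The span of the words obtained by inserting the letter `σ` into a rearrangement of `w`, with
fewer than `n` letters after it. -/
def insertionSpan (σ : α) (w : List α) (n : ℕ) : Submodule ℚ (WordSpace α) :=
  Submodule.span ℚ
    {x | ∃ p s : List α, s.length < n ∧ (p ++ s).Perm w ∧ x = ofWord (p ++ σ :: s)}

lemma consₗ_mem_insertionSpan {σ b : α} {w w' : List α} {n n' : ℕ} {x : WordSpace α}
    (hn : n ≤ n') (hw : (b :: w).Perm w') (hx : x ∈ insertionSpan σ w n) :
    consₗ b x ∈ insertionSpan σ w' n' := by
  refine (Submodule.map_span_le (consₗ b) _ _).2 ?_ (Submodule.mem_map_of_mem hx)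
  rintro _ ⟨p, s, hs, hps, rfl⟩
  exact Submodule.subset_span
    ⟨b :: p, s, hs.trans_le hn, (hps.cons b).trans hw, consₗ_ofWord _ _⟩

/-- Only one term of the shuffle, `u σ v`, has all of `v` after `σ`. -/
lemma shuffleWord_snoc_sub_mem_insertionSpan (u : List α) (σ : α) (v : List α) :
    shuffleWord (u ++ [σ]) v - ofWord (u ++ σ :: v) ∈ insertionSpan σ (u ++ v) v.length := by
  induction v generalizing u with
  | nil => simp [shuffleWord_nil_right]
  | cons b v ihv =>
    have first_from_right (u : List α) :
        consₗ b (shuffleWord (u ++ [σ]) v) ∈ insertionSpan σ (u ++ b :: v) (b :: v).length := by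
      have h := consₗ_mem_insertionSpan (b := b) (n' := (b :: v).length) (by simp)
        List.perm_middle.symm (ihv u)
      rw [map_sub, consₗ_ofWord] at h
      refine (Submodule.sub_mem_iff_left _ ?_).1 h
      exact Submodule.subset_span ⟨b :: u, v, by simp, List.perm_middle.symm, rfl⟩
    induction u with
    | nil =>
      have h := first_from_right []
      simp only [List.nil_append] at h ⊢
      rwa [shuffleWord_cons_cons, shuffleWord_nil_left, consₗ_ofWord, add_sub_cancel_left]
    | cons a u ihu =>
      have first_from_left := consₗ_mem_insertionSpan le_rfl (List.Perm.refl (a :: _)) ihu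
      rw [map_sub, consₗ_ofWord] at first_from_left
      simp only [List.cons_append, shuffleWord_cons_cons, add_sub_right_comm]
      exact add_mem first_from_left (first_from_right (a :: u))

lemma shuffleWord_mem_span_perm (u v : List α) :
    shuffleWord u v ∈ Submodule.span ℚ (ofWord '' {w | w.Perm (u ++ v)}) := by
  have cons_mem {a : α} {w w' : List α} {x : WordSpace α} (hw : (a :: w).Perm w')
      (hx : x ∈ Submodule.span ℚ (ofWord '' {w' | w'.Perm w})) :
      consₗ a x ∈ Submodule.span ℚ (ofWord '' {w | w.Perm w'}) := by
    refine (Submodule.map_span_le (consₗ a) _ _).2 ?_ (Submodule.mem_map_of_mem hx)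
    rintro _ ⟨v, hv, rfl⟩
    exact Submodule.subset_span ⟨a :: v, (hv.cons a).trans hw, (consₗ_ofWord _ _).symm⟩
  induction u generalizing v with
  | nil =>
    rw [shuffleWord_nil_left]
    exact Submodule.subset_span ⟨v, List.Perm.refl _, rfl⟩
  | cons a u ihu =>
    induction v with
    | nil =>
      rw [shuffleWord_nil_right]
      exact Submodule.subset_span ⟨a :: u, by simp, rfl⟩
    | cons b v ihv =>
      rw [shuffleWord_cons_cons]
      exact add_mem (cons_mem (List.Perm.refl _) (ihu (b :: v)))
        (cons_mem List.perm_middle.symm ihv)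

variable {p : Submodule ℚ (WordSpace α)}

lemma ofWord_append_cons_mem (hmul : ∀ x ∈ p, ∀ y ∈ p, shuffleₗ x y ∈ p) {L : Set α} {σ : α}
    {n : ℕ} (hsnoc : ∀ u : List α, (∀ b ∈ u, b ∈ L) → ofWord (u ++ [σ]) ∈ p)
    (hshort : ∀ v : List α, v.length < n → (∀ b ∈ v, b ∈ L) → ofWord v ∈ p)
    {u v : List α} (hn : u.length + v.length < n) (hL : ∀ b ∈ u ++ v, b ∈ L) :
    ofWord (u ++ σ :: v) ∈ p := by
  induction hm : v.length using Nat.strong_induction_on generalizing u v with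
  | _ m ih =>
    have hshuffle : shuffleWord (u ++ [σ]) v ∈ p := by
      rw [← shuffleₗ_ofWord]
      exact hmul _ (hsnoc u fun b hb => hL b (by simp [hb])) _
        (hshort v (by omega) fun b hb => hL b (by simp [hb]))
    refine (Submodule.sub_mem_iff_right _ hshuffle).1
      (Submodule.span_le.2 ?_ (shuffleWord_snoc_sub_mem_insertionSpan u σ v))
    rintro _ ⟨u', v', hlt, hperm, rfl⟩
    have hlen := hperm.length_eq
    simp only [List.length_append] at hlen
    exact ih v'.length (hm ▸ hlt) (by omega) (fun b hb => hL b (hperm.mem_iff.1 hb)) rfl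

lemma ofWord_replicate_mem (hmul : ∀ x ∈ p, ∀ y ∈ p, shuffleₗ x y ∈ p) (hone : ofWord [] ∈ p)
    {a : α} (ha : ofWord [a] ∈ p) (n : ℕ) : ofWord (List.replicate n a) ∈ p := by
  induction n with
  | zero => exact hone
  | succ n ih =>
    have h := hmul _ ha _ ih
    have hchoose : ((1 + n).choose 1 : ℚ) ≠ 0 :=
      Nat.cast_ne_zero.2 (Nat.choose_pos (Nat.le_add_right 1 n)).ne'
    rw [shuffleₗ_ofWord, ← List.replicate_one, shuffleWord_replicate,
      Submodule.smul_mem_iff _ hchoose] at h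
    rwa [add_comm]

/-- A letter of minimal degree can be moved to the end of a word by shuffles with shorter words. -/
theorem eq_top_of_minimal_mem (deg : α → WithTop ℤ)
    (hdeg : ∀ a b, deg a = ⊤ → deg b = ⊤ → a = b)
    (hmul : ∀ x ∈ p, ∀ y ∈ p, shuffleₗ x y ∈ p)
    (hone : ofWord [] ∈ p) (htop : ∀ a, deg a = ⊤ → ofWord [a] ∈ p)
    (hmin : ∀ (u : List α) (a : α) (d : ℤ), deg a = d → (∀ b ∈ u, d ≤ deg b) →
      ofWord (u ++ [a]) ∈ p) : p = ⊤ := by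
  have ofWord_mem (w : List α) : ofWord w ∈ p := by
    induction hn : w.length using Nat.strong_induction_on generalizing w with
    | _ n ih =>
      rcases w.eq_nil_or_concat with rfl | ⟨w', c, hw'⟩
      · exact hone
      obtain ⟨a, ha, hle⟩ : ∃ a ∈ w, ∀ b ∈ w, deg a ≤ deg b := by
        classical
        simpa using Finset.exists_min_image w.toFinset deg ⟨c, by simp [hw']⟩
      by_cases hat : deg a = ⊤
      · rw [List.eq_replicate_of_mem fun b hb => hdeg b a (top_le_iff.1 (hat ▸ hle b hb)) hat]
        exact ofWord_replicate_mem hmul hone (htop a hat) _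
      · obtain ⟨d, hd⟩ := WithTop.ne_top_iff_exists.1 hat
        obtain ⟨u, v, rfl⟩ := List.append_of_mem ha
        refine ofWord_append_cons_mem hmul (L := {b | deg a ≤ deg b}) (n := n)
          (fun u hu => hmin u a d hd.symm (by simpa [hd] using hu))
          (fun v hv _ => ih _ hv v rfl) (by simp at hn; omega) fun b hb => hle b ?_
        simp only [List.mem_append, List.mem_cons] at hb ⊢
        tauto
  rw [eq_top_iff]
  rintro x -
  induction x using Finsupp.induction_linear with
  | zero => exact p.zero_mem
  | add x y hx hy => exact p.add_mem hx hy
  | single w c => simpa [ofWord] using p.smul_mem c (ofWord_mem w)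

end Generation

/-! ### The leading-word morphism -/

section LeadingHom

variable (deg : α → WithTop ℤ) (lc : α → β) (z : β)

/-- The limit of the letter `a`, rescaled in degree `d`, if `d ≤ deg a`: its leading coefficient
`lc a`, or the letter `z`, which stands for zero. -/
def limitLetter (d : ℤ) (a : α) : β :=
  open Classical in if deg a = d then lc a else z

/-- The substitution that rescales letters in degree `d`, discarding those of smaller degree. -/
def limitSubst (d : ℤ) (a : α) : β →₀ ℚ :=
  open Classical in
  if (d : WithTop ℤ) ≤ deg a then Finsupp.single (limitLetter deg lc z d a) 1 else 0

/-- The substitution by `-z` of all letters of degree greater than `d`, discarding the others. -/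
def vanishingSubst (d : ℤ) (a : α) : β →₀ ℚ :=
  open Classical in if (d : WithTop ℤ) < deg a then Finsupp.single z (-1) else 0

/-- The limit of words rescaled in degree `d`, regularized so that it only sees the letters of
degree exactly `d` at the end of a word. -/
def scaleHom (d : ℤ) : WordSpace α →ₗ[ℚ] WordSpace β :=
  convolution (subst (limitSubst deg lc z d)) (subst (vanishingSubst deg z d))

lemma isShuffleHom_scaleHom (d : ℤ) : IsShuffleHom (scaleHom deg lc z d) :=
  (isShuffleHom_subst _).convolution (isShuffleHom_subst _)

variable {deg lc z}

lemma scaleHom_of_exists_lt {d : ℤ} {w : List α} (h : ∃ a ∈ w, deg a < d) :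
    scaleHom deg lc z d (ofWord w) = 0 := by
  obtain ⟨a, ha, h⟩ := h
  rw [scaleHom, convolution_ofWord, cutSum_eq_zero]
  rintro p s rfl
  rw [subst_ofWord, subst_ofWord]
  rcases List.mem_append.1 ha with ha | ha
  · rw [substWord_eq_zero ha (by simp [limitSubst, h]), map_zero, LinearMap.zero_apply]
  · rw [substWord_eq_zero ha (by simp [vanishingSubst, h.le]), map_zero]

lemma scaleHom_eq_counit {d : ℤ} {w : List α} (h : ∀ a ∈ w, deg a ≠ d) :
    scaleHom deg lc z d (ofWord w) = counit (ofWord w) := by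
  rcases eq_or_ne w [] with rfl | hw
  · rw [(isShuffleHom_scaleHom deg lc z d).map_one, counit_one]
  rw [counit_of_ne_nil hw]
  by_cases hlt : ∃ a ∈ w, deg a < d
  · exact scaleHom_of_exists_lt hlt
  push Not at hlt
  rw [← convolution_const_subst_neg z hw, scaleHom, convolution_ofWord, convolution_ofWord]
  refine cutSum_congr ?_
  rintro p s rfl
  have hle (a) (ha : a ∈ p ++ s) : (d : WithTop ℤ) ≤ deg a := hlt a ha
  have hp : substWord (limitSubst deg lc z d) p = substWord (fun _ => Finsupp.single z 1) p :=
    substWord_congr fun a ha => by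
      have ha' := List.mem_append_left s ha
      simp [limitSubst, limitLetter, hle a ha', h a ha']
  have hs : substWord (vanishingSubst deg z d) s = substWord (fun _ => Finsupp.single z (-1)) s :=
    substWord_congr fun a ha => by
      have ha' := List.mem_append_right p ha
      simp [vanishingSubst, (hle a ha').lt_of_ne (h a ha').symm]
  simp only [subst_ofWord, hp, hs]

lemma exists_eq_snoc_of_append_eq_snoc {p s u : List α} {a : α} (h : p ++ s = u ++ [a])
    (hs : s ≠ []) : ∃ s', s = s' ++ [a] := by
  obtain ⟨s', b, rfl⟩ := s.eq_nil_or_concat'.resolve_left hs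
  rw [← List.append_assoc] at h
  exact ⟨s', by rw [(List.append_singleton_inj.1 h).2]⟩

lemma scaleHom_minimal {d : ℤ} {u : List α} {a : α} (ha : deg a = d)
    (hu : ∀ b ∈ u, d ≤ deg b) :
    scaleHom deg lc z d (ofWord (u ++ [a])) =
      ofWord ((u ++ [a]).map (limitLetter deg lc z d)) := by
  rw [scaleHom, convolution_ofWord, cutSum_eq_left]
  · rw [(isShuffleHom_subst _).map_one, shuffleₗ_one_right, subst_ofWord,
      substWord_eq_smul_ofWord_map 1 (limitLetter deg lc z d), one_pow, one_smul]
    simpa [or_imp, forall_and, limitSubst, ha] using fun b hb h => absurd h (hu b hb).not_gt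
  · intro p s hps hs
    obtain ⟨s, rfl⟩ := exists_eq_snoc_of_append_eq_snoc hps hs
    rw [subst_ofWord, subst_ofWord, substWord_eq_zero (a := a) (w := s ++ [a]) (by simp)
      (by simp [vanishingSubst, ha]), map_zero]

variable (deg lc z) in
/-- The convolution product of the maps `scaleHom d` for `d` in a list. -/
def scaleHoms : List ℤ → (WordSpace α →ₗ[ℚ] WordSpace β)
  | [] => counit
  | d :: ds => convolution (scaleHom deg lc z d) (scaleHoms ds)

variable (deg lc z) in
lemma isShuffleHom_scaleHoms (ds : List ℤ) : IsShuffleHom (scaleHoms deg lc z ds) := by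
  induction ds with
  | nil => exact isShuffleHom_subst _
  | cons d ds ih => exact (isShuffleHom_scaleHom deg lc z d).convolution ih

lemma scaleHoms_filter (E : Finset ℤ) (ds : List ℤ) {w : List α}
    (h : ∀ a ∈ w, ∀ d : ℤ, deg a = d → d ∈ E) :
    scaleHoms deg lc z (ds.filter (· ∈ E)) (ofWord w) = scaleHoms deg lc z ds (ofWord w) := by
  induction ds generalizing w with
  | nil => rfl
  | cons d ds ih =>
    by_cases hd : d ∈ E
    · rw [List.filter_cons_of_pos (by simpa using hd), scaleHoms, scaleHoms, convolution_ofWord,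
        convolution_ofWord]
      exact cutSum_congr fun p s hps => by rw [ih fun a ha => h a (by simp [← hps, ha])]
    · rw [List.filter_cons_of_neg (by simpa using hd), ih h, scaleHoms,
        convolution_of_left_eq_counit]
      exact fun p s hps => scaleHom_eq_counit fun a ha had => hd (h a (by simp [← hps, ha]) d had)

lemma scaleHoms_snoc_of_lt {ds : List ℤ} {a : α} (h : ∀ d ∈ ds, deg a < d) (u : List α) :
    scaleHoms deg lc z ds (ofWord (u ++ [a])) = 0 := by
  induction ds generalizing u with
  | nil => exact counit_of_ne_nil (by simp)
  | cons d ds ih =>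
    rw [scaleHoms, convolution_ofWord, cutSum_eq_zero]
    intro p s hps
    rcases eq_or_ne s [] with rfl | hs
    · rw [scaleHom_of_exists_lt ⟨a, by simp_all, h d (by simp)⟩, map_zero, LinearMap.zero_apply]
    · obtain ⟨s, rfl⟩ := exists_eq_snoc_of_append_eq_snoc hps hs
      rw [ih fun d hd => h d (by simp [hd]), map_zero]

/-- The factors before `scaleHom d` only see letters of degree less than `d`, and those after it
kill every nonempty suffix. -/
lemma scaleHoms_minimal {d : ℤ} {u : List α} {a : α} (ha : deg a = d)
    (hu : ∀ b ∈ u, d ≤ deg b) {ds : List ℤ} (hds : ds.Pairwise (· < ·)) (hd : d ∈ ds) :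
    scaleHoms deg lc z ds (ofWord (u ++ [a])) =
      ofWord ((u ++ [a]).map (limitLetter deg lc z d)) := by
  induction ds with
  | nil => simp at hd
  | cons e ds ih =>
    rw [List.pairwise_cons] at hds
    rcases List.mem_cons.1 hd with rfl | hd
    · rw [scaleHoms, convolution_ofWord, cutSum_eq_left, (isShuffleHom_scaleHoms _ _ _ _).map_one,
        shuffleₗ_one_right, scaleHom_minimal ha hu]
      intro p s hps hs
      obtain ⟨s, rfl⟩ := exists_eq_snoc_of_append_eq_snoc hps hs
      rw [scaleHoms_snoc_of_lt (fun e he => ha ▸ by exact_mod_cast hds.1 e he), map_zero]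
    · rw [scaleHoms, convolution_of_left_eq_counit, ih hds.2 hd]
      refine fun p s hps => scaleHom_eq_counit fun b hb hbe => ?_
      have hmem : b ∈ u ++ [a] := hps ▸ List.mem_append_left s hb
      have hle : (d : WithTop ℤ) ≤ deg b := by
        rcases List.mem_append.1 hmem with hmem | hmem
        · exact hu b hmem
        · rw [List.mem_singleton.1 hmem, ha]
      rw [hbe] at hle
      exact (hds.1 d hd).not_ge (by exact_mod_cast hle)

variable (deg) in
/-- The set of finite degrees of the letters of a word. -/
def degSet (w : List α) : Finset ℤ :=
  open Classical in
  (w.map deg).toFinset.preimage (fun d : ℤ => (d : WithTop ℤ)) WithTop.coe_injective.injOn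

lemma mem_degSet {w : List α} {d : ℤ} : d ∈ degSet deg w ↔ ∃ a ∈ w, deg a = d := by
  simp [degSet]

lemma degSet_mono {v w : List α} (h : v ⊆ w) : degSet deg v ⊆ degSet deg w := fun d hd => by
  obtain ⟨a, ha, had⟩ := mem_degSet.1 hd
  exact mem_degSet.2 ⟨a, h ha, had⟩

variable (deg lc z) in
/-- The morphism sending a word to its leading word as all letters degenerate: the convolution
product of the maps `scaleHom d` in increasing order of `d`. On a given word, all but finitely many
factors agree with the counit. -/
def leadingHom : WordSpace α →ₗ[ℚ] WordSpace β :=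
  Finsupp.linearCombination ℚ fun w => scaleHoms deg lc z ((degSet deg w).sort (· ≤ ·)) (ofWord w)

lemma leadingHom_ofWord (w : List α) : leadingHom deg lc z (ofWord w) =
    scaleHoms deg lc z ((degSet deg w).sort (· ≤ ·)) (ofWord w) := by
  simp [leadingHom, ofWord]

lemma leadingHom_ofWord_of_subset {E : Finset ℤ} {w : List α} (h : degSet deg w ⊆ E) :
    leadingHom deg lc z (ofWord w) = scaleHoms deg lc z (E.sort (· ≤ ·)) (ofWord w) := by
  have hsort : (degSet deg w).sort (· ≤ ·) = (E.sort (· ≤ ·)).filter (· ∈ degSet deg w) := by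
    refine List.Perm.eq_of_pairwise' (r := (· ≤ ·)) (Finset.pairwise_sort _ _)
      ((Finset.pairwise_sort _ _).filter _) <| (List.perm_ext_iff_of_nodup
        (Finset.sort_nodup _ _) ((Finset.sort_nodup _ _).filter _)).2 fun d => ?_
    simpa using @h d
  rw [leadingHom_ofWord, hsort, scaleHoms_filter]
  exact fun a ha d had => mem_degSet.2 ⟨a, ha, had⟩

variable (deg lc z) in
theorem isShuffleHom_leadingHom : IsShuffleHom (leadingHom deg lc z) where
  map_one := by rw [leadingHom_ofWord, (isShuffleHom_scaleHoms _ _ _ _).map_one]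
  map_shuffleWord u v := by
    rw [leadingHom_ofWord_of_subset (degSet_mono (List.subset_append_left u v)),
      leadingHom_ofWord_of_subset (degSet_mono (List.subset_append_right u v)),
      ← (isShuffleHom_scaleHoms deg lc z _).map_shuffleWord]
    refine (Submodule.span_le (p := LinearMap.eqLocus _ _)).2 ?_ (shuffleWord_mem_span_perm u v)
    rintro _ ⟨w, hw, rfl⟩
    exact leadingHom_ofWord_of_subset (degSet_mono hw.subset)

theorem leadingHom_minimal {d : ℤ} {u : List α} {a : α} (ha : deg a = d)
    (hu : ∀ b ∈ u, d ≤ deg b) :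
    leadingHom deg lc z (ofWord (u ++ [a])) =
      ofWord ((u ++ [a]).map (limitLetter deg lc z d)) := by
  rw [leadingHom_ofWord]
  refine scaleHoms_minimal ha hu (Finset.sortedLT_sort _).pairwise ?_
  rw [Finset.mem_sort]
  exact mem_degSet.2 ⟨a, by simp, ha⟩

theorem leadingHom_of_top {a : α} (ha : deg a = ⊤) : leadingHom deg lc z (ofWord [a]) = 0 := by
  have : degSet deg [a] = ∅ := by
    ext d
    simp [mem_degSet, ha]
  rw [leadingHom_ofWord, this, Finset.sort_empty, scaleHoms, counit_of_ne_nil (by simp)]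

end LeadingHom

/-! ### Regularized limits -/

section RegularizedLimits

lemma tendsto_ofReal_nhdsGT_zero : Tendsto (fun t : ℝ => (t : ℂ)) (𝓝[>] 0) (𝓝 0) := by
  simpa using (Complex.continuous_ofReal.tendsto 0).mono_left nhdsWithin_le_nhds

lemma tendsto_mul_abs_log_pow (k : ℕ) :
    Tendsto (fun t : ℝ => t * |Real.log t| ^ k) (𝓝[>] 0) (𝓝 0) := by
  have h := (isLittleO_abs_log_rpow_rpow_nhdsGT_zero k neg_one_lt_zero).tendsto_div_nhds_zero
  refine h.congr fun t => ?_
  rw [Real.rpow_neg_one, div_inv_eq_mul, Real.rpow_natCast, mul_comm]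

lemma sum_neg_one_pow_mul_log_inv_pow (n : ℕ) (f : ℕ → ℂ) (s : ℝ) :
    ∑ i ∈ Finset.range n, (-1) ^ i * f i * (Real.log s⁻¹ : ℂ) ^ i =
      ∑ i ∈ Finset.range n, f i * (Real.log s : ℂ) ^ i := by
  refine Finset.sum_congr rfl fun i _ => ?_
  have hsign : (-1 : ℂ) ^ i * (-1) ^ i = 1 := by rw [← mul_pow]; simp
  rw [Real.log_inv, Complex.ofReal_neg, neg_pow]
  linear_combination (f i * (Real.log s : ℂ) ^ i) * hsign

theorem hasRegLimAtTop_iff {F : ℝ → ℂ} {c : ℂ} :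
    HasRegLimAtTop F c ↔ HasRegLimAtZero (fun s => F s⁻¹) c := by
  constructor <;> rintro ⟨n, f, hf, hF, hc⟩ <;>
    refine ⟨n, fun i z => (-1) ^ i * f i z, fun i => analyticAt_const.mul (hf i), ?_, by simpa⟩
  · filter_upwards [tendsto_inv_nhdsGT_zero.eventually hF] with s hs
    rw [← inv_inv s, sum_neg_one_pow_mul_log_inv_pow _ fun i => f i _, inv_inv, hs]
    simp
  · filter_upwards [tendsto_inv_atTop_nhdsGT_zero.eventually hF] with s hs
    rw [inv_inv] at hs
    rw [← sum_neg_one_pow_mul_log_inv_pow _ fun i => f i _] at hs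
    simpa using hs

namespace HasRegLimAtZero

variable {F G : ℝ → ℂ} {c d : ℂ}

lemma congr (h : HasRegLimAtZero F c) (hFG : ∀ᶠ t in 𝓝[>] 0, F t = G t) :
    HasRegLimAtZero G c := by
  obtain ⟨n, f, hf, hF, hc⟩ := h
  refine ⟨n, f, hf, ?_, hc⟩
  filter_upwards [hF, hFG] with t h1 h2
  rw [← h2, h1]

lemma exists_expansion_of_le (h : HasRegLimAtZero F c) :
    ∃ (n : ℕ) (f : ℕ → ℂ → ℂ), (∀ i, AnalyticAt ℂ (f i) 0) ∧
      (∀ N, n ≤ N → ∀ᶠ t : ℝ in 𝓝[>] 0,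
        F t = ∑ i ∈ Finset.range (N + 1), f i (t : ℂ) * (Real.log t : ℂ) ^ i) ∧ f 0 0 = c := by
  obtain ⟨n, f, hf, hF, hc⟩ := h
  refine ⟨n, fun i => if i ≤ n then f i else fun _ => 0, fun i => ?_, fun N hN => ?_, by simpa⟩
  · dsimp only
    split_ifs
    exacts [hf i, analyticAt_const]
  · filter_upwards [hF] with t ht
    rw [ht]
    refine Finset.sum_subset_zero_on_sdiff (Finset.range_mono (by omega)) (fun i hi => ?_)
      fun i hi => ?_
    · simp only [Finset.mem_sdiff, Finset.mem_range] at hi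
      simp [show ¬ i ≤ n by omega]
    · simp [Finset.mem_range_succ_iff.1 hi]

lemma add (hF : HasRegLimAtZero F c) (hG : HasRegLimAtZero G d) :
    HasRegLimAtZero (fun t => F t + G t) (c + d) := by
  obtain ⟨n, f, hf, hF, hc⟩ := hF.exists_expansion_of_le
  obtain ⟨m, g, hg, hG, hd⟩ := hG.exists_expansion_of_le
  refine ⟨max n m, fun i z => f i z + g i z, fun i => (hf i).add (hg i), ?_, by simp [hc, hd]⟩
  filter_upwards [hF _ (le_max_left n m), hG _ (le_max_right n m)] with t h1 h2
  simp only [h1, h2, add_mul, Finset.sum_add_distrib]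

lemma analyticAt_mul {g : ℂ → ℂ} (hg : AnalyticAt ℂ g 0) (hF : HasRegLimAtZero F c) :
    HasRegLimAtZero (fun t => g t * F t) (g 0 * c) := by
  obtain ⟨n, f, hf, hF, hc⟩ := hF
  refine ⟨n, fun i z => g z * f i z, fun i => hg.mul (hf i), ?_, by simp [hc]⟩
  filter_upwards [hF] with t h
  simp only [h, Finset.mul_sum, mul_assoc]

lemma log_mul (hF : HasRegLimAtZero F c) :
    HasRegLimAtZero (fun t => (Real.log t : ℂ) * F t) 0 := by
  obtain ⟨n, f, hf, hF, -⟩ := hF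
  refine ⟨n + 1, fun | 0 => fun _ => 0 | i + 1 => f i, ?_, ?_, rfl⟩
  · rintro (_ | i)
    exacts [analyticAt_const, hf i]
  · filter_upwards [hF] with t h
    rw [h, Finset.sum_range_succ' _ (n + 1), Finset.mul_sum, zero_mul, add_zero]
    exact Finset.sum_congr rfl fun i _ => by ring

lemma of_analyticAt {g : ℂ → ℂ} (hg : AnalyticAt ℂ g 0) : HasRegLimAtZero (fun t => g t) (g 0) :=
  ⟨0, fun _ => g, fun _ => hg, by simp, rfl⟩

lemma const (c : ℂ) : HasRegLimAtZero (fun _ => c) c :=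
  of_analyticAt (g := fun _ => c) analyticAt_const

lemma const_mul (a : ℂ) (hF : HasRegLimAtZero F c) : HasRegLimAtZero (fun t => a * F t) (a * c) :=
  analyticAt_mul (g := fun _ => a) analyticAt_const hF

lemma neg (hF : HasRegLimAtZero F c) : HasRegLimAtZero (fun t => - F t) (-c) := by
  simpa using hF.const_mul (-1)

lemma sub (hF : HasRegLimAtZero F c) (hG : HasRegLimAtZero G d) :
    HasRegLimAtZero (fun t => F t - G t) (c - d) := by
  simpa only [sub_eq_add_neg] using hF.add hG.neg

lemma log_pow_mul (k : ℕ) (hF : HasRegLimAtZero F c) :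
    HasRegLimAtZero (fun t => (Real.log t : ℂ) ^ k * F t) (if k = 0 then c else 0) := by
  induction k with
  | zero => simpa using hF
  | succ k ih => simpa only [pow_succ', mul_assoc, k.succ_ne_zero, if_false] using ih.log_mul

lemma sum {ι : Type*} (s : Finset ι) {F : ι → ℝ → ℂ} {c : ι → ℂ}
    (h : ∀ i ∈ s, HasRegLimAtZero (F i) (c i)) :
    HasRegLimAtZero (fun t => ∑ i ∈ s, F i t) (∑ i ∈ s, c i) := by
  classical
  induction s using Finset.induction_on with
  | empty => simpa using const 0
  | insert i s hi ih =>
    simp only [Finset.sum_insert hi]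
    exact (h i (by simp)).add (ih fun j hj => h j (by simp [hj]))

lemma mul (hF : HasRegLimAtZero F c) (hG : HasRegLimAtZero G d) :
    HasRegLimAtZero (fun t => F t * G t) (c * d) := by
  obtain ⟨n, f, hf, hF, rfl⟩ := hF
  have h := sum (Finset.range (n + 1)) fun i _ => (hG.log_pow_mul i).analyticAt_mul (hf i)
  simp only [mul_ite, mul_zero, Finset.sum_ite_eq', Finset.mem_range, Nat.succ_pos, if_true] at h
  refine h.congr ?_
  filter_upwards [hF] with t ht
  rw [ht, Finset.sum_mul]
  exact Finset.sum_congr rfl fun i _ => by ring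

end HasRegLimAtZero

lemma tendsto_sub_mul_log_pow {f : ℂ → ℂ} (hf : AnalyticAt ℂ f 0) (i : ℕ) :
    Tendsto (fun t : ℝ => (f t - f 0) * (Real.log t : ℂ) ^ i) (𝓝[>] 0) (𝓝 0) := by
  have hO : (fun t : ℝ => f t - f 0) =O[𝓝[>] 0] fun t : ℝ => t := by
    refine (hf.differentiableAt.isBigO_sub.comp_tendsto tendsto_ofReal_nhdsGT_zero).trans ?_
    exact Asymptotics.IsBigO.of_bound 1 (Eventually.of_forall fun t => by simp)
  have hlog : (fun t : ℝ => (Real.log t : ℂ) ^ i) =O[𝓝[>] 0] fun t : ℝ => |Real.log t| ^ i :=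
    Asymptotics.IsBigO.of_bound 1 (Eventually.of_forall fun t => by simp)
  exact (hO.mul hlog).trans_tendsto (tendsto_mul_abs_log_pow i)

lemma coeff_zero_eq_of_tendsto_eval_log {P : Polynomial ℂ} {d : ℂ}
    (hP : Tendsto (fun t : ℝ => P.eval (Real.log t : ℂ)) (𝓝[>] 0) (𝓝 d)) : P.coeff 0 = d := by
  have hlog : Tendsto (fun t : ℝ => ‖(Real.log t : ℂ)‖) (𝓝[>] 0) atTop := by
    simp only [Complex.norm_real]
    exact tendsto_abs_atBot_atTop.comp Real.tendsto_log_nhdsGT_zero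
  have hdeg : P.degree ≤ 0 := by
    by_contra! hpos
    exact not_tendsto_nhds_of_tendsto_atTop (P.tendsto_norm_atTop hpos hlog) _ hP.norm
  rw [Polynomial.eq_C_of_degree_le_zero hdeg] at hP
  simp only [Polynomial.eval_C] at hP
  exact tendsto_nhds_unique tendsto_const_nhds hP

namespace HasRegLimAtZero

variable {F : ℝ → ℂ} {c d : ℂ}

theorem eq_of_tendsto (hF : HasRegLimAtZero F c) (hd : Tendsto F (𝓝[>] 0) (𝓝 d)) : c = d := by
  obtain ⟨n, f, hf, hF, rfl⟩ := hF
  let P : Polynomial ℂ := ∑ i ∈ Finset.range (n + 1), Polynomial.monomial i (f i 0)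
  have hP0 : P.coeff 0 = f 0 0 := by simp [P, Polynomial.coeff_monomial]
  rw [← hP0]
  refine coeff_zero_eq_of_tendsto_eval_log ?_
  have hdiff := tendsto_finsetSum (Finset.range (n + 1)) fun i _ =>
    tendsto_sub_mul_log_pow (hf i) i
  rw [Finset.sum_const_zero] at hdiff
  refine (sub_zero d ▸ hd.sub hdiff).congr' ?_
  filter_upwards [hF] with t ht
  simp [ht, P, Polynomial.eval_finsetSum, sub_mul, Finset.sum_sub_distrib]

theorem unique (h : HasRegLimAtZero F c) (h' : HasRegLimAtZero F d) : c = d :=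
  sub_eq_zero.1 ((h.sub h').eq_of_tendsto (by simp))

theorem regLimAtZero_eq (h : HasRegLimAtZero F c) : regLimAtZero F = c :=
  (Classical.epsilon_spec ⟨c, h⟩ : HasRegLimAtZero F (regLimAtZero F)).unique h

end HasRegLimAtZero

theorem HasRegLimAtTop.unique {F : ℝ → ℂ} {c d : ℂ} (h : HasRegLimAtTop F c)
    (h' : HasRegLimAtTop F d) : c = d :=
  (hasRegLimAtTop_iff.1 h).unique (hasRegLimAtTop_iff.1 h')

theorem HasRegLimAtTop.regLimAtTop_eq {F : ℝ → ℂ} {c : ℂ} (h : HasRegLimAtTop F c) :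
    regLimAtTop F = c :=
  (Classical.epsilon_spec ⟨c, h⟩ : HasRegLimAtTop F (regLimAtTop F)).unique h

end RegularizedLimits

/-! ### Integration of logarithmic expansions -/

section LogPrimitives

lemma exists_analyticAt_primitive {g : ℂ → ℂ} (hg : AnalyticAt ℂ g 0) :
    ∃ P : ℂ → ℂ, AnalyticAt ℂ P 0 ∧ ∀ᶠ z in 𝓝 0, HasDerivAt P (g z) z := by
  obtain ⟨r, hr, hball⟩ := Metric.eventually_nhds_iff_ball.1 hg.eventually_analyticAt
  have hd : DifferentiableOn ℂ g (Metric.ball 0 r) :=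
    fun z hz => (hball z hz).differentiableAt.differentiableWithinAt
  obtain ⟨P, hP⟩ := hd.isExactOn_ball
  have hPd : DifferentiableOn ℂ P (Metric.ball 0 r) :=
    fun z hz => (hP z hz).differentiableAt.differentiableWithinAt
  exact ⟨P, hPd.analyticAt (Metric.ball_mem_nhds 0 hr),
    mem_of_superset (Metric.ball_mem_nhds 0 hr) hP⟩

lemma exists_analyticAt_eq_add_mul {g : ℂ → ℂ} (hg : AnalyticAt ℂ g 0) :
    ∃ h : ℂ → ℂ, AnalyticAt ℂ h 0 ∧ ∀ z, g z = g 0 + z * h z := by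
  obtain ⟨p, hp⟩ := hg
  refine ⟨dslope g 0, ⟨_, hp.has_fpower_series_dslope_fslope⟩, fun z => ?_⟩
  have h := sub_smul_dslope g 0 z
  rw [sub_zero, smul_eq_mul] at h
  rw [h, add_sub_cancel]

lemma hasDerivAt_ofReal_log_pow (n : ℕ) {t : ℝ} (ht : 0 < t) :
    HasDerivAt (fun t : ℝ => (Real.log t : ℂ) ^ n) (n * (Real.log t : ℂ) ^ (n - 1) / t) t := by
  refine ((Real.hasDerivAt_log ht.ne').ofReal_comp.fun_pow n).congr_deriv ?_
  push_cast
  ring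

/-- Write `g t = g 0 + t * h t` and let `P` be a primitive of `h`. Integration by parts reduces
the primitive of `h t * log t ^ n` to that of `P t * log t ^ (n - 1) / t`. -/
lemma exists_primitive_mul_log_pow_div (n : ℕ) {g : ℂ → ℂ} (hg : AnalyticAt ℂ g 0) :
    ∃ (F : ℝ → ℂ) (c : ℂ), HasRegLimAtZero F c ∧
      ∀ᶠ t : ℝ in 𝓝[>] 0, HasDerivAt F (g t * (Real.log t : ℂ) ^ n / t) t := by
  induction n generalizing g with
  | zero =>
    obtain ⟨h, hh, hgh⟩ := exists_analyticAt_eq_add_mul hg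
    obtain ⟨P, hP, hPd⟩ := exists_analyticAt_primitive hh
    refine ⟨fun t => g 0 * ((Real.log t : ℂ) ^ 1 * 1) + P t, _,
      (((HasRegLimAtZero.const 1).log_pow_mul 1).const_mul (g 0)).add (.of_analyticAt hP), ?_⟩
    filter_upwards [tendsto_ofReal_nhdsGT_zero.eventually hPd, self_mem_nhdsWithin]
      with t hPt (ht : 0 < t)
    refine ((((hasDerivAt_ofReal_log_pow 1 ht).mul_const 1).const_mul (g 0)).add
      hPt.comp_ofReal).congr_deriv ?_
    have : (t : ℂ) ≠ 0 := by exact_mod_cast ht.ne'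
    rw [hgh t]
    field_simp
    simp
  | succ n ih =>
    obtain ⟨h, hh, hgh⟩ := exists_analyticAt_eq_add_mul hg
    obtain ⟨P, hP, hPd⟩ := exists_analyticAt_primitive hh
    obtain ⟨Q, e, hQ, hQd⟩ := ih hP
    have hlog (k : ℕ) := (HasRegLimAtZero.const 1).log_pow_mul k
    refine ⟨fun t => g 0 / (n + 2) * ((Real.log t : ℂ) ^ (n + 2) * 1) +
      (P t * ((Real.log t : ℂ) ^ (n + 1) * 1) - (n + 1) * Q t), _,
      ((hlog _).const_mul _).add (((hlog _).analyticAt_mul hP).sub (hQ.const_mul (n + 1))), ?_⟩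
    filter_upwards [tendsto_ofReal_nhdsGT_zero.eventually hPd, self_mem_nhdsWithin, hQd]
      with t hPt (ht : 0 < t) hQt
    refine ((((hasDerivAt_ofReal_log_pow (n + 2) ht).mul_const 1).const_mul (g 0 / (n + 2))).add
      ((hPt.comp_ofReal.mul ((hasDerivAt_ofReal_log_pow (n + 1) ht).mul_const 1)).sub
        (hQt.const_mul (n + 1 : ℂ)))).congr_deriv ?_
    have : (t : ℂ) ≠ 0 := by exact_mod_cast ht.ne'
    have : (n : ℂ) + 2 ≠ 0 := by exact_mod_cast (by omega : n + 2 ≠ 0)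
    rw [hgh t]
    push_cast
    field_simp
    ring

lemma exists_eventuallyEq_const_of_hasDerivAt_zero {F : ℝ → ℂ}
    (hF : ∀ᶠ t : ℝ in 𝓝[>] 0, HasDerivAt F 0 t) : ∃ c, ∀ᶠ t in 𝓝[>] 0, F t = c := by
  obtain ⟨ε, hε : 0 < ε, hsub⟩ := mem_nhdsGT_iff_exists_Ioo_subset.1 hF
  refine ⟨F (ε / 2), ?_⟩
  filter_upwards [Ioo_mem_nhdsGT hε] with t ht
  exact isOpen_Ioo.is_const_of_deriv_eq_zero (𝕜 := ℝ) isPreconnected_Ioo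
    (fun t ht => (hsub ht).differentiableAt.differentiableWithinAt)
    (fun t ht => (hsub ht).deriv) ht ⟨half_pos hε, half_lt_self hε⟩

theorem exists_hasRegLimAtZero_of_hasDerivAt {F F' : ℝ → ℂ} {c : ℂ}
    (hF : ∀ᶠ t : ℝ in 𝓝[>] 0, HasDerivAt F (F' t) t)
    (h : HasRegLimAtZero (fun t => t * F' t) c) : ∃ d, HasRegLimAtZero F d := by
  obtain ⟨n, f, hf, hF', -⟩ := h
  choose P p hP hPd using fun i => exists_primitive_mul_log_pow_div i (hf i)
  have hder : ∀ᶠ t : ℝ in 𝓝[>] 0,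
      HasDerivAt (fun t => F t - ∑ i ∈ Finset.range (n + 1), P i t) 0 t := by
    have hPd' : ∀ᶠ t : ℝ in 𝓝[>] 0, ∀ i ∈ Finset.range (n + 1),
        HasDerivAt (P i) (f i t * (Real.log t : ℂ) ^ i / t) t :=
      (Finset.eventually_all _).2 fun i _ => hPd i
    filter_upwards [hF, hF', hPd', self_mem_nhdsWithin] with t hFt hexp hPt (ht : 0 < t)
    refine (hFt.sub (HasDerivAt.fun_sum hPt)).congr_deriv ?_
    have : (t : ℂ) ≠ 0 := by exact_mod_cast ht.ne'
    rw [← Finset.sum_div, ← hexp, mul_div_cancel_left₀ _ this, sub_self]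
  obtain ⟨e, he⟩ := exists_eventuallyEq_const_of_hasDerivAt_zero hder
  refine ⟨_, ((HasRegLimAtZero.sum (Finset.range (n + 1)) fun i _ => hP i).add (.const e)).congr ?_⟩
  filter_upwards [he] with t ht
  rw [← ht, add_sub_cancel]

end LogPrimitives

/-! ### Estimates for hyperlogarithms -/

section LetterSeparation

variable {c c' : ℝ} {a b : ℂ} {w : List ℂ}

/-- The letters for which hyperlogarithms are defined: those off the positive real axis. -/
def Admissible (a : ℂ) : Prop := ∀ x : ℝ, 0 < x → a ≠ x

/-- Quantitative separation of a nonzero letter from the positive real axis, with the constant `c`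
made explicit so that estimates are uniform in the letters. -/
def IsSeparated (c : ℝ) (a : ℂ) : Prop := ∀ x : ℝ, 0 < x → c * (1 + x) ≤ ‖(x : ℂ) - a‖

/-- Scale invariant separation of a letter from the positive real axis. Unlike `IsSeparated` it
allows the letter to approach or to equal zero. -/
def IsConicallySeparated (c : ℝ) (a : ℂ) : Prop := ∀ x : ℝ, 0 < x → c * x ≤ ‖(x : ℂ) - a‖

/-- The words `u σ 0^k` with `σ` separated and all letters of `u` conically separated. Their
hyperlogarithms are `O(√z)`, uniformly for words of bounded length. -/
inductive IsSeparatedWord (c : ℝ) : List ℂ → Prop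
  | base (k : ℕ) {σ : ℂ} : IsSeparated c σ → IsSeparatedWord c (σ :: List.replicate k 0)
  | cons {τ : ℂ} {w : List ℂ} :
      IsConicallySeparated c τ → IsSeparatedWord c w → IsSeparatedWord c (τ :: w)

/-- The words to which the uniform estimates apply: words of zeros and separated words. -/
def IsTameWord (c : ℝ) (w : List ℂ) : Prop :=
  w = List.replicate w.length 0 ∨ IsSeparatedWord c w

namespace IsConicallySeparated

lemma sub_ne_zero (hc : 0 < c) (h : IsConicallySeparated c a) {x : ℝ} (hx : 0 < x) :
    (x : ℂ) - a ≠ 0 :=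
  norm_pos_iff.1 ((mul_pos hc hx).trans_le (h x hx))

lemma admissible (hc : 0 < c) (h : IsConicallySeparated c a) : Admissible a :=
  fun _ hx hax => h.sub_ne_zero hc hx (by rw [hax, sub_self])

lemma mono (h : IsConicallySeparated c a) (hc : c' ≤ c) : IsConicallySeparated c' a := fun x hx =>
  (mul_le_mul_of_nonneg_right hc hx.le).trans (h x hx)

lemma zero (hc : c ≤ 1) : IsConicallySeparated c 0 := fun x hx => by
  rw [sub_zero, Complex.norm_real, Real.norm_of_nonneg hx.le]
  exact mul_le_of_le_one_left hx.le hc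

lemma mul_left {s : ℝ} (h : IsConicallySeparated c a) (hs : 0 < s) :
    IsConicallySeparated c (s * a) := fun x hx => by
  have hs0 : (s : ℂ) ≠ 0 := by exact_mod_cast hs.ne'
  have hsub : (x : ℂ) - s * a = s * ((x / s : ℝ) - a) := by
    push_cast
    field_simp
  rw [hsub, norm_mul, Complex.norm_real, Real.norm_of_nonneg hs.le]
  calc c * x = s * (c * (x / s)) := by field_simp
    _ ≤ _ := mul_le_mul_of_nonneg_left (h (x / s) (by positivity)) hs.le

end IsConicallySeparated

namespace IsSeparated

lemma isConicallySeparated (hc : 0 < c) (h : IsSeparated c a) : IsConicallySeparated c a :=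
  fun x hx => le_trans (by gcongr; linarith) (h x hx)

lemma ne_zero (hc : 0 < c) (h : IsSeparated c a) : a ≠ 0 := by
  rintro rfl
  have := h (c / 2) (by positivity)
  rw [sub_zero, Complex.norm_real, Real.norm_of_nonneg (by positivity)] at this
  nlinarith

lemma mono (h : IsSeparated c a) (hc : c' ≤ c) : IsSeparated c' a := fun x hx =>
  (mul_le_mul_of_nonneg_right hc (by linarith)).trans (h x hx)

lemma of_norm_sub_le (hc : 0 ≤ c) (h : IsSeparated (2 * c) a) (hab : ‖b - a‖ ≤ c) :
    IsSeparated c b := fun x hx => by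
  have htri : ‖(x : ℂ) - a‖ ≤ ‖(x : ℂ) - b‖ + ‖b - a‖ := norm_sub_le_norm_sub_add_norm_sub ..
  nlinarith [h x hx]

end IsSeparated

namespace Admissible

lemma sub_ne_zero (ha : Admissible a) {x : ℝ} (hx : 0 < x) : (x : ℂ) - a ≠ 0 :=
  _root_.sub_ne_zero.2 (ha x hx).symm

lemma exists_le_norm_sub (ha : Admissible a) (h0 : a ≠ 0) :
    ∃ d, 0 < d ∧ ∀ x : ℝ, 0 < x → d ≤ ‖(x : ℂ) - a‖ := by
  have hclosed : IsClosed ((fun x : ℝ => (x : ℂ)) '' Set.Ici 0) :=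
    Complex.isometry_ofReal.isClosedEmbedding.isClosedMap _ isClosed_Ici
  have hnot : a ∉ (fun x : ℝ => (x : ℂ)) '' Set.Ici 0 := by
    rintro ⟨x, hx, rfl⟩
    exact ha x (hx.lt_of_ne fun h => h0 (by simp [← h])) rfl
  refine ⟨_, (hclosed.notMem_iff_infDist_pos ⟨_, 0, Set.self_mem_Ici, rfl⟩).1 hnot, fun x hx => ?_⟩
  rw [← dist_eq_norm, dist_comm]
  exact Metric.infDist_le_dist_of_mem ⟨x, hx.le, rfl⟩

lemma exists_isSeparated (ha : Admissible a) (h0 : a ≠ 0) :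
    ∃ c, 0 < c ∧ c ≤ 1 ∧ IsSeparated c a := by
  obtain ⟨d, hd, hda⟩ := ha.exists_le_norm_sub h0
  have hn : 0 ≤ ‖a‖ := norm_nonneg a
  refine ⟨d / (1 + ‖a‖ + d), by positivity, (div_le_one (by positivity)).2 (by linarith),
    fun x hx => ?_⟩
  have hfar : x - ‖a‖ ≤ ‖(x : ℂ) - a‖ := by
    simpa only [Complex.norm_real, Real.norm_of_nonneg hx.le] using norm_sub_norm_le (x : ℂ) a
  rw [div_mul_eq_mul_div, div_le_iff₀ (by positivity)]
  nlinarith [hda x hx]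

end Admissible

namespace IsSeparatedWord

lemma exists_mem_ne_zero (hc : 0 < c) (h : IsSeparatedWord c w) : ∃ τ ∈ w, τ ≠ 0 := by
  induction h with
  | base k hσ => exact ⟨_, by simp, hσ.ne_zero hc⟩
  | cons _ _ ih => exact ih.imp fun τ h => ⟨List.mem_cons_of_mem _ h.1, h.2⟩

lemma isConicallySeparated (hc : 0 < c) (hc1 : c ≤ 1) (h : IsSeparatedWord c w) :
    ∀ a ∈ w, IsConicallySeparated c a := by
  induction h with
  | base k hσ =>
    refine List.forall_mem_cons.2 ⟨hσ.isConicallySeparated hc, fun a ha => ?_⟩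
    rw [List.eq_of_mem_replicate ha]
    exact .zero hc1
  | cons hτ _ ih => exact List.forall_mem_cons.2 ⟨hτ, ih⟩

lemma append_singleton {u : List ℂ} (hu : ∀ a ∈ u, IsConicallySeparated c a)
    (hb : IsSeparated c b) : IsSeparatedWord c (u ++ [b]) := by
  induction u with
  | nil => exact .base 0 hb
  | cons a u ih =>
    obtain ⟨ha, hu⟩ := List.forall_mem_cons.1 hu
    exact .cons ha (ih hu)

end IsSeparatedWord

namespace IsTameWord

lemma of_forall_mem (hc : 0 < c) (hc1 : c ≤ 1) (hw : ∀ a ∈ w, a = 0 ∨ IsSeparated c a) :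
    IsTameWord c w := by
  induction w with
  | nil => exact Or.inl rfl
  | cons a w ih =>
    obtain ⟨ha, hw⟩ := List.forall_mem_cons.1 hw
    rcases ih hw, ha with ⟨h | h, rfl | ha⟩
    · exact Or.inl (by rw [List.length_cons, List.replicate_succ, ← h])
    · exact Or.inr (h ▸ .base _ ha)
    · exact Or.inr (.cons (.zero hc1) h)
    · exact Or.inr (.cons (ha.isConicallySeparated hc) h)

lemma tail (h : IsTameWord c (a :: w)) : IsTameWord c w := by
  rcases h with h | h
  · rw [List.length_cons, List.replicate_succ, List.cons.injEq] at h
    exact Or.inl h.2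
  · cases h with
    | base k _ => exact Or.inl (by simp)
    | cons _ h => exact Or.inr h

lemma drop (h : IsTameWord c w) (j : ℕ) : IsTameWord c (w.drop j) := by
  induction j generalizing w with
  | zero => exact h
  | succ j ih =>
    cases w with
    | nil => exact h
    | cons a w => exact ih h.tail

lemma isConicallySeparated (hc : 0 < c) (hc1 : c ≤ 1) (h : IsTameWord c w) :
    ∀ a ∈ w, IsConicallySeparated c a := by
  rcases h with h | h
  · intro a ha
    rw [h] at ha
    rw [List.eq_of_mem_replicate ha]
    exact .zero hc1
  · exact h.isConicallySeparated hc hc1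

lemma admissible (hc : 0 < c) (hc1 : c ≤ 1) (h : IsTameWord c w) : ∀ a ∈ w, Admissible a :=
  fun a ha => (h.isConicallySeparated hc hc1 a ha).admissible hc

end IsTameWord

lemma exists_forall_mem_isSeparated (hw : ∀ a ∈ w, Admissible a) :
    ∃ c, 0 < c ∧ c ≤ 1 ∧ ∀ a ∈ w, a = 0 ∨ IsSeparated c a := by
  induction w with
  | nil => exact ⟨1, one_pos, le_rfl, by simp⟩
  | cons a w ih =>
    obtain ⟨ha, hw⟩ := List.forall_mem_cons.1 hw
    obtain ⟨c, hc, hc1, h⟩ := ih hw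
    rcases eq_or_ne a 0 with rfl | h0
    · exact ⟨c, hc, hc1, List.forall_mem_cons.2 ⟨Or.inl rfl, h⟩⟩
    · obtain ⟨c', hc', -, h'⟩ := ha.exists_isSeparated h0
      exact ⟨min c c', lt_min hc hc', (min_le_left ..).trans hc1, List.forall_mem_cons.2
        ⟨Or.inr (h'.mono (min_le_right ..)),
          fun b hb => (h b hb).imp_right fun h => h.mono (min_le_left ..)⟩⟩

lemma exists_isTameWord (hw : ∀ a ∈ w, Admissible a) : ∃ c, 0 < c ∧ c ≤ 1 ∧ IsTameWord c w := by
  obtain ⟨c, hc, hc1, h⟩ := exists_forall_mem_isSeparated hw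
  exact ⟨c, hc, hc1, .of_forall_mem hc hc1 h⟩

end LetterSeparation

section SqrtBoundedIntegrals

lemma intervalIntegrable_div_sqrt (K : ℝ) {z : ℝ} (hz : 0 ≤ z) :
    IntervalIntegrable (fun x : ℝ => K / √x) volume 0 z := by
  have h : IntervalIntegrable (fun x : ℝ => x ^ (-(1 / 2) : ℝ)) volume 0 z :=
    intervalIntegral.intervalIntegrable_rpow' (by norm_num)
  refine (h.const_mul K).congr fun x hx => ?_
  rw [Set.uIoc_of_le hz] at hx
  simp only [Real.rpow_neg hx.1.le, Real.sqrt_eq_rpow, div_eq_mul_inv K]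

lemma integral_div_sqrt (K : ℝ) {z : ℝ} (hz : 0 ≤ z) :
    ∫ x in (0 : ℝ)..z, K / √x = 2 * K * √z := by
  have hpow : ∀ x ∈ Set.uIcc 0 z, K / √x = K * x ^ (-(1 / 2) : ℝ) := fun x hx => by
    rw [Set.uIcc_of_le hz] at hx
    rw [Real.rpow_neg hx.1, Real.sqrt_eq_rpow, div_eq_mul_inv K]
  rw [intervalIntegral.integral_congr hpow, intervalIntegral.integral_const_mul,
    integral_rpow (Or.inl (by norm_num)), Real.sqrt_eq_rpow,
    show (-(1 / 2) + 1 : ℝ) = 1 / 2 by norm_num, Real.zero_rpow (by norm_num)]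
  ring

lemma tendsto_zero_of_norm_le_mul_sqrt {F : ℝ → ℂ} {C : ℝ} (hF : ∀ x, 0 < x → ‖F x‖ ≤ C * √x) :
    Tendsto F (𝓝[>] 0) (𝓝 0) := by
  have hsqrt : ContinuousAt (fun x => C * √x) 0 := by fun_prop
  refine squeeze_zero_norm' ?_ (by simpa using hsqrt.tendsto.mono_left nhdsWithin_le_nhds)
  filter_upwards [self_mem_nhdsWithin] with x hx using hF x hx

variable {g : ℝ → ℂ} {K : ℝ}

lemma norm_integral_le_mul_sqrt (hb : ∀ x, 0 < x → ‖g x‖ ≤ K / √x) {z : ℝ} (hz : 0 < z) :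
    ‖∫ x in (0 : ℝ)..z, g x‖ ≤ 2 * K * √z := by
  rw [← integral_div_sqrt K hz.le]
  exact intervalIntegral.norm_integral_le_of_norm_le hz.le
    (Eventually.of_forall fun x hx => hb x hx.1) (intervalIntegrable_div_sqrt K hz.le)

lemma hasDerivAt_integral_of_norm_le_div_sqrt (hc : ContinuousOn g (Set.Ioi 0))
    (hb : ∀ x, 0 < x → ‖g x‖ ≤ K / √x) {z : ℝ} (hz : 0 < z) :
    HasDerivAt (fun z => ∫ x in (0 : ℝ)..z, g x) (g z) z := by
  refine intervalIntegral.integral_hasDerivAt_right ?_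
    (hc.stronglyMeasurableAtFilter isOpen_Ioi z hz) (hc.continuousAt (Ioi_mem_nhds hz))
  refine (intervalIntegrable_div_sqrt K hz.le).mono_fun' ?_ ?_
  · rw [Set.uIoc_of_le hz.le]
    exact (hc.mono fun x hx => hx.1).aestronglyMeasurable measurableSet_Ioc
  · refine (ae_restrict_mem measurableSet_uIoc).mono fun x hx => hb x ?_
    rw [Set.uIoc_of_le hz.le] at hx
    exact hx.1

lemma eq_of_hasDerivAt_zero {F : ℝ → ℂ} (hF : ∀ z, 0 < z → HasDerivAt F 0 z) {y z : ℝ}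
    (hy : 0 < y) (hz : 0 < z) : F y = F z :=
  isOpen_Ioi.is_const_of_deriv_eq_zero (𝕜 := ℝ) isPreconnected_Ioi
    (fun t ht => (hF t ht).differentiableAt.differentiableWithinAt)
    (fun t ht => (hF t ht).deriv) hy hz

lemma eq_of_hasDerivAt_of_hasRegLimAtZero {F G F' : ℝ → ℂ} {c : ℂ}
    (hF : ∀ z, 0 < z → HasDerivAt F (F' z) z) (hG : ∀ z, 0 < z → HasDerivAt G (F' z) z)
    (hFc : HasRegLimAtZero F c) (hGc : HasRegLimAtZero G c) {z : ℝ} (hz : 0 < z) : F z = G z := by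
  have hconst : HasRegLimAtZero (fun t => F t - G t) (F z - G z) := by
    refine (HasRegLimAtZero.const _).congr ?_
    filter_upwards [self_mem_nhdsWithin] with t ht
    exact eq_of_hasDerivAt_zero (fun s hs => ((hF s hs).sub (hG s hs)).congr_deriv (sub_self _))
      hz ht
  simpa only [sub_self, sub_eq_zero] using hconst.unique (hFc.sub hGc)

lemma eq_integral_of_hasDerivAt_of_hasRegLimAtZero {F : ℝ → ℂ}
    (hF : ∀ z, 0 < z → HasDerivAt F (g z) z) (hF0 : HasRegLimAtZero F 0)
    (hc : ContinuousOn g (Set.Ioi 0)) (hb : ∀ x, 0 < x → ‖g x‖ ≤ K / √x) {z : ℝ} (hz : 0 < z) :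
    F z = ∫ x in (0 : ℝ)..z, g x := by
  have hint : Tendsto (fun s => ∫ x in (0 : ℝ)..s, g x) (𝓝[>] 0) (𝓝 0) :=
    tendsto_zero_of_norm_le_mul_sqrt fun _ hs => norm_integral_le_mul_sqrt hb hs
  have hlim : Tendsto F (𝓝[>] 0) (𝓝 (F z - ∫ x in (0 : ℝ)..z, g x)) := by
    refine (zero_add (F z - _) ▸ hint.add_const (F z - ∫ x in (0 : ℝ)..z, g x)).congr' ?_
    filter_upwards [self_mem_nhdsWithin] with s hs
    rw [eq_of_hasDerivAt_zero (F := fun s => F s - ∫ x in (0 : ℝ)..s, g x) (fun t ht =>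
      ((hF t ht).sub (hasDerivAt_integral_of_norm_le_div_sqrt hc hb ht)).congr_deriv (sub_self _))
      hz hs]
    exact add_sub_cancel ..
  exact sub_eq_zero.1 (hF0.eq_of_tendsto hlim).symm

end SqrtBoundedIntegrals

section HyperlogBounds

lemma hyperlogWord_nil (z : ℝ) : hyperlogWord [] z = 1 := rfl

lemma hyperlogWord_cons {σ : ℂ} {w : List ℂ} (h : ∃ τ ∈ σ :: w, τ ≠ 0) (z : ℝ) :
    hyperlogWord (σ :: w) z = ∫ x in (0 : ℝ)..z, hyperlogWord w x / ((x : ℂ) - σ) := by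
  rw [hyperlogWord, if_neg (by push Not; exact h)]

lemma hyperlogWord_replicate (k : ℕ) (z : ℝ) :
    hyperlogWord (List.replicate k 0) z = (Real.log z : ℂ) ^ k / (k.factorial : ℂ) := by
  cases k with
  | zero => simp [hyperlogWord_nil]
  | succ k =>
    have hzero : ∀ τ ∈ (0 : ℂ) :: List.replicate k 0, τ = 0 :=
      List.forall_mem_cons.2 ⟨rfl, fun _ => List.eq_of_mem_replicate⟩
    rw [List.replicate_succ, hyperlogWord, if_pos hzero]
    simp

lemma continuousOn_hyperlogWord_replicate (k : ℕ) :
    ContinuousOn (hyperlogWord (List.replicate k 0)) (Set.Ioi 0) := by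
  have hlog : ContinuousOn (fun z : ℝ => (Real.log z : ℂ)) (Set.Ioi 0) :=
    Complex.continuous_ofReal.comp_continuousOn
      (Real.continuousOn_log.mono fun x (hx : 0 < x) => hx.ne')
  exact ((hlog.pow k).div_const _).congr fun z _ => hyperlogWord_replicate k z

lemma abs_log_pow_div_factorial_le {m : ℝ} (hm : 0 < m) (k : ℕ) (x : ℝ) :
    |Real.log x| ^ k / k.factorial ≤ m ^ k * Real.exp (|Real.log x| / m) :=
  calc |Real.log x| ^ k / k.factorial = m ^ k * ((|Real.log x| / m) ^ k / k.factorial) := by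
        rw [div_pow]; field_simp
    _ ≤ _ := by gcongr; exact Real.pow_div_factorial_le_exp _ (by positivity) k

lemma exp_half_abs_log_mul_sqrt_le {x : ℝ} (hx : 0 < x) :
    Real.exp (|Real.log x| / 2) * √x ≤ 1 + x := by
  have hsqrt : √x = Real.exp (Real.log x / 2) := by
    rw [← Real.log_sqrt hx.le, Real.exp_log (Real.sqrt_pos.2 hx)]
  rw [hsqrt, ← Real.exp_add]
  rcases abs_cases (Real.log x) with ⟨h, -⟩ | ⟨h, -⟩
  · rw [h, add_halves, Real.exp_log hx]
    linarith
  · rw [h, neg_div, neg_add_cancel, Real.exp_zero]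
    linarith

lemma norm_hyperlogWord_replicate_mul_sqrt_le (k : ℕ) {x : ℝ} (hx : 0 < x) :
    ‖hyperlogWord (List.replicate k 0) x‖ * √x ≤ 2 ^ k * (1 + x) := by
  rw [hyperlogWord_replicate, norm_div, norm_pow, Complex.norm_real, Complex.norm_natCast,
    Real.norm_eq_abs]
  calc |Real.log x| ^ k / k.factorial * √x
      ≤ 2 ^ k * Real.exp (|Real.log x| / 2) * √x := by
        gcongr; exact abs_log_pow_div_factorial_le two_pos k x
    _ ≤ _ := by rw [mul_assoc]; gcongr; exact exp_half_abs_log_mul_sqrt_le hx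

variable {c : ℝ} {σ y : ℂ}

lemma IsConicallySeparated.norm_div_sub_le (hc : 0 < c) (hσ : IsConicallySeparated c σ) {C x : ℝ}
    (hx : 0 < x) (hC : 0 ≤ C) (hy : ‖y‖ ≤ C * √x) : ‖y / ((x : ℂ) - σ)‖ ≤ C / c / √x := by
  have hcx : 0 < c * x := by positivity
  rw [norm_div, div_div, div_le_div_iff₀ (hcx.trans_le (hσ x hx)) (by positivity)]
  calc ‖y‖ * (c * √x) ≤ C * √x * (c * √x) := by gcongr
    _ = C * (c * (√x * √x)) := by ring
    _ = C * (c * x) := by rw [Real.mul_self_sqrt hx.le]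
    _ ≤ _ := by gcongr; exact hσ x hx

lemma IsSeparated.norm_div_sub_le (hc : 0 < c) (hσ : IsSeparated c σ) {D x : ℝ} (hx : 0 < x)
    (hD : 0 ≤ D) (hy : ‖y‖ * √x ≤ D * (1 + x)) : ‖y / ((x : ℂ) - σ)‖ ≤ D / c / √x := by
  have hcx : 0 < c * (1 + x) := by positivity
  rw [norm_div, div_div, div_le_div_iff₀ (hcx.trans_le (hσ x hx)) (by positivity)]
  calc ‖y‖ * (c * √x) = c * (‖y‖ * √x) := by ring
    _ ≤ c * (D * (1 + x)) := by gcongr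
    _ = D * (c * (1 + x)) := by ring
    _ ≤ _ := by gcongr; exact hσ x hx

lemma IsConicallySeparated.continuousOn_div_sub (hc : 0 < c) (hσ : IsConicallySeparated c σ)
    {f : ℝ → ℂ} (hf : ContinuousOn f (Set.Ioi 0)) :
    ContinuousOn (fun x : ℝ => f x / ((x : ℂ) - σ)) (Set.Ioi 0) :=
  hf.div (by fun_prop) fun _ hx => hσ.sub_ne_zero hc hx

lemma exists_norm_hyperlogWord_div_sub_le_of_norm_le (hc : 0 < c) {n : ℕ} {C : ℝ} (hC : 0 ≤ C)
    (hbound : ∀ w : List ℂ, w.length ≤ n → IsSeparatedWord c w →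
      ∀ x, 0 < x → ‖hyperlogWord w x‖ ≤ C * √x) :
    ∃ K, 0 ≤ K ∧ ∀ (σ : ℂ) (w : List ℂ), w.length ≤ n → IsSeparatedWord c (σ :: w) →
      ∀ x : ℝ, 0 < x → ‖hyperlogWord w x / ((x : ℂ) - σ)‖ ≤ K / √x := by
  refine ⟨(C + 2 ^ n) / c, by positivity, fun σ w hw h x hx => ?_⟩
  cases h with
  | base k hσ =>
    rw [List.length_replicate] at hw
    refine (hσ.norm_div_sub_le hc hx (by positivity)
      (norm_hyperlogWord_replicate_mul_sqrt_le k hx)).trans ?_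
    gcongr
    exact (pow_le_pow_right₀ one_le_two hw).trans (le_add_of_nonneg_left hC)
  | cons hσ hw' =>
    refine (hσ.norm_div_sub_le hc hx hC (hbound w hw hw' x hx)).trans ?_
    gcongr
    exact le_add_of_nonneg_right (by positivity)

theorem exists_continuousOn_and_norm_hyperlogWord_le (hc : 0 < c) (hc1 : c ≤ 1) (n : ℕ) :
    ∃ C : ℝ, 0 ≤ C ∧ ∀ w : List ℂ, w.length ≤ n → IsSeparatedWord c w →
      ContinuousOn (hyperlogWord w) (Set.Ioi 0) ∧ ∀ x, 0 < x → ‖hyperlogWord w x‖ ≤ C * √x := by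
  induction n with
  | zero =>
    refine ⟨0, le_rfl, fun w hw h => ?_⟩
    obtain rfl := List.length_eq_zero_iff.1 (Nat.le_zero.1 hw)
    nomatch h
  | succ n ih =>
    obtain ⟨C, hC, hn⟩ := ih
    obtain ⟨K, hK, hdiv⟩ := exists_norm_hyperlogWord_div_sub_le_of_norm_le hc hC
      fun w hw h => (hn w hw h).2
    refine ⟨2 * K, by positivity, fun w hw h => ?_⟩
    obtain ⟨σ, w, rfl⟩ : ∃ σ v, w = σ :: v := by cases h <;> exact ⟨_, _, rfl⟩
    rw [List.length_cons, Nat.succ_le_succ_iff] at hw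
    have hcont : ContinuousOn (hyperlogWord w) (Set.Ioi 0) := by
      cases h with
      | base k _ => exact continuousOn_hyperlogWord_replicate k
      | cons _ h => exact (hn w hw h).1
    have hσ := h.isConicallySeparated hc hc1 σ (by simp)
    rw [funext (hyperlogWord_cons (h.exists_mem_ne_zero hc))]
    exact ⟨fun z hz => (hasDerivAt_integral_of_norm_le_div_sqrt (hσ.continuousOn_div_sub hc hcont)
      (hdiv σ w hw h) hz).continuousAt.continuousWithinAt,
      fun z hz => norm_integral_le_mul_sqrt (hdiv σ w hw h) hz⟩

lemma exists_norm_hyperlogWord_le (hc : 0 < c) (hc1 : c ≤ 1) (n : ℕ) :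
    ∃ C : ℝ, 0 ≤ C ∧ ∀ w : List ℂ, w.length ≤ n → IsSeparatedWord c w →
      ∀ x, 0 < x → ‖hyperlogWord w x‖ ≤ C * √x := by
  obtain ⟨C, hC, h⟩ := exists_continuousOn_and_norm_hyperlogWord_le hc hc1 n
  exact ⟨C, hC, fun w hw hsep => (h w hw hsep).2⟩

lemma exists_norm_hyperlogWord_div_sub_le (hc : 0 < c) (hc1 : c ≤ 1) (n : ℕ) :
    ∃ K, 0 ≤ K ∧ ∀ (σ : ℂ) (w : List ℂ), w.length ≤ n → IsSeparatedWord c (σ :: w) →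
      ∀ x : ℝ, 0 < x → ‖hyperlogWord w x / ((x : ℂ) - σ)‖ ≤ K / √x := by
  obtain ⟨C, hC, h⟩ := exists_norm_hyperlogWord_le hc hc1 n
  exact exists_norm_hyperlogWord_div_sub_le_of_norm_le hc hC h

end HyperlogBounds

/-! ### Differentiation and expansions of hyperlogarithms -/

section HyperlogExpansions

variable {σ : ℂ} {w : List ℂ}

theorem continuousOn_hyperlogWord (hw : ∀ a ∈ w, Admissible a) :
    ContinuousOn (hyperlogWord w) (Set.Ioi 0) := by
  obtain ⟨c, hc, hc1, h | h⟩ := exists_isTameWord hw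
  · rw [h]
    exact continuousOn_hyperlogWord_replicate _
  · obtain ⟨C, -, hC⟩ := exists_continuousOn_and_norm_hyperlogWord_le hc hc1 w.length
    exact (hC w le_rfl h).1

lemma hasDerivAt_hyperlogWord_replicate (k : ℕ) {z : ℝ} (hz : 0 < z) :
    HasDerivAt (hyperlogWord (List.replicate (k + 1) 0))
      (hyperlogWord (List.replicate k 0) z / z) z := by
  simp only [funext (hyperlogWord_replicate (k + 1)), hyperlogWord_replicate k]
  refine ((hasDerivAt_ofReal_log_pow (k + 1) hz).div_const _).congr_deriv ?_
  have hz0 : (z : ℂ) ≠ 0 := by exact_mod_cast hz.ne'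
  have hk : (k : ℂ) + 1 ≠ 0 := by exact_mod_cast k.succ_ne_zero
  have hfac : (k.factorial : ℂ) ≠ 0 := by exact_mod_cast k.factorial_ne_zero
  rw [Nat.factorial_succ, Nat.add_sub_cancel]
  push_cast
  field_simp

theorem hasDerivAt_hyperlogWord (hw : ∀ a ∈ σ :: w, Admissible a) {z : ℝ} (hz : 0 < z) :
    HasDerivAt (hyperlogWord (σ :: w)) (hyperlogWord w z / ((z : ℂ) - σ)) z := by
  obtain ⟨c, hc, hc1, h | h⟩ := exists_isTameWord hw
  · rw [List.length_cons, List.replicate_succ, List.cons.injEq] at h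
    obtain ⟨rfl, h⟩ := h
    rw [h, sub_zero]
    exact hasDerivAt_hyperlogWord_replicate _ hz
  · obtain ⟨K, -, hK⟩ := exists_norm_hyperlogWord_div_sub_le hc hc1 w.length
    rw [funext (hyperlogWord_cons (h.exists_mem_ne_zero hc))]
    exact hasDerivAt_integral_of_norm_le_div_sqrt
      ((h.isConicallySeparated hc hc1 σ (by simp)).continuousOn_div_sub hc
        (continuousOn_hyperlogWord (List.forall_mem_cons.1 hw).2)) (hK σ w le_rfl h) hz

lemma exists_hasRegLimAtZero_of_hasDerivAt_div_sub {F F' : ℝ → ℂ} {c : ℂ} (a : ℂ)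
    (hF : ∀ᶠ t : ℝ in 𝓝[>] 0, HasDerivAt F (F' t / ((t : ℂ) - a)) t)
    (hF' : HasRegLimAtZero F' c) : ∃ d, HasRegLimAtZero F d := by
  rcases eq_or_ne a 0 with rfl | ha
  · refine exists_hasRegLimAtZero_of_hasDerivAt hF (hF'.congr ?_)
    filter_upwards [self_mem_nhdsWithin] with t (ht : 0 < t)
    have : (t : ℂ) ≠ 0 := by exact_mod_cast ht.ne'
    rw [sub_zero, mul_div_cancel₀ _ this]
  · have hA : AnalyticAt ℂ (fun z : ℂ => z / (z - a)) 0 :=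
      analyticAt_id.div (analyticAt_id.sub analyticAt_const) (by simpa using ha)
    exact exists_hasRegLimAtZero_of_hasDerivAt hF
      ((hF'.analyticAt_mul hA).congr (Eventually.of_forall fun t => by ring))

lemma exists_hasRegLimAtTop_of_hasDerivAt_div_sub {F F' : ℝ → ℂ} {c : ℂ} (a : ℂ)
    (hF : ∀ᶠ z : ℝ in atTop, HasDerivAt F (F' z / ((z : ℂ) - a)) z)
    (hF' : HasRegLimAtTop F' c) : ∃ d, HasRegLimAtTop F d := by
  simp only [hasRegLimAtTop_iff] at hF' ⊢
  have hA : AnalyticAt ℂ (fun s : ℂ => -(1 - a * s)⁻¹) 0 :=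
    ((analyticAt_const.sub (analyticAt_const.mul analyticAt_id)).inv (by simp)).neg
  refine exists_hasRegLimAtZero_of_hasDerivAt
    (F' := fun s : ℝ => (-(s ^ 2)⁻¹ : ℝ) • (F' s⁻¹ / (((s⁻¹ : ℝ) : ℂ) - a))) ?_
    ((hF'.analyticAt_mul hA).congr ?_)
  · filter_upwards [tendsto_inv_nhdsGT_zero.eventually hF, self_mem_nhdsWithin] with s hs hs0
    exact hs.scomp s (hasDerivAt_inv (Set.mem_Ioi.1 hs0).ne')
  · filter_upwards [self_mem_nhdsWithin] with s (hs : 0 < s)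
    have hs0 : (s : ℂ) ≠ 0 := by exact_mod_cast hs.ne'
    have hsub : (s : ℂ)⁻¹ - a = (1 - a * s) / s := by field_simp
    rw [Complex.real_smul]
    push_cast
    rw [hsub]
    field_simp

lemma hasRegLimAtZero_hyperlogWord_replicate (k : ℕ) :
    HasRegLimAtZero (hyperlogWord (List.replicate (k + 1) 0)) 0 := by
  have h := ((HasRegLimAtZero.const 1).log_pow_mul (k + 1)).const_mul ((k + 1).factorial : ℂ)⁻¹
  rw [if_neg k.succ_ne_zero, mul_zero] at h
  refine h.congr (Eventually.of_forall fun t => ?_)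
  rw [hyperlogWord_replicate]
  ring

theorem hasRegLimAtZero_hyperlogWord (hw : ∀ a ∈ w, Admissible a) :
    HasRegLimAtZero (hyperlogWord w) (if w = [] then 1 else 0) := by
  induction w with
  | nil => exact if_pos rfl ▸ HasRegLimAtZero.const 1
  | cons σ w ih =>
    rw [if_neg (List.cons_ne_nil σ w)]
    obtain ⟨c, hc, hc1, h | h⟩ := exists_isTameWord hw
    · rw [h]
      exact hasRegLimAtZero_hyperlogWord_replicate _
    · obtain ⟨d, hd⟩ := exists_hasRegLimAtZero_of_hasDerivAt_div_sub σ
        (by filter_upwards [self_mem_nhdsWithin] with t ht using hasDerivAt_hyperlogWord hw ht)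
        (ih (List.forall_mem_cons.1 hw).2)
      obtain ⟨C, -, hC⟩ := exists_norm_hyperlogWord_le hc hc1 (σ :: w).length
      rwa [hd.eq_of_tendsto (tendsto_zero_of_norm_le_mul_sqrt (hC _ le_rfl h))] at hd

theorem exists_hasRegLimAtTop_hyperlogWord (hw : ∀ a ∈ w, Admissible a) :
    ∃ c, HasRegLimAtTop (hyperlogWord w) c := by
  induction w with
  | nil => exact ⟨1, hasRegLimAtTop_iff.2 (HasRegLimAtZero.const 1)⟩
  | cons σ w ih =>
    obtain ⟨c, hc⟩ := ih (List.forall_mem_cons.1 hw).2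
    exact exists_hasRegLimAtTop_of_hasDerivAt_div_sub σ
      (by filter_upwards [eventually_gt_atTop 0] with z hz using hasDerivAt_hyperlogWord hw hz) hc

end HyperlogExpansions

/-! ### The shuffle relation for hyperlogarithms -/

section HyperlogShuffle

variable {α : Type*} {ev : α → ℂ}

/-- `hyperlog`, the linear extension of `w ↦ L_w(z)`, as a bundled linear map of the word. -/
def hyperlogₗ (ev : α → ℂ) (z : ℝ) : WordSpace α →ₗ[ℚ] ℂ :=
  Finsupp.linearCombination ℚ fun w => hyperlogWord (w.map ev) z

lemma hyperlog_eq_hyperlogₗ (ev : α → ℂ) (x : WordSpace α) (z : ℝ) :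
    hyperlog ev x z = hyperlogₗ ev z x := by
  simp only [hyperlog, hyperlogₗ, Finsupp.linearCombination_apply, Rat.smul_def]

lemma hyperlogₗ_ofWord (ev : α → ℂ) (z : ℝ) (w : List α) :
    hyperlogₗ ev z (ofWord w) = hyperlogWord (w.map ev) z := by
  simp [hyperlogₗ, ofWord]

/-- The elements of the word space whose hyperlogarithms converge: the span of all words whose
letters have admissible values. -/
def admissibleSpan (ev : α → ℂ) : Submodule ℚ (WordSpace α) :=
  Submodule.span ℚ (ofWord '' {w | ∀ a ∈ w.map ev, Admissible a})

lemma shuffleWord_mem_admissibleSpan {u v : List α} (hu : ∀ a ∈ u.map ev, Admissible a)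
    (hv : ∀ a ∈ v.map ev, Admissible a) : shuffleWord u v ∈ admissibleSpan ev := by
  refine Submodule.span_mono (Set.image_mono fun w hw a ha => ?_) (shuffleWord_mem_span_perm u v)
  rw [(hw.map ev).mem_iff, List.map_append, List.mem_append] at ha
  exact ha.elim (hu a) (hv a)

lemma hasDerivAt_hyperlogₗ_consₗ {a : α} (ha : Admissible (ev a)) {x : WordSpace α}
    (hx : x ∈ admissibleSpan ev) {z : ℝ} (hz : 0 < z) :
    HasDerivAt (fun z => hyperlogₗ ev z (consₗ a x)) (hyperlogₗ ev z x / ((z : ℂ) - ev a)) z := by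
  induction hx using Submodule.span_induction with
  | mem x hx =>
    obtain ⟨w, hw, rfl⟩ := hx
    simp only [consₗ_ofWord, hyperlogₗ_ofWord, List.map_cons]
    exact hasDerivAt_hyperlogWord (List.forall_mem_cons.2 ⟨ha, hw⟩) hz
  | zero => simpa using hasDerivAt_const z (0 : ℂ)
  | add x y _ _ hx hy =>
    simp only [map_add, add_div]
    exact hx.add hy
  | smul q x _ hx =>
    simp only [map_smul, Rat.smul_def, mul_div_assoc]
    exact hx.const_mul _

lemma hasRegLimAtZero_hyperlogₗ_consₗ {a : α} (ha : Admissible (ev a)) {x : WordSpace α}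
    (hx : x ∈ admissibleSpan ev) : HasRegLimAtZero (fun z => hyperlogₗ ev z (consₗ a x)) 0 := by
  induction hx using Submodule.span_induction with
  | mem x hx =>
    obtain ⟨w, hw, rfl⟩ := hx
    simp only [consₗ_ofWord, hyperlogₗ_ofWord, List.map_cons]
    simpa using hasRegLimAtZero_hyperlogWord (List.forall_mem_cons.2 ⟨ha, hw⟩)
  | zero => simpa using HasRegLimAtZero.const 0
  | add x y _ _ hx hy => simpa using hx.add hy
  | smul q x _ hx => simpa [Rat.smul_def] using hx.const_mul q

/-- Both sides of the relation for `a u` and `b v` vanish at `0` in the regularized sense and, by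
the relation for shorter words, have the same derivative. -/
theorem hyperlogₗ_shuffleWord {u v : List α} (hu : ∀ a ∈ u.map ev, Admissible a)
    (hv : ∀ a ∈ v.map ev, Admissible a) {z : ℝ} (hz : 0 < z) :
    hyperlogₗ ev z (shuffleWord u v) =
      hyperlogWord (u.map ev) z * hyperlogWord (v.map ev) z := by
  induction u generalizing v z with
  | nil => simp [shuffleWord_nil_left, hyperlogₗ_ofWord, hyperlogWord_nil]
  | cons a u ihu =>
    induction v generalizing z with
    | nil => simp [shuffleWord_nil_right, hyperlogₗ_ofWord, hyperlogWord_nil]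
    | cons b v ihv =>
      obtain ⟨ha, hu'⟩ := List.forall_mem_cons.1 hu
      obtain ⟨hb, hv'⟩ := List.forall_mem_cons.1 hv
      have hau := shuffleWord_mem_admissibleSpan hu' hv
      have hbv := shuffleWord_mem_admissibleSpan hu hv'
      simp only [shuffleWord_cons_cons, map_add]
      refine eq_of_hasDerivAt_of_hasRegLimAtZero (c := 0)
        (F := fun z => hyperlogₗ ev z (consₗ a (shuffleWord u (b :: v))) +
          hyperlogₗ ev z (consₗ b (shuffleWord (a :: u) v)))
        (G := fun z => hyperlogWord ((a :: u).map ev) z * hyperlogWord ((b :: v).map ev) z)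
        (F' := fun z => hyperlogₗ ev z (shuffleWord u (b :: v)) / ((z : ℂ) - ev a) +
          hyperlogₗ ev z (shuffleWord (a :: u) v) / ((z : ℂ) - ev b))
        (fun z hz => (hasDerivAt_hyperlogₗ_consₗ ha hau hz).add
          (hasDerivAt_hyperlogₗ_consₗ hb hbv hz)) (fun z hz => ?_) ?_ ?_ hz
      · rw [ihu hu' hv hz, ihv hv' hz]
        refine ((hasDerivAt_hyperlogWord hu hz).mul (hasDerivAt_hyperlogWord hv hz)).congr_deriv ?_
        simp only [List.map_cons]
        ring
      · simpa using (hasRegLimAtZero_hyperlogₗ_consₗ ha hau).add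
          (hasRegLimAtZero_hyperlogₗ_consₗ hb hbv)
      · simpa using (hasRegLimAtZero_hyperlogWord hu).mul (hasRegLimAtZero_hyperlogWord hv)

end HyperlogShuffle

/-! ### Regularization at infinity -/

section SuffixSum

variable {α : Type*}

/-- The divided power `y ^ j / j!`. -/
def dividedPow (y : ℂ) (j : ℕ) : ℂ := y ^ j / (j.factorial : ℂ)

/-- The sum of `e j * Λ v` over the suffixes `v` of `w`, where `j` is the number of letters
removed from the front of `w`. Removing logarithms at infinity and rescaling the variable both
have this shape, with divided powers as coefficients `e j`. -/
def suffixSum (Λ : List α → ℂ) (e : ℕ → ℂ) (w : List α) : ℂ :=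
  ∑ j ∈ Finset.range (w.length + 1), e j * Λ (w.drop j)

lemma dividedPow_zero (y : ℂ) : dividedPow y 0 = 1 := by simp [dividedPow]

lemma dividedPow_add (x y : ℂ) (j : ℕ) :
    dividedPow (x + y) j = ∑ k ∈ Finset.range (j + 1), dividedPow x k * dividedPow y (j - k) := by
  rw [dividedPow, add_pow, Finset.sum_div]
  refine Finset.sum_congr rfl fun k hk => ?_
  have hfac : (j.factorial : ℂ) ≠ 0 := by exact_mod_cast j.factorial_ne_zero
  rw [Nat.cast_choose ℂ (Nat.lt_succ_iff.1 (Finset.mem_range.1 hk)), dividedPow, dividedPow]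
  field_simp

lemma suffixSum_dividedPow_add (Λ : List α → ℂ) (x y : ℂ) (w : List α) :
    suffixSum Λ (dividedPow (x + y)) w =
      suffixSum (suffixSum Λ (dividedPow y)) (dividedPow x) w := by
  let f (k i : ℕ) : ℂ := dividedPow x k * (dividedPow y i * Λ (w.drop (k + i)))
  have hsplit : ∀ j, dividedPow (x + y) j * Λ (w.drop j) =
      ∑ k ∈ Finset.range (j + 1), f k (j - k) := fun j => by
    rw [dividedPow_add, Finset.sum_mul]
    refine Finset.sum_congr rfl fun k hk => ?_
    simp only [f, Nat.add_sub_cancel' (Nat.lt_succ_iff.1 (Finset.mem_range.1 hk)), mul_assoc]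
  calc suffixSum Λ (dividedPow (x + y)) w
      = ∑ j ∈ Finset.range (w.length + 1), ∑ k ∈ Finset.range (j + 1), f k (j - k) :=
        Finset.sum_congr rfl fun j _ => hsplit j
    _ = ∑ k ∈ Finset.range (w.length + 1), ∑ i ∈ Finset.range (w.length + 1 - k), f k i :=
        Finset.sum_range_diag_flip _ f
    _ = _ := Finset.sum_congr rfl fun k hk => by
        simp only [f, suffixSum, Finset.mul_sum, List.length_drop, List.drop_drop,
          Nat.sub_add_comm (Nat.lt_succ_iff.1 (Finset.mem_range.1 hk))]

end SuffixSum

section RegularizedHyperlog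

variable {w : List ℂ}

/-- The hyperlogarithm with its logarithmic divergence at infinity removed. It converges to the
regularized limit, see `tendsto_regHyperlog`. -/
def regHyperlog (w : List ℂ) (z : ℝ) : ℂ :=
  suffixSum (fun v => hyperlogWord v z) (dividedPow (-(Real.log z : ℂ))) w

/-- The regularized limit at infinity of the hyperlogarithm of a word. -/
def regValue (w : List ℂ) : ℂ := regLimAtTop (hyperlogWord w)

lemma forall_mem_drop_admissible (hw : ∀ a ∈ w, Admissible a) (j : ℕ) :
    ∀ a ∈ w.drop j, Admissible a := fun a ha => hw a (List.mem_of_mem_drop ha)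

lemma hasRegLimAtTop_regValue (hw : ∀ a ∈ w, Admissible a) :
    HasRegLimAtTop (hyperlogWord w) (regValue w) := by
  obtain ⟨c, hc⟩ := exists_hasRegLimAtTop_hyperlogWord hw
  rwa [regValue, hc.regLimAtTop_eq]

lemma hasRegLimAtZero_regHyperlog_inv (hw : ∀ a ∈ w, Admissible a) :
    HasRegLimAtZero (fun s => regHyperlog w s⁻¹) (regValue w) := by
  have hterm : ∀ j ∈ Finset.range (w.length + 1), HasRegLimAtZero
      (fun s : ℝ => dividedPow (-(Real.log s⁻¹ : ℂ)) j * hyperlogWord (w.drop j) s⁻¹)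
      (if j = 0 then regValue w else 0) := fun j _ => by
    have hlog := ((hasRegLimAtTop_iff.1 (hasRegLimAtTop_regValue
      (forall_mem_drop_admissible hw j))).log_pow_mul j).const_mul (j.factorial : ℂ)⁻¹
    have hval : ((j.factorial : ℂ)⁻¹ * if j = 0 then regValue (w.drop j) else 0) =
        if j = 0 then regValue w else 0 := by
      rcases j with _ | j <;> simp
    rw [hval] at hlog
    refine hlog.congr (Eventually.of_forall fun s => ?_)
    simp only [dividedPow, Real.log_inv, Complex.ofReal_neg, neg_neg]
    ring
  have hsum := HasRegLimAtZero.sum _ hterm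
  rwa [Finset.sum_ite_eq' _ _ fun _ => regValue w, if_pos (by simp)] at hsum

lemma dividedPow_neg_log (j : ℕ) (z : ℝ) :
    dividedPow (-(Real.log z : ℂ)) j = (-1) ^ j * hyperlogWord (List.replicate j 0) z := by
  rw [hyperlogWord_replicate, dividedPow, neg_pow, mul_div_assoc]

lemma hasDerivAt_dividedPow_neg_log (j : ℕ) {z : ℝ} (hz : 0 < z) :
    HasDerivAt (fun z : ℝ => dividedPow (-(Real.log z : ℂ)) j)
      (if j = 0 then 0 else -dividedPow (-(Real.log z : ℂ)) (j - 1) / z) z := by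
  cases j with
  | zero => simpa only [dividedPow_zero, if_true] using hasDerivAt_const z (1 : ℂ)
  | succ j =>
    simp only [dividedPow_neg_log]
    refine ((hasDerivAt_hyperlogWord_replicate j hz).const_mul _).congr_deriv ?_
    rw [if_neg j.succ_ne_zero, Nat.add_sub_cancel]
    ring

lemma hasDerivAt_hyperlogWord_drop (hw : ∀ a ∈ w, Admissible a) (j : ℕ) {z : ℝ} (hz : 0 < z) :
    HasDerivAt (hyperlogWord (w.drop j))
      (if j < w.length then hyperlogWord (w.drop (j + 1)) z / ((z : ℂ) - w.getD j 0) else 0)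
      z := by
  split_ifs with hj
  · have hdrop : w.drop j = w.getD j 0 :: w.drop (j + 1) := by
      rw [List.drop_eq_getElem_cons hj, List.getD_eq_getElem _ _ hj]
    rw [hdrop]
    exact hasDerivAt_hyperlogWord (hdrop ▸ forall_mem_drop_admissible hw j) hz
  · rw [List.drop_eq_nil_of_le (not_lt.1 hj)]
    exact hasDerivAt_const z (1 : ℂ)

/-- The derivatives of the divided powers telescope against those of the hyperlogarithms, which
leaves the integrable differences of `1 / (z - a)` and `1 / z`. -/
lemma hasDerivAt_regHyperlog (hw : ∀ a ∈ w, Admissible a) {z : ℝ} (hz : 0 < z) :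
    HasDerivAt (regHyperlog w)
      (∑ j ∈ Finset.range w.length, dividedPow (-(Real.log z : ℂ)) j *
        (hyperlogWord (w.drop (j + 1)) z * (1 / ((z : ℂ) - w.getD j 0) - 1 / z))) z := by
  refine (HasDerivAt.fun_sum (u := Finset.range (w.length + 1)) fun j _ =>
    (hasDerivAt_dividedPow_neg_log j hz).fun_mul
      (hasDerivAt_hyperlogWord_drop hw j hz)).congr_deriv ?_
  rw [Finset.sum_add_distrib, Finset.sum_range_succ', Finset.sum_range_succ _ w.length]
  simp only [lt_irrefl, if_false, mul_zero, add_zero, if_true, zero_mul, Nat.add_eq_zero_iff,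
    one_ne_zero, and_false, Nat.add_sub_cancel]
  rw [← Finset.sum_add_distrib]
  refine Finset.sum_congr rfl fun j hj => ?_
  rw [if_pos (Finset.mem_range.1 hj)]
  ring

end RegularizedHyperlog

/-! ### Uniform estimates at infinity -/

section UniformConvergence

variable {c : ℝ} {w : List ℂ}

lemma exists_norm_hyperlogWord_le_of_isTameWord (hc : 0 < c) (hc1 : c ≤ 1) (n : ℕ) :
    ∃ C : ℝ, 0 ≤ C ∧ ∀ w : List ℂ, w.length ≤ n → IsTameWord c w →
      ∀ x, 1 ≤ x → ‖hyperlogWord w x‖ ≤ C * √x := by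
  obtain ⟨C, hC0, hC⟩ := exists_norm_hyperlogWord_le hc hc1 n
  refine ⟨C + 2 * 2 ^ n, by positivity, fun w hw h x hx => ?_⟩
  have hx0 : 0 < x := one_pos.trans_le hx
  have hsqrt := Real.sqrt_pos.2 hx0
  rcases h with h | h
  · have hpow : (2 : ℝ) ^ w.length ≤ 2 ^ n := pow_le_pow_right₀ one_le_two hw
    rw [h]
    refine le_of_mul_le_mul_right ?_ hsqrt
    calc ‖hyperlogWord (List.replicate w.length 0) x‖ * √x
        ≤ 2 ^ w.length * (1 + x) := norm_hyperlogWord_replicate_mul_sqrt_le _ hx0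
      _ ≤ 2 ^ n * (x + x) := by gcongr
      _ ≤ (C + 2 * 2 ^ n) * x := by nlinarith
      _ = (C + 2 * 2 ^ n) * √x * √x := by rw [mul_assoc, Real.mul_self_sqrt hx0.le]
  · exact (hC w hw h x hx0).trans (by gcongr; linarith [pow_pos (two_pos (α := ℝ)) n])

lemma norm_dividedPow_neg_log_le (j : ℕ) {x : ℝ} (hx : 1 ≤ x) :
    ‖dividedPow (-(Real.log x : ℂ)) j‖ ≤ 4 ^ j * x ^ (1 / 4 : ℝ) := by
  have h := abs_log_pow_div_factorial_le (m := 4) (by norm_num) j x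
  rw [abs_of_nonneg (Real.log_nonneg hx), ← mul_one_div (Real.log x),
    ← Real.rpow_def_of_pos (one_pos.trans_le hx)] at h
  simpa only [dividedPow, norm_div, norm_pow, norm_neg, Complex.norm_real, Complex.norm_natCast,
    Real.norm_of_nonneg (Real.log_nonneg hx)] using h

lemma norm_one_div_sub_sub_one_div_le (hc : 0 < c) {a : ℂ} (ha : IsConicallySeparated c a)
    {M : ℝ} (hM : ‖a‖ ≤ M) {x : ℝ} (hx : 0 < x) :
    ‖1 / ((x : ℂ) - a) - 1 / x‖ ≤ M / c * x ^ (-2 : ℝ) := by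
  have hne := ha.sub_ne_zero hc hx
  have hx0 : (x : ℂ) ≠ 0 := by exact_mod_cast hx.ne'
  have hsub : 1 / ((x : ℂ) - a) - 1 / x = a / (((x : ℂ) - a) * x) := by
    field_simp
    ring
  rw [hsub, norm_div, norm_mul, Complex.norm_real, Real.norm_of_nonneg hx.le,
    Real.rpow_neg hx.le, ← div_eq_mul_inv, div_div, Real.rpow_two, sq, ← mul_assoc]
  exact div_le_div₀ ((norm_nonneg a).trans hM) hM (by positivity)
    (mul_le_mul_of_nonneg_right (ha x hx) hx.le)

lemma norm_sub_le_of_norm_deriv_le_rpow {F F' : ℝ → ℂ} {K p z z' : ℝ} (hK : 0 ≤ K) (hp : 0 < p)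
    (hz : 0 < z) (hzz' : z ≤ z') (hF : ∀ x ∈ Set.Icc z z', HasDerivAt F (F' x) x)
    (hF' : ∀ x ∈ Set.Icc z z', ‖F' x‖ ≤ K * x ^ (-p - 1)) :
    ‖F z' - F z‖ ≤ K / p * z ^ (-p) := by
  have hpos : ∀ x ∈ Set.Icc z z', 0 < x := fun x hx => hz.trans_le hx.1
  have hB : ∀ x ∈ Set.Icc z z',
      HasDerivAt (fun x => K / p * (z ^ (-p) - x ^ (-p))) (K * x ^ (-p - 1)) x := fun x hx => by
    refine (((Real.hasDerivAt_rpow_const (p := -p) (Or.inl (hpos x hx).ne')).const_sub _).const_mul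
      (K / p)).congr_deriv ?_
    field_simp
  have hle := image_norm_le_of_norm_deriv_right_le_deriv_boundary'
    (f := fun x => F x - F z) (f' := F') (a := z) (b := z')
    (fun x hx => ((hF x hx).sub_const _).continuousAt.continuousWithinAt)
    (fun x hx => ((hF x ⟨hx.1, hx.2.le⟩).sub_const _).hasDerivWithinAt)
    (by simp) (fun x hx => (hB x hx).continuousAt.continuousWithinAt)
    (fun x hx => (hB x ⟨hx.1, hx.2.le⟩).hasDerivWithinAt)
    (fun x hx => hF' x ⟨hx.1, hx.2.le⟩) (Set.right_mem_Icc.2 hzz')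
  refine hle.trans (mul_le_mul_of_nonneg_left ?_ (by positivity))
  linarith [Real.rpow_nonneg (hz.le.trans hzz') (-p)]

lemma exists_norm_deriv_regHyperlog_le (hc : 0 < c) (hc1 : c ≤ 1) {M : ℝ} (hM : 0 ≤ M) (n : ℕ) :
    ∃ K : ℝ, 0 ≤ K ∧ ∀ w : List ℂ, w.length ≤ n → IsTameWord c w → (∀ a ∈ w, ‖a‖ ≤ M) →
      ∀ x : ℝ, 1 ≤ x → ‖∑ j ∈ Finset.range w.length, dividedPow (-(Real.log x : ℂ)) j *
        (hyperlogWord (w.drop (j + 1)) x * (1 / ((x : ℂ) - w.getD j 0) - 1 / x))‖ ≤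
          K * x ^ (-(1 / 4) - 1 : ℝ) := by
  obtain ⟨C, hC0, hC⟩ := exists_norm_hyperlogWord_le_of_isTameWord hc hc1 n
  refine ⟨n * (4 ^ n * (C * (M / c))), by positivity, fun w hw ht hb x hx => ?_⟩
  have hx0 : 0 < x := one_pos.trans_le hx
  have hexp : x ^ (1 / 4 : ℝ) * (√x * x ^ (-2 : ℝ)) = x ^ (-(1 / 4) - 1 : ℝ) := by
    rw [Real.sqrt_eq_rpow, ← Real.rpow_add hx0, ← Real.rpow_add hx0]
    norm_num
  refine (norm_sum_le_of_le _ (n := fun _ => 4 ^ n * (C * (M / c)) * x ^ (-(1 / 4) - 1 : ℝ))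
    fun j hj => ?_).trans ?_
  · have hj := Finset.mem_range.1 hj
    have hmem : w.getD j 0 ∈ w := by
      rw [List.getD_eq_getElem _ _ hj]
      exact List.getElem_mem hj
    have hpow : (4 : ℝ) ^ j ≤ 4 ^ n := pow_le_pow_right₀ (by norm_num) (by omega)
    rw [norm_mul, norm_mul]
    calc _ ≤ 4 ^ n * x ^ (1 / 4 : ℝ) * (C * √x * (M / c * x ^ (-2 : ℝ))) := by
          gcongr
          · exact (norm_dividedPow_neg_log_le j hx).trans (by gcongr)
          · exact hC _ (by rw [List.length_drop]; omega) (ht.drop _) x hx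
          · exact norm_one_div_sub_sub_one_div_le hc (ht.isConicallySeparated hc hc1 _ hmem)
              (hb _ hmem) hx0
      _ = 4 ^ n * (C * (M / c)) * (x ^ (1 / 4 : ℝ) * (√x * x ^ (-2 : ℝ))) := by ring
      _ = _ := by rw [hexp]
  · rw [Finset.sum_const, Finset.card_range, nsmul_eq_mul, ← mul_assoc]
    gcongr

lemma exists_norm_regHyperlog_sub_le (hc : 0 < c) (hc1 : c ≤ 1) {M : ℝ} (hM : 0 ≤ M) (n : ℕ) :
    ∃ K : ℝ, 0 ≤ K ∧ ∀ w : List ℂ, w.length ≤ n → IsTameWord c w → (∀ a ∈ w, ‖a‖ ≤ M) →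
      ∀ z z' : ℝ, 1 ≤ z → z ≤ z' →
        ‖regHyperlog w z' - regHyperlog w z‖ ≤ K * z ^ (-(1 / 4) : ℝ) := by
  obtain ⟨K, hK0, hK⟩ := exists_norm_deriv_regHyperlog_le hc hc1 hM n
  refine ⟨K / (1 / 4), by positivity, fun w hw ht hb z z' hz hzz' => ?_⟩
  have hz0 : 0 < z := one_pos.trans_le hz
  exact norm_sub_le_of_norm_deriv_le_rpow hK0 (by norm_num) hz0 hzz'
    (fun x hx => hasDerivAt_regHyperlog (ht.admissible hc hc1) (hz0.trans_le hx.1))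
    (fun x hx => hK w hw ht hb x (hz.trans hx.1))

lemma tendsto_mul_rpow_neg_quarter (K : ℝ) :
    Tendsto (fun z : ℝ => K * z ^ (-(1 / 4) : ℝ)) atTop (𝓝 0) := by
  simpa using (tendsto_rpow_neg_atTop (show (0 : ℝ) < 1 / 4 by norm_num)).const_mul K

lemma exists_forall_mem_norm_le (w : List ℂ) : ∃ M, 0 ≤ M ∧ ∀ a ∈ w, ‖a‖ ≤ M :=
  ⟨(w.map norm).sum, List.sum_nonneg (by simp), fun _ ha =>
    List.single_le_sum (by simp) _ (List.mem_map_of_mem ha)⟩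

theorem tendsto_regHyperlog (hw : ∀ a ∈ w, Admissible a) :
    Tendsto (regHyperlog w) atTop (𝓝 (regValue w)) := by
  obtain ⟨c, hc, hc1, h⟩ := exists_isTameWord hw
  obtain ⟨M, hM, hMw⟩ := exists_forall_mem_norm_le w
  obtain ⟨K, -, hK⟩ := exists_norm_regHyperlog_sub_le hc hc1 hM w.length
  have hcauchy : CauchySeq (regHyperlog w) := by
    rw [Metric.cauchySeq_iff']
    intro ε hε
    obtain ⟨N, hN1, hN⟩ := ((eventually_ge_atTop (1 : ℝ)).and
      ((tendsto_mul_rpow_neg_quarter K).eventually_lt_const hε)).exists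
    exact ⟨N, fun z hz => (dist_eq_norm _ _).trans_lt ((hK w le_rfl h hMw N z hN1 hz).trans_lt hN)⟩
  obtain ⟨l, hl⟩ := cauchySeq_tendsto_of_complete hcauchy
  rwa [(hasRegLimAtZero_regHyperlog_inv hw).eq_of_tendsto (hl.comp tendsto_inv_nhdsGT_zero)]

theorem exists_norm_regValue_sub_regHyperlog_le (hc : 0 < c) (hc1 : c ≤ 1) {M : ℝ} (hM : 0 ≤ M)
    (n : ℕ) : ∃ K : ℝ, 0 ≤ K ∧ ∀ w : List ℂ, w.length ≤ n → IsTameWord c w →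
      (∀ a ∈ w, ‖a‖ ≤ M) → ∀ z : ℝ, 1 ≤ z →
        ‖regValue w - regHyperlog w z‖ ≤ K * z ^ (-(1 / 4) : ℝ) := by
  obtain ⟨K, hK0, hK⟩ := exists_norm_regHyperlog_sub_le hc hc1 hM n
  refine ⟨K, hK0, fun w hw ht hb z hz => le_of_tendsto
    ((tendsto_regHyperlog (ht.admissible hc hc1)).sub_const (regHyperlog w z)).norm ?_⟩
  filter_upwards [eventually_ge_atTop z] with z' hz' using hK w hw ht hb z z' hz hz'

end UniformConvergence

/-! ### Scaling -/

section Scaling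

variable {s : ℝ} {a b : ℂ}

lemma drop_append_singleton_eq_or_eq_nil {α : Type*} (u : List α) (b : α) (j : ℕ) :
    (u ++ [b]).drop j = u.drop j ++ [b] ∨ (u ++ [b]).drop j = [] := by
  rcases le_or_gt j u.length with hj | hj
  · exact Or.inl (List.drop_append_of_le_length hj)
  · exact Or.inr (List.drop_eq_nil_of_le (by simpa using hj))

lemma hyperlogWord_cons_map_mul (hs : 0 < s) {w : List ℂ} (hne : ∃ τ ∈ a :: w, τ ≠ 0)
    (hw : ∀ z : ℝ, hyperlogWord (w.map (s * ·)) (s * z) = hyperlogWord w z) (z : ℝ) :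
    hyperlogWord ((a :: w).map (s * ·)) (s * z) = hyperlogWord (a :: w) z := by
  have hs0 : (s : ℂ) ≠ 0 := by exact_mod_cast hs.ne'
  have hne' : ∃ τ ∈ (s * a) :: w.map ((s : ℂ) * ·), τ ≠ 0 := by
    obtain ⟨τ, hτ, h0⟩ := hne
    exact ⟨s * τ, List.mem_map_of_mem (f := ((s : ℂ) * ·)) hτ, mul_ne_zero hs0 h0⟩
  have hsubst := intervalIntegral.smul_integral_comp_mul_left (a := 0) (b := z)
    (f := fun x : ℝ => hyperlogWord (w.map ((s : ℂ) * ·)) x / ((x : ℂ) - s * a)) s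
  rw [mul_zero] at hsubst
  rw [List.map_cons, hyperlogWord_cons hne', hyperlogWord_cons hne, ← hsubst, Complex.real_smul,
    ← intervalIntegral.integral_const_mul]
  refine intervalIntegral.integral_congr fun x _ => ?_
  simp only [hw]
  push_cast
  rw [← mul_sub, ← mul_div_assoc, mul_div_mul_left _ _ hs0]

lemma hyperlogWord_map_mul (hs : 0 < s) (u : List ℂ) (hb : b ≠ 0) (z : ℝ) :
    hyperlogWord ((u ++ [b]).map (s * ·)) (s * z) = hyperlogWord (u ++ [b]) z := by
  induction u generalizing z with
  | nil => exact hyperlogWord_cons_map_mul hs ⟨b, by simp, hb⟩ (fun z => by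
      simp only [List.map_nil, hyperlogWord_nil]) z
  | cons a u ih => exact hyperlogWord_cons_map_mul hs ⟨b, by simp, hb⟩ ih z

lemma regHyperlog_map_mul (hs : 0 < s) (u : List ℂ) (hb : b ≠ 0) {z : ℝ} (hz : 0 < z) :
    regHyperlog ((u ++ [b]).map (s * ·)) (s * z) =
      suffixSum (fun v => regHyperlog v z) (dividedPow (-(Real.log s : ℂ))) (u ++ [b]) := by
  have hdrop : ∀ j, hyperlogWord (((u ++ [b]).map ((s : ℂ) * ·)).drop j) (s * z) =
      hyperlogWord ((u ++ [b]).drop j) z := fun j => by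
    rw [← List.map_drop]
    rcases drop_append_singleton_eq_or_eq_nil u b j with h | h
    · rw [h, hyperlogWord_map_mul hs _ hb]
    · rw [h, List.map_nil, hyperlogWord_nil, hyperlogWord_nil]
  have hlog : (-(Real.log (s * z) : ℂ)) = -(Real.log s : ℂ) + -(Real.log z : ℂ) := by
    rw [Real.log_mul hs.ne' hz.ne']
    push_cast
    ring
  refine Eq.trans ?_ (suffixSum_dividedPow_add (fun v => hyperlogWord v z) _ _ (u ++ [b]))
  simp only [regHyperlog, suffixSum, List.length_map, hdrop, hlog]

theorem regValue_map_mul (hs : 0 < s) (u : List ℂ) (hb : b ≠ 0)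
    (hw : ∀ a ∈ u ++ [b], Admissible a) :
    regValue ((u ++ [b]).map (s * ·)) =
      suffixSum regValue (dividedPow (-(Real.log s : ℂ))) (u ++ [b]) := by
  have hw' : ∀ a ∈ (u ++ [b]).map ((s : ℂ) * ·), Admissible a := by
    simp only [List.mem_map, forall_exists_index, and_imp, forall_apply_eq_imp_iff₂]
    intro a ha x hx h
    have hs0 : (s : ℂ) ≠ 0 := by exact_mod_cast hs.ne'
    exact hw a ha (x / s) (by positivity) (by push_cast; rw [eq_div_iff hs0, ← h, mul_comm])
  have hscaled : Tendsto (fun z : ℝ => regHyperlog ((u ++ [b]).map ((s : ℂ) * ·)) (s * z)) atTop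
      (𝓝 (regValue ((u ++ [b]).map ((s : ℂ) * ·)))) :=
    (tendsto_regHyperlog hw').comp (tendsto_id.const_mul_atTop hs)
  have hsum : Tendsto (fun z : ℝ => suffixSum (fun v => regHyperlog v z)
      (dividedPow (-(Real.log s : ℂ))) (u ++ [b])) atTop
      (𝓝 (suffixSum regValue (dividedPow (-(Real.log s : ℂ))) (u ++ [b]))) :=
    tendsto_finsetSum _ fun j _ =>
      (tendsto_regHyperlog (forall_mem_drop_admissible hw j)).const_mul _
  refine tendsto_nhds_unique hscaled (hsum.congr' ?_)
  filter_upwards [eventually_gt_atTop 0] with z hz using (regHyperlog_map_mul hs u hb hz).symm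

end Scaling

/-! ### Continuity in the letters -/

section LetterContinuity

variable {T ι : Type*} {l : Filter T} {c : ℝ} {ev : T → ι → ℂ} {ev₀ : ι → ℂ} {u : List ι} {b : ι}

lemma isSeparatedWord_map_append_singleton {f : ι → ℂ}
    (hu : ∀ a ∈ u, IsConicallySeparated c (f a)) (hb : IsSeparated c (f b)) :
    IsSeparatedWord c ((u ++ [b]).map f) := by
  rw [List.map_append]
  exact .append_singleton (List.forall_mem_map.2 hu) hb

lemma tendsto_hyperlogWord_cons [l.IsCountablyGenerated] (hc : 0 < c) (hc1 : c ≤ 1) {a : ι}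
    {w : List ι} (ha : Tendsto (fun t => ev t a) l (𝓝 (ev₀ a)))
    (hsep : ∀ᶠ t in l, IsSeparatedWord c ((a :: w).map (ev t)))
    (hsep₀ : IsSeparatedWord c ((a :: w).map ev₀))
    (hw : ∀ x : ℝ, 0 < x → Tendsto (fun t => hyperlogWord (w.map (ev t)) x) l
      (𝓝 (hyperlogWord (w.map ev₀) x))) {x : ℝ} (hx : 0 < x) :
    Tendsto (fun t => hyperlogWord ((a :: w).map (ev t)) x) l
      (𝓝 (hyperlogWord ((a :: w).map ev₀) x)) := by
  obtain ⟨K, -, hK⟩ := exists_norm_hyperlogWord_div_sub_le hc hc1 w.length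
  have hmem : ∀ y ∈ Set.uIoc 0 x, 0 < y := fun y hy => by
    rw [Set.uIoc_of_le hx.le] at hy
    exact hy.1
  simp only [List.map_cons] at hsep hsep₀ ⊢
  rw [hyperlogWord_cons (hsep₀.exists_mem_ne_zero hc)]
  refine Tendsto.congr' (f₁ := fun t => ∫ y in (0 : ℝ)..x,
    hyperlogWord (w.map (ev t)) y / ((y : ℂ) - ev t a)) ?_ ?_
  · filter_upwards [hsep] with t ht
    rw [hyperlogWord_cons (ht.exists_mem_ne_zero hc)]
  refine intervalIntegral.tendsto_integral_filter_of_dominated_convergence (fun y => K / √y)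
    ?_ ?_ (intervalIntegrable_div_sqrt K hx.le) ?_
  · filter_upwards [hsep] with t ht
    obtain ⟨hat, hwt⟩ := List.forall_mem_cons.1 (ht.isConicallySeparated hc hc1)
    exact ((hat.continuousOn_div_sub hc (continuousOn_hyperlogWord
      fun a' ha' => (hwt a' ha').admissible hc)).mono hmem).aestronglyMeasurable
        measurableSet_uIoc
  · filter_upwards [hsep] with t ht
    exact Eventually.of_forall fun y hy => hK _ _ (by simp) ht y (hmem y hy)
  · exact Eventually.of_forall fun y hy => (hw y (hmem y hy)).div (tendsto_const_nhds.sub ha)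
      ((hsep₀.isConicallySeparated hc hc1 _ (by simp)).sub_ne_zero hc (hmem y hy))

lemma tendsto_hyperlogWord [l.IsCountablyGenerated] (hc : 0 < c) (hc1 : c ≤ 1)
    (hlim : ∀ a ∈ u ++ [b], Tendsto (fun t => ev t a) l (𝓝 (ev₀ a)))
    (hu : ∀ᶠ t in l, ∀ a ∈ u, IsConicallySeparated c (ev t a))
    (hb : ∀ᶠ t in l, IsSeparated c (ev t b))
    (hu₀ : ∀ a ∈ u, IsConicallySeparated c (ev₀ a)) (hb₀ : IsSeparated c (ev₀ b))
    {x : ℝ} (hx : 0 < x) :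
    Tendsto (fun t => hyperlogWord ((u ++ [b]).map (ev t)) x) l
      (𝓝 (hyperlogWord ((u ++ [b]).map ev₀) x)) := by
  induction u generalizing x with
  | nil =>
    exact tendsto_hyperlogWord_cons (w := []) hc hc1 (hlim b (by simp))
      (hb.mono fun t ht => .base 0 ht) (.base 0 hb₀) (fun x _ => tendsto_const_nhds) hx
  | cons a u ih =>
    obtain ⟨ha, hlim'⟩ := List.forall_mem_cons.1 hlim
    refine tendsto_hyperlogWord_cons hc hc1 ha ?_
      (isSeparatedWord_map_append_singleton hu₀ hb₀) (fun x hx => ih hlim'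
        (hu.mono fun t ht => (List.forall_mem_cons.1 ht).2) (List.forall_mem_cons.1 hu₀).2 hx) hx
    filter_upwards [hu, hb] with t hut hbt using isSeparatedWord_map_append_singleton hut hbt

lemma tendsto_regHyperlog_map [l.IsCountablyGenerated] (hc : 0 < c) (hc1 : c ≤ 1)
    (hlim : ∀ a ∈ u ++ [b], Tendsto (fun t => ev t a) l (𝓝 (ev₀ a)))
    (hu : ∀ᶠ t in l, ∀ a ∈ u, IsConicallySeparated c (ev t a))
    (hb : ∀ᶠ t in l, IsSeparated c (ev t b))
    (hu₀ : ∀ a ∈ u, IsConicallySeparated c (ev₀ a)) (hb₀ : IsSeparated c (ev₀ b))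
    {z : ℝ} (hz : 0 < z) :
    Tendsto (fun t => regHyperlog ((u ++ [b]).map (ev t)) z) l
      (𝓝 (regHyperlog ((u ++ [b]).map ev₀) z)) := by
  simp only [regHyperlog, suffixSum, List.length_map, ← List.map_drop]
  refine tendsto_finsetSum _ fun j _ => Tendsto.const_mul _ ?_
  have hlim' : ∀ a ∈ (u ++ [b]).drop j, Tendsto (fun t => ev t a) l (𝓝 (ev₀ a)) :=
    fun a ha => hlim a (List.mem_of_mem_drop ha)
  rcases drop_append_singleton_eq_or_eq_nil u b j with h | h
  · rw [h] at hlim' ⊢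
    exact tendsto_hyperlogWord hc hc1 hlim'
      (hu.mono fun t ht a ha => ht a (List.mem_of_mem_drop ha)) hb
      (fun a ha => hu₀ a (List.mem_of_mem_drop ha)) hb₀ hz
  · rw [h]
    exact tendsto_const_nhds

lemma eventually_forall_mem_map_norm_le {w : List ι} {M M' : ℝ}
    (hlim : ∀ a ∈ w, Tendsto (fun t => ev t a) l (𝓝 (ev₀ a)))
    (hM : ∀ a ∈ w.map ev₀, ‖a‖ ≤ M) (hMM' : M < M') :
    ∀ᶠ t in l, ∀ a ∈ w.map (ev t), ‖a‖ ≤ M' := by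
  simp only [List.forall_mem_map] at hM ⊢
  exact (List.finite_toSet w).eventually_all.2 fun a ha => (hlim a ha).norm.eventually_le_const
    ((hM a ha).trans_lt hMM')

/-- The removal of logarithms converges uniformly in the letters, so the limits may be
interchanged. -/
theorem tendsto_regValue [l.IsCountablyGenerated] (hc : 0 < c) (hc1 : c ≤ 1)
    (hlim : ∀ a ∈ u ++ [b], Tendsto (fun t => ev t a) l (𝓝 (ev₀ a)))
    (hu : ∀ᶠ t in l, ∀ a ∈ u, IsConicallySeparated c (ev t a))
    (hb : ∀ᶠ t in l, IsSeparated c (ev t b))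
    (hu₀ : ∀ a ∈ u, IsConicallySeparated c (ev₀ a)) (hb₀ : IsSeparated c (ev₀ b)) :
    Tendsto (fun t => regValue ((u ++ [b]).map (ev t))) l
      (𝓝 (regValue ((u ++ [b]).map ev₀))) := by
  obtain ⟨M, hM0, hM⟩ := exists_forall_mem_norm_le ((u ++ [b]).map ev₀)
  obtain ⟨K, -, hK⟩ := exists_norm_regValue_sub_regHyperlog_le hc hc1 (M := M + 1) (by linarith)
    (u ++ [b]).length
  have hunif : TendstoUniformlyOnFilter (fun z t => regHyperlog ((u ++ [b]).map (ev t)) z)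
      (fun t => regValue ((u ++ [b]).map (ev t))) atTop l := by
    rw [Metric.tendstoUniformlyOnFilter_iff]
    intro ε hε
    filter_upwards [((eventually_ge_atTop (1 : ℝ)).and
      ((tendsto_mul_rpow_neg_quarter K).eventually_lt_const hε)).prod_mk
        ((eventually_forall_mem_map_norm_le hlim hM (lt_add_one M)).and (hu.and hb))]
      with ⟨z, t⟩ ⟨⟨hz, hzε⟩, hMt, hut, hbt⟩
    rw [dist_eq_norm]
    exact (hK _ (by simp) (Or.inr (isSeparatedWord_map_append_singleton hut hbt)) hMt z
      hz).trans_lt hzε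
  have hsep₀ : IsTameWord c ((u ++ [b]).map ev₀) :=
    Or.inr (isSeparatedWord_map_append_singleton hu₀ hb₀)
  refine hunif.tendsto_of_eventually_tendsto ?_ (tendsto_regHyperlog (hsep₀.admissible hc hc1))
  filter_upwards [eventually_gt_atTop 0] with z hz
    using tendsto_regHyperlog_map hc hc1 hlim hu hb hu₀ hb₀ hz

end LetterContinuity

/-! ### The total differential of hyperlogarithms -/

section LetterDifferential

variable {ι : Type*}

/-- The combination of the values of `Λ` at the words obtained from `w = σ₁ ⋯ σₙ` by deleting one
letter in which the total differential of hyperlogarithms is expressed: deleting `σᵢ` has the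
coefficient `q σᵢ₋₁ σᵢ - q σᵢ σᵢ₊₁`, with the first term missing for `i = 1` and the second one
equal to `q₀ σₙ` for `i = n`. The recursion collects the terms with the same coefficient of `q`. -/
def letterDifferential (q : ι → ι → ℂ) (q₀ : ι → ℂ) : List ι → (List ι → ℂ) →ₗ[ℂ] ℂ
  | [] => 0
  | [i] => -q₀ i • LinearMap.proj []
  | i :: j :: v =>
      let eval (x : List ι) : (List ι → ℂ) →ₗ[ℂ] ℂ := LinearMap.proj x
      q i j • (eval (i :: v) - eval (j :: v)) +
        letterDifferential q q₀ (j :: v) ∘ₗ LinearMap.funLeft ℂ ℂ (List.cons i)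

variable {q : ι → ι → ℂ} {q₀ : ι → ℂ}

lemma letterDifferential_nil (Λ : List ι → ℂ) : letterDifferential q q₀ [] Λ = 0 := rfl

lemma letterDifferential_singleton (i : ι) (Λ : List ι → ℂ) :
    letterDifferential q q₀ [i] Λ = -q₀ i * Λ [] := rfl

lemma letterDifferential_cons_cons (i j : ι) (v : List ι) (Λ : List ι → ℂ) :
    letterDifferential q q₀ (i :: j :: v) Λ =
      q i j * (Λ (i :: v) - Λ (j :: v)) +
        letterDifferential q q₀ (j :: v) (fun x => Λ (i :: x)) := rfl

lemma letterDifferential_mul_coeff (k : ℂ) (w : List ι) (Λ : List ι → ℂ) :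
    letterDifferential (fun i j => k * q i j) (fun i => k * q₀ i) w Λ =
      k * letterDifferential q q₀ w Λ := by
  induction w generalizing Λ with
  | nil => simp only [letterDifferential_nil, mul_zero]
  | cons i w ih =>
    cases w with
    | nil => simp only [letterDifferential_singleton]; ring
    | cons j v => simp only [letterDifferential_cons_cons, ih]; ring

lemma letterDifferential_eq_zero {w : List ι} (h : ∀ i ∈ w, ∀ j ∈ w, q i j = 0)
    (h₀ : ∀ i ∈ w, q₀ i = 0) (Λ : List ι → ℂ) : letterDifferential q q₀ w Λ = 0 := by
  induction w generalizing Λ with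
  | nil => rfl
  | cons i w ih =>
    cases w with
    | nil => rw [letterDifferential_singleton, h₀ i (by simp), neg_zero, zero_mul]
    | cons j v =>
      rw [letterDifferential_cons_cons, h i (by simp) j (by simp), zero_mul, zero_add,
        ih (fun k hk l hl => h k (List.mem_cons_of_mem _ hk) l (List.mem_cons_of_mem _ hl))
          fun k hk => h₀ k (List.mem_cons_of_mem _ hk)]

lemma letterDifferential_congr {w : List ι} {Λ Λ' : List ι → ℂ}
    (h : ∀ v : List ι, v.length + 1 = w.length → Λ v = Λ' v) :
    letterDifferential q q₀ w Λ = letterDifferential q q₀ w Λ' := by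
  induction w generalizing Λ Λ' with
  | nil => rfl
  | cons i w ih =>
    cases w with
    | nil => simp only [letterDifferential_singleton, h [] rfl]
    | cons j v =>
      rw [letterDifferential_cons_cons, letterDifferential_cons_cons, h (i :: v) (by simp),
        h (j :: v) (by simp), ih fun x hx => h (i :: x) (by simpa using hx)]

lemma hasDerivAt_letterDifferential {Λ : ℝ → List ι → ℂ} {Λ' : List ι → ℂ} {x : ℝ}
    (h : ∀ v, HasDerivAt (fun x => Λ x v) (Λ' v) x) (w : List ι) :
    HasDerivAt (fun x => letterDifferential q q₀ w (Λ x)) (letterDifferential q q₀ w Λ') x := by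
  induction w generalizing Λ Λ' with
  | nil => exact hasDerivAt_const x (0 : ℂ)
  | cons i w ih =>
    cases w with
    | nil => exact (h []).const_mul _
    | cons j v =>
      exact (((h (i :: v)).sub (h (j :: v))).const_mul _).add (ih fun y => h (i :: y))

lemma hasRegLimAtZero_letterDifferential {q : ℝ → ι → ι → ℂ} {q₀ : ℝ → ι → ℂ}
    {q' : ι → ι → ℂ} {q₀' : ι → ℂ} {Λ : ℝ → List ι → ℂ} {Λ' : List ι → ℂ} {w : List ι}
    (hq : ∀ i j, HasRegLimAtZero (fun t => q t i j) (q' i j))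
    (hq₀ : ∀ i, HasRegLimAtZero (fun t => q₀ t i) (q₀' i))
    (h : ∀ v : List ι, v.length + 1 = w.length → HasRegLimAtZero (fun t => Λ t v) (Λ' v)) :
    HasRegLimAtZero (fun t => letterDifferential (q t) (q₀ t) w (Λ t))
      (letterDifferential q' q₀' w Λ') := by
  induction w generalizing Λ Λ' with
  | nil => exact HasRegLimAtZero.const 0
  | cons i w ih =>
    cases w with
    | nil => exact (hq₀ i).neg.mul (h [] rfl)
    | cons j v =>
      exact ((hq i j).mul ((h (i :: v) (by simp)).sub (h (j :: v) (by simp)))).add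
        (ih fun y hy => h (i :: y) (by simpa using hy))

lemma norm_letterDifferential_le {B δ : ℝ} (hq : ∀ i j, ‖q i j‖ ≤ B) (hq₀ : ∀ i, ‖q₀ i‖ ≤ B)
    (hB : 0 ≤ B) {w : List ι} {Λ : List ι → ℂ}
    (h : ∀ v : List ι, v.length + 1 = w.length → ‖Λ v‖ ≤ δ) :
    ‖letterDifferential q q₀ w Λ‖ ≤ w.length * (2 * B * δ) := by
  induction w generalizing Λ with
  | nil => simp [letterDifferential_nil]
  | cons i w ih =>
    cases w with
    | nil =>
      have hδ : 0 ≤ δ := (norm_nonneg _).trans (h [] rfl)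
      rw [letterDifferential_singleton, norm_mul, norm_neg]
      calc ‖q₀ i‖ * ‖Λ []‖ ≤ B * δ := mul_le_mul (hq₀ i) (h [] rfl) (norm_nonneg _) hB
        _ ≤ 2 * (B * δ) := le_mul_of_one_le_left (mul_nonneg hB hδ) one_le_two
        _ = ([i].length : ℝ) * (2 * B * δ) := by simp [mul_assoc]
    | cons j v =>
      have hsub : ‖Λ (i :: v) - Λ (j :: v)‖ ≤ δ + δ :=
        norm_sub_le_of_le (h (i :: v) (by simp)) (h (j :: v) (by simp))
      rw [letterDifferential_cons_cons]
      calc ‖q i j * (Λ (i :: v) - Λ (j :: v)) + letterDifferential q q₀ (j :: v) _‖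
          ≤ ‖q i j‖ * ‖Λ (i :: v) - Λ (j :: v)‖ +
              ‖letterDifferential q q₀ (j :: v) (fun x => Λ (i :: x))‖ :=
            (norm_add_le _ _).trans_eq (by rw [norm_mul])
        _ ≤ B * (δ + δ) + (j :: v).length * (2 * B * δ) :=
            add_le_add (mul_le_mul (hq i j) hsub (norm_nonneg _) hB)
              (ih fun x hx => h (i :: x) (by simpa using hx))
        _ = (i :: j :: v).length * (2 * B * δ) := by
            rw [List.length_cons (a := i)]
            push_cast
            ring

lemma suffixSum_cons (Λ : List ι → ℂ) (e : ℕ → ℂ) (i : ι) (w : List ι) :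
    suffixSum Λ e (i :: w) = e 0 * Λ (i :: w) + suffixSum Λ (fun j => e (j + 1)) w := by
  rw [suffixSum, suffixSum, List.length_cons, Finset.sum_range_succ', add_comm]
  rfl

lemma letterDifferential_suffixSum (Λ : List ι → ℂ) (e : ℕ → ℂ) (w : List ι) :
    letterDifferential q q₀ w (suffixSum Λ e) =
      suffixSum (letterDifferential q q₀ · Λ) e w := by
  induction w generalizing Λ e with
  | nil => simp [letterDifferential_nil, suffixSum]
  | cons i w ih =>
    cases w with
    | nil => simp [suffixSum, Finset.sum_range_succ, letterDifferential_nil,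
        letterDifferential_singleton, mul_left_comm]
    | cons j v =>
      have hcons : (fun x => suffixSum Λ e (i :: x)) =
          e 0 • (fun x => Λ (i :: x)) + suffixSum Λ fun k => e (k + 1) :=
        funext (suffixSum_cons Λ e i)
      rw [letterDifferential_cons_cons, hcons, map_add, map_smul, ih, suffixSum_cons Λ,
        suffixSum_cons Λ, suffixSum_cons (letterDifferential q q₀ · Λ) e i,
        letterDifferential_cons_cons, smul_eq_mul]
      ring

end LetterDifferential

section LetterFamily

variable {ι : Type*} {U : Set ℝ} {a a' : ι → ℝ → ℂ}

/-- A family of admissible letters `a i` depending differentiably on a parameter `t ∈ U`, with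
continuous derivatives `a' i`. Any two letters either coincide or are different for all
parameters, and likewise for the comparison of a letter with `0`. -/
structure LetterFamily (U : Set ℝ) (a a' : ι → ℝ → ℂ) : Prop where
  isOpen : IsOpen U
  hasDerivAt : ∀ i, ∀ t ∈ U, HasDerivAt (a i) (a' i t) t
  continuousOn_deriv : ∀ i, ContinuousOn (a' i) U
  admissible : ∀ i, ∀ t ∈ U, Admissible (a i t)
  eq_zero_or_ne_zero : ∀ i, (∀ t ∈ U, a i t = 0) ∨ ∀ t ∈ U, a i t ≠ 0
  eq_or_ne : ∀ i j, (∀ t ∈ U, a i t = a j t) ∨ ∀ t ∈ U, a i t ≠ a j t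

/-- The logarithmic derivative of the difference of two letters, which is `0` if they coincide. -/
def logDiff (a a' : ι → ℝ → ℂ) (t : ℝ) (i j : ι) : ℂ := (a' i t - a' j t) / (a i t - a j t)

/-- The logarithmic derivative of a letter, which is `0` for the letter `0`. -/
def logDiffZero (a a' : ι → ℝ → ℂ) (t : ℝ) (i : ι) : ℂ := a' i t / a i t

/-- The contribution to `∂ L_{w(t)}(x) / ∂t` of the upper limit `x` of integration. -/
def boundaryTerm (a a' : ι → ℝ → ℂ) (w : List ι) (x t : ℝ) : ℂ :=
  match w with
  | [] => 0
  | i :: v => -a' i t / ((x : ℂ) - a i t) * hyperlogWord (v.map (a · t)) x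

/-- The derivative of `L_{w(t)}(x)` with respect to the parameter `t` of the letters. -/
def paramDeriv (a a' : ι → ℝ → ℂ) (w : List ι) (x t : ℝ) : ℂ :=
  boundaryTerm a a' w x t + letterDifferential (logDiff a a' t) (logDiffZero a a' t) w
    fun v => hyperlogWord (v.map (a · t)) x

/-- The derivative with respect to `t` of the integrand `L_{v(t)}(x) / (x - a i t)` of the
hyperlogarithm of `i :: v`. -/
def paramDerivIntegrand (a a' : ι → ℝ → ℂ) (i : ι) (v : List ι) (x t : ℝ) : ℂ :=
  paramDeriv a a' v x t / ((x : ℂ) - a i t) +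
    a' i t / ((x : ℂ) - a i t) * (hyperlogWord (v.map (a · t)) x / ((x : ℂ) - a i t))

namespace LetterFamily

lemma mono (H : LetterFamily U a a') {V : Set ℝ} (hV : IsOpen V) (hVU : V ⊆ U) :
    LetterFamily V a a' where
  isOpen := hV
  hasDerivAt i t ht := H.hasDerivAt i t (hVU ht)
  continuousOn_deriv i := (H.continuousOn_deriv i).mono hVU
  admissible i t ht := H.admissible i t (hVU ht)
  eq_zero_or_ne_zero i := (H.eq_zero_or_ne_zero i).imp (fun h t ht => h t (hVU ht))
    fun h t ht => h t (hVU ht)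
  eq_or_ne i j := (H.eq_or_ne i j).imp (fun h t ht => h t (hVU ht)) fun h t ht => h t (hVU ht)

variable (H : LetterFamily U a a') {t x : ℝ}
include H

lemma exists_ne_zero_or_forall_eq_zero (w : List ι) :
    (∃ i ∈ w, ∀ t ∈ U, a i t ≠ 0) ∨ ∀ i ∈ w, ∀ t ∈ U, a i t = 0 :=
  or_iff_not_imp_left.2 fun h i hi =>
    (H.eq_zero_or_ne_zero i).resolve_right fun h' => h ⟨i, hi, h'⟩

lemma deriv_eq_of_eqOn {i j : ι} (h : ∀ t ∈ U, a i t = a j t) (ht : t ∈ U) : a' i t = a' j t :=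
  (H.hasDerivAt i t ht).unique ((H.hasDerivAt j t ht).congr_of_eventuallyEq
    (eventually_of_mem (H.isOpen.mem_nhds ht) h))

lemma deriv_eq_zero {i : ι} (ht : t ∈ U) (h : a i t = 0) : a' i t = 0 :=
  have h0 : ∀ s ∈ U, a i s = 0 := (H.eq_zero_or_ne_zero i).resolve_right fun h' => h' t ht h
  (H.hasDerivAt i t ht).unique ((hasDerivAt_const t (0 : ℂ)).congr_of_eventuallyEq
    (eventually_of_mem (H.isOpen.mem_nhds ht) h0))

lemma logDiff_mul_sub (ht : t ∈ U) (i j : ι) :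
    logDiff a a' t i j * (a i t - a j t) = a' i t - a' j t := by
  rcases H.eq_or_ne i j with h | h
  · rw [h t ht, H.deriv_eq_of_eqOn h ht, sub_self, sub_self, mul_zero]
  · exact div_mul_cancel₀ _ (sub_ne_zero.2 (h t ht))

lemma forall_mem_map_admissible (ht : t ∈ U) (w : List ι) :
    ∀ b ∈ w.map (a · t), Admissible b :=
  List.forall_mem_map.2 fun i _ => H.admissible i t ht

lemma hasDerivAt_neg_deriv_div_sub (i : ι) (ht : t ∈ U) (hx : 0 < x) :
    HasDerivAt (fun x : ℝ => -a' i t / ((x : ℂ) - a i t)) (a' i t / ((x : ℂ) - a i t) ^ 2) x := by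
  have hsub : HasDerivAt (fun x : ℝ => (x : ℂ) - a i t) 1 x :=
    Complex.ofRealCLM.hasDerivAt.sub_const _
  have hi := (H.admissible i t ht).sub_ne_zero hx
  refine ((hsub.fun_inv hi).const_mul (-a' i t)).congr_deriv ?_
  field_simp

lemma hasDerivAt_paramDeriv (i : ι) (v : List ι) (ht : t ∈ U) (hx : 0 < x) :
    HasDerivAt (fun x => paramDeriv a a' (i :: v) x t) (paramDerivIntegrand a a' i v x t) x := by
  have hΛ : ∀ j y, HasDerivAt (fun x => hyperlogWord ((j :: y).map (a · t)) x)
      (hyperlogWord (y.map (a · t)) x / ((x : ℂ) - a j t)) x := fun j y =>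
    hasDerivAt_hyperlogWord (H.forall_mem_map_admissible ht (j :: y)) hx
  have hi := (H.admissible i t ht).sub_ne_zero hx
  have hk := H.hasDerivAt_neg_deriv_div_sub i ht hx
  cases v with
  | nil =>
    refine ((hk.mul_const 1).add_const (-logDiffZero a a' t i * 1)).congr_deriv ?_
    simp only [paramDerivIntegrand, paramDeriv, boundaryTerm, letterDifferential_nil, List.map_nil,
      hyperlogWord_nil]
    field_simp
    ring
  | cons j v =>
    have hj := (H.admissible j t ht).sub_ne_zero hx
    have hD := (((hΛ i v).sub (hΛ j v)).const_mul (logDiff a a' t i j)).add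
      (hasDerivAt_letterDifferential (q := logDiff a a' t) (q₀ := logDiffZero a a' t)
        (hΛ i) (j :: v))
    refine ((hk.mul (hΛ j v)).add hD).congr_deriv ?_
    have hsmul : (fun y => hyperlogWord (y.map (a · t)) x / ((x : ℂ) - a i t)) =
        ((x : ℂ) - a i t)⁻¹ • fun y : List ι => hyperlogWord (y.map (a · t)) x :=
      funext fun y => div_eq_inv_mul _ _
    rw [hsmul, map_smul, smul_eq_mul, paramDerivIntegrand, paramDeriv, boundaryTerm]
    generalize letterDifferential _ _ (j :: v) _ = Q
    -- Partial fractions turn the difference of the two kernels into `a i t - a j t`.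
    have hpartial : logDiff a a' t i j * (hyperlogWord (v.map (a · t)) x / ((x : ℂ) - a i t) -
        hyperlogWord (v.map (a · t)) x / ((x : ℂ) - a j t)) =
        (a' i t - a' j t) * hyperlogWord (v.map (a · t)) x /
          (((x : ℂ) - a i t) * ((x : ℂ) - a j t)) := by
      rw [← H.logDiff_mul_sub ht i j]
      field_simp
      ring
    rw [hpartial]
    field_simp
    ring

lemma hasRegLimAtZero_neg_deriv_div_sub (i : ι) (ht : t ∈ U) :
    HasRegLimAtZero (fun x : ℝ => -a' i t / ((x : ℂ) - a i t)) (logDiffZero a a' t i) := by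
  by_cases h0 : a i t = 0
  · simpa [logDiffZero, H.deriv_eq_zero ht h0] using HasRegLimAtZero.const 0
  · have hA : AnalyticAt ℂ (fun x : ℂ => -a' i t / (x - a i t)) 0 :=
      analyticAt_const.div (analyticAt_id.sub analyticAt_const) (by simpa using h0)
    simpa [logDiffZero, neg_div_neg_eq] using HasRegLimAtZero.of_analyticAt hA

lemma hasRegLimAtZero_paramDeriv (i : ι) (v : List ι) (ht : t ∈ U) :
    HasRegLimAtZero (fun x => paramDeriv a a' (i :: v) x t) 0 := by
  have hΛ : ∀ y : List ι, HasRegLimAtZero (fun x => hyperlogWord (y.map (a · t)) x)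
      (if y = [] then 1 else 0) := fun y => by
    simpa using hasRegLimAtZero_hyperlogWord (H.forall_mem_map_admissible ht y)
  have hD := hasRegLimAtZero_letterDifferential (w := i :: v)
    (fun i j => HasRegLimAtZero.const (logDiff a a' t i j))
    (fun i => HasRegLimAtZero.const (logDiffZero a a' t i)) fun y _ => hΛ y
  have h : HasRegLimAtZero (fun x => paramDeriv a a' (i :: v) x t) _ :=
    ((H.hasRegLimAtZero_neg_deriv_div_sub i ht).mul (hΛ v)).add hD
  cases v with
  | nil => simpa only [letterDifferential_singleton, if_true, mul_one, add_neg_cancel] using h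
  | cons j v =>
    have hzero : letterDifferential (logDiff a a' t) (logDiffZero a a' t) (i :: j :: v)
        (fun y : List ι => if y = [] then (1 : ℂ) else 0) = 0 := by
      refine (letterDifferential_congr (Λ' := 0) fun y hy => if_neg ?_).trans (map_zero _)
      rintro rfl
      simp at hy
    simpa only [hzero, if_neg (List.cons_ne_nil j v), mul_zero, add_zero] using h

lemma continuousOn_paramDeriv (w : List ι) (ht : t ∈ U) :
    ContinuousOn (fun x => paramDeriv a a' w x t) (Set.Ioi 0) := by
  cases w with
  | nil => exact continuousOn_const (c := (0 : ℂ) + 0)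
  | cons i v =>
    exact fun x hx => (H.hasDerivAt_paramDeriv i v ht hx).continuousAt.continuousWithinAt

lemma paramDeriv_eq_zero {w : List ι} (hw : ∀ i ∈ w, ∀ t ∈ U, a i t = 0) (ht : t ∈ U) (x : ℝ) :
    paramDeriv a a' w x t = 0 := by
  have ha' : ∀ i ∈ w, a' i t = 0 := fun i hi => H.deriv_eq_zero ht (hw i hi t ht)
  rw [paramDeriv, letterDifferential_eq_zero
    (fun i hi j hj => by simp [logDiff, ha' i hi, ha' j hj])
    (fun i hi => by simp [logDiffZero, ha' i hi]), add_zero]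
  cases w with
  | nil => rfl
  | cons i v => rw [boundaryTerm, ha' i (by simp), neg_zero, zero_div, zero_mul]

lemma hasDerivAt_hyperlogWord_map_of_forall_eq_zero {w : List ι}
    (hw : ∀ i ∈ w, ∀ t ∈ U, a i t = 0) (ht : t ∈ U) (x : ℝ) :
    HasDerivAt (fun t => hyperlogWord (w.map (a · t)) x) (paramDeriv a a' w x t) t := by
  rw [H.paramDeriv_eq_zero hw ht]
  refine (hasDerivAt_const t (hyperlogWord (w.map fun _ => 0) x)).congr_of_eventuallyEq ?_
  filter_upwards [H.isOpen.mem_nhds ht] with s hs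
  rw [List.map_congr_left fun i hi => hw i hi s hs]

end LetterFamily

lemma regHyperlog_map {α : Type*} (f : α → ℂ) (v : List α) (z : ℝ) :
    regHyperlog (v.map f) z =
      suffixSum (fun y => hyperlogWord (y.map f) z) (dividedPow (-(Real.log z : ℂ))) v := by
  simp only [regHyperlog, suffixSum, List.length_map, List.map_drop]

lemma suffixSum_paramDeriv (w : List ι) (z t : ℝ) :
    suffixSum (paramDeriv a a' · z t) (dividedPow (-(Real.log z : ℂ))) w =
      suffixSum (boundaryTerm a a' · z t) (dividedPow (-(Real.log z : ℂ))) w +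
        letterDifferential (logDiff a a' t) (logDiffZero a a' t) w
          fun v => regHyperlog (v.map (a · t)) z := by
  simp only [regHyperlog_map]
  rw [letterDifferential_suffixSum]
  simp only [suffixSum, paramDeriv, mul_add, Finset.sum_add_distrib]

/-- A family of letters together with the bounds on the parameter set which make all estimates
for hyperlogarithms of words in these letters uniform in the parameter. -/
structure UniformLetterFamily (V : Set ℝ) (a a' : ι → ℝ → ℂ) (c M : ℝ) : Prop
    extends LetterFamily V a a' where
  pos : 0 < c
  le_one : c ≤ 1
  nonneg : 0 ≤ M
  eq_zero_or_isSeparated : ∀ t ∈ V, ∀ i, a i t = 0 ∨ IsSeparated c (a i t)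
  norm_le : ∀ t ∈ V, ∀ i, ‖a i t‖ ≤ M
  norm_deriv_le : ∀ t ∈ V, ∀ i, ‖a' i t‖ ≤ M
  norm_logDiff_le : ∀ t ∈ V, ∀ i j, ‖logDiff a a' t i j‖ ≤ M
  norm_logDiffZero_le : ∀ t ∈ V, ∀ i, ‖logDiffZero a a' t i‖ ≤ M

lemma exists_forall_isSeparated [Finite ι] {f : ι → ℂ} (hf : ∀ i, Admissible (f i)) :
    ∃ c, 0 < c ∧ c ≤ 1 ∧ ∀ i, f i = 0 ∨ IsSeparated c (f i) := by
  cases nonempty_fintype ι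
  obtain ⟨c, hc, hc1, h⟩ := exists_forall_mem_isSeparated (w := Finset.univ.toList.map f)
    (List.forall_mem_map.2 fun i _ => hf i)
  exact ⟨c, hc, hc1, fun i => h _ (List.mem_map_of_mem (Finset.mem_toList.2 (Finset.mem_univ i)))⟩

lemma eventually_eventually_forall_norm_le {κ : Type*} [Finite κ] {f : κ → ℝ → ℂ} {t₀ : ℝ}
    (hf : ∀ k, ContinuousAt (f k) t₀) :
    ∀ᶠ M : ℝ in atTop, ∀ᶠ t in 𝓝 t₀, ∀ k, ‖f k t‖ ≤ M := by
  have hM : ∀ᶠ M : ℝ in atTop, ∀ k, ‖f k t₀‖ < M :=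
    eventually_all.2 fun k => eventually_gt_atTop _
  filter_upwards [hM] with M hM
  exact eventually_all.2 fun k =>
    ((hf k).norm.eventually_lt_const (hM k)).mono fun t ht => ht.le

namespace LetterFamily

variable (H : LetterFamily U a a') {t₀ : ℝ}
include H

lemma continuousAt (ht₀ : t₀ ∈ U) (i : ι) : ContinuousAt (a i) t₀ :=
  (H.hasDerivAt i t₀ ht₀).continuousAt

lemma continuousAt_deriv (ht₀ : t₀ ∈ U) (i : ι) : ContinuousAt (a' i) t₀ :=
  (H.continuousOn_deriv i).continuousAt (H.isOpen.mem_nhds ht₀)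

lemma continuousAt_logDiff (ht₀ : t₀ ∈ U) (i j : ι) :
    ContinuousAt (fun t => logDiff a a' t i j) t₀ := by
  rcases H.eq_or_ne i j with h | h
  · refine (continuousAt_const (y := (0 : ℂ))).congr ?_
    filter_upwards [H.isOpen.mem_nhds ht₀] with t ht
    rw [logDiff, h t ht, sub_self, div_zero]
  · exact ((H.continuousAt_deriv ht₀ i).sub (H.continuousAt_deriv ht₀ j)).div
      ((H.continuousAt ht₀ i).sub (H.continuousAt ht₀ j)) (sub_ne_zero.2 (h t₀ ht₀))

lemma continuousAt_logDiffZero (ht₀ : t₀ ∈ U) (i : ι) :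
    ContinuousAt (fun t => logDiffZero a a' t i) t₀ := by
  rcases H.eq_zero_or_ne_zero i with h | h
  · refine (continuousAt_const (y := (0 : ℂ))).congr ?_
    filter_upwards [H.isOpen.mem_nhds ht₀] with t ht
    rw [logDiffZero, h t ht, div_zero]
  · exact (H.continuousAt_deriv ht₀ i).div (H.continuousAt ht₀ i) (h t₀ ht₀)

lemma exists_eventually_isSeparated [Finite ι] (ht₀ : t₀ ∈ U) :
    ∃ c, 0 < c ∧ c ≤ 1 ∧ ∀ᶠ t in 𝓝 t₀, ∀ i, a i t = 0 ∨ IsSeparated c (a i t) := by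
  obtain ⟨c, hc, hc1, hsep⟩ := exists_forall_isSeparated fun i => H.admissible i t₀ ht₀
  refine ⟨c / 2, by positivity, by linarith, eventually_all.2 fun i => ?_⟩
  rcases H.eq_zero_or_ne_zero i with h | h
  · filter_upwards [H.isOpen.mem_nhds ht₀] with t ht using Or.inl (h t ht)
  · have hi : IsSeparated (2 * (c / 2)) (a i t₀) :=
      (mul_div_cancel₀ c two_ne_zero).symm ▸ (hsep i).resolve_left (h t₀ ht₀)
    filter_upwards [Metric.tendsto_nhds.1 (H.continuousAt ht₀ i) (c / 2) (by positivity)] with t ht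
    exact Or.inr (hi.of_norm_sub_le (by positivity) (dist_eq_norm (a i t) _ ▸ ht.le))

lemma exists_uniformLetterFamily [Finite ι] (ht₀ : t₀ ∈ U) :
    ∃ (V : Set ℝ) (c M : ℝ), t₀ ∈ V ∧ UniformLetterFamily V a a' c M := by
  obtain ⟨c, hc, hc1, hsep⟩ := H.exists_eventually_isSeparated ht₀
  obtain ⟨M, hM, hM', hMq, hMq₀, hM0⟩ :=
    ((eventually_eventually_forall_norm_le (H.continuousAt ht₀)).and
      ((eventually_eventually_forall_norm_le (H.continuousAt_deriv ht₀)).and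
        ((eventually_eventually_forall_norm_le
          fun p : ι × ι => H.continuousAt_logDiff ht₀ p.1 p.2).and
            ((eventually_eventually_forall_norm_le (H.continuousAt_logDiffZero ht₀)).and
              (eventually_ge_atTop 0))))).exists
  obtain ⟨V, hV, hVo, htV⟩ := mem_nhds_iff.1
    (hM.and (hM'.and (hMq.and (hMq₀.and (hsep.and (H.isOpen.mem_nhds ht₀))))))
  choose hM hM' hMq hMq₀ hsep hVU using @hV
  exact ⟨V, c, M, htV,
    { toLetterFamily := H.mono hVo fun t ht => hVU ht
      pos := hc
      le_one := hc1
      nonneg := hM0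
      eq_zero_or_isSeparated := fun t ht => hsep ht
      norm_le := fun t ht => hM ht
      norm_deriv_le := fun t ht => hM' ht
      norm_logDiff_le := fun t ht i j => hMq ht (i, j)
      norm_logDiffZero_le := fun t ht => hMq₀ ht }⟩

end LetterFamily

namespace UniformLetterFamily

variable {V : Set ℝ} {c M t x : ℝ} (H : UniformLetterFamily V a a' c M)
include H

lemma isTameWord (ht : t ∈ V) (w : List ι) : IsTameWord c (w.map (a · t)) :=
  .of_forall_mem H.pos H.le_one (List.forall_mem_map.2 fun i _ => H.eq_zero_or_isSeparated t ht i)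

lemma isSeparatedWord (ht : t ∈ V) {w : List ι} (hw : ∃ i ∈ w, ∀ t ∈ V, a i t ≠ 0) :
    IsSeparatedWord c (w.map (a · t)) := by
  obtain ⟨i, hi, h0⟩ := hw
  refine (H.isTameWord ht w).resolve_left fun h => h0 t ht ?_
  exact List.eq_of_mem_replicate (h ▸ List.mem_map_of_mem (f := (a · t)) hi)

lemma isConicallySeparated (ht : t ∈ V) (i : ι) : IsConicallySeparated c (a i t) := by
  rcases H.eq_zero_or_isSeparated t ht i with h | h
  · exact h ▸ .zero H.le_one
  · exact h.isConicallySeparated H.pos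

lemma norm_deriv_div_sub_le (ht : t ∈ V) (i : ι) (hx : 0 < x) :
    ‖a' i t / ((x : ℂ) - a i t)‖ ≤ M / c := by
  rcases H.eq_zero_or_isSeparated t ht i with h | h
  · rw [H.deriv_eq_zero ht h, zero_div, norm_zero]
    exact div_nonneg H.nonneg H.pos.le
  · rw [norm_div]
    refine div_le_div₀ H.nonneg (H.norm_deriv_le t ht i) H.pos (le_trans ?_ (h x hx))
    nlinarith [H.pos]

lemma continuousOn_hyperlogWord_div_sub (ht : t ∈ V) (i : ι) (v : List ι) :
    ContinuousOn (fun x : ℝ => hyperlogWord (v.map (a · t)) x / ((x : ℂ) - a i t)) (Set.Ioi 0) :=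
  (H.isConicallySeparated ht i).continuousOn_div_sub H.pos
    (continuousOn_hyperlogWord (H.forall_mem_map_admissible ht v))

lemma continuousOn_paramDerivIntegrand (ht : t ∈ V) (i : ι) (v : List ι) :
    ContinuousOn (fun x => paramDerivIntegrand a a' i v x t) (Set.Ioi 0) :=
  ((H.isConicallySeparated ht i).continuousOn_div_sub H.pos (H.continuousOn_paramDeriv v ht)).add
    (((H.isConicallySeparated ht i).continuousOn_div_sub H.pos continuousOn_const).mul
      (H.continuousOn_hyperlogWord_div_sub ht i v))

lemma exists_norm_hyperlogWord_div_sub_le {i : ι} {v : List ι}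
    (hw : ∃ j ∈ i :: v, ∀ t ∈ V, a j t ≠ 0) :
    ∃ K, 0 ≤ K ∧ ∀ t ∈ V, ∀ x : ℝ, 0 < x →
      ‖hyperlogWord (v.map (a · t)) x / ((x : ℂ) - a i t)‖ ≤ K / √x := by
  obtain ⟨K, hK, h⟩ := Hyperlogarithm.exists_norm_hyperlogWord_div_sub_le H.pos H.le_one v.length
  exact ⟨K, hK, fun t ht x hx => h _ _ (List.length_map _).le (H.isSeparatedWord ht hw) x hx⟩

lemma exists_norm_paramDerivIntegrand_le {i : ι} {v : List ι}
    (hw : ∃ j ∈ i :: v, ∀ t ∈ V, a j t ≠ 0) {K : ℝ} (hK : 0 ≤ K)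
    (hv : ∀ t ∈ V, ∀ x, 0 < x → ‖paramDeriv a a' v x t‖ ≤ K * √x) :
    ∃ K', 0 ≤ K' ∧ ∀ t ∈ V, ∀ x, 0 < x → ‖paramDerivIntegrand a a' i v x t‖ ≤ K' / √x := by
  have hc := H.pos
  have hM := H.nonneg
  obtain ⟨D, hD, hdiv⟩ := H.exists_norm_hyperlogWord_div_sub_le hw
  refine ⟨K / c + M / c * D, by positivity, fun t ht x hx => ?_⟩
  rw [add_div, mul_div_assoc]
  refine norm_add_le_of_le
    ((H.isConicallySeparated ht i).norm_div_sub_le hc hx hK (hv t ht x hx)) ?_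
  rw [norm_mul]
  exact mul_le_mul (H.norm_deriv_div_sub_le ht i hx) (hdiv t ht x hx) (norm_nonneg _)
    (by positivity)

lemma exists_norm_paramDeriv_le (w : List ι) :
    ∃ K, 0 ≤ K ∧ ∀ t ∈ V, ∀ x, 0 < x → ‖paramDeriv a a' w x t‖ ≤ K * √x := by
  induction w with
  | nil =>
    refine ⟨0, le_rfl, fun t ht x _ => ?_⟩
    rw [H.paramDeriv_eq_zero (by simp) ht, norm_zero, zero_mul]
  | cons i v ih =>
    obtain ⟨K, hK, hv⟩ := ih
    rcases H.exists_ne_zero_or_forall_eq_zero (i :: v) with hw | hw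
    · obtain ⟨K', hK', h⟩ := H.exists_norm_paramDerivIntegrand_le hw hK hv
      refine ⟨2 * K', by positivity, fun t ht x hx => ?_⟩
      rw [eq_integral_of_hasDerivAt_of_hasRegLimAtZero
        (fun x hx => H.hasDerivAt_paramDeriv i v ht hx) (H.hasRegLimAtZero_paramDeriv i v ht)
        (H.continuousOn_paramDerivIntegrand ht i v) (h t ht) hx]
      exact norm_integral_le_mul_sqrt (h t ht) hx
    · refine ⟨0, le_rfl, fun t ht x _ => ?_⟩
      rw [H.paramDeriv_eq_zero hw ht, norm_zero, zero_mul]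

lemma hasDerivAt_hyperlogWord_div_sub (i : ι) {v : List ι} (ht : t ∈ V) (hx : 0 < x)
    (hv : HasDerivAt (fun t => hyperlogWord (v.map (a · t)) x) (paramDeriv a a' v x t) t) :
    HasDerivAt (fun t => hyperlogWord (v.map (a · t)) x / ((x : ℂ) - a i t))
      (paramDerivIntegrand a a' i v x t) t := by
  have hne := (H.isConicallySeparated ht i).sub_ne_zero H.pos hx
  refine (hv.div ((H.hasDerivAt i t ht).const_sub (x : ℂ)) hne).congr_deriv ?_
  rw [paramDerivIntegrand]
  field_simp
  ring

lemma hasDerivAt_hyperlogWord_map_cons {i : ι} {v : List ι}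
    (hw : ∃ j ∈ i :: v, ∀ t ∈ V, a j t ≠ 0)
    (hv : ∀ t ∈ V, ∀ x, 0 < x →
      HasDerivAt (fun t => hyperlogWord (v.map (a · t)) x) (paramDeriv a a' v x t) t)
    (ht : t ∈ V) (hx : 0 < x) :
    HasDerivAt (fun t => hyperlogWord ((i :: v).map (a · t)) x)
      (paramDeriv a a' (i :: v) x t) t := by
  obtain ⟨K, hK, hbound⟩ := H.exists_norm_paramDeriv_le v
  obtain ⟨K', -, hK'⟩ := H.exists_norm_paramDerivIntegrand_le hw hK hbound
  obtain ⟨D, -, hD⟩ := H.exists_norm_hyperlogWord_div_sub_le hw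
  have hV := H.isOpen.mem_nhds ht
  have hmeas {g : ℝ → ℂ} (hg : ContinuousOn g (Set.Ioi 0)) :
      AEStronglyMeasurable g (volume.restrict (Set.uIoc 0 x)) := by
    rw [Set.uIoc_of_le hx.le]
    exact (hg.mono fun y hy => hy.1).aestronglyMeasurable measurableSet_Ioc
  have hpos : ∀ y ∈ Set.uIoc 0 x, 0 < y := by
    rw [Set.uIoc_of_le hx.le]
    exact fun y hy => hy.1
  have hint : IntervalIntegrable
      (fun y : ℝ => hyperlogWord (v.map (a · t)) y / ((y : ℂ) - a i t)) volume 0 x :=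
    (intervalIntegrable_div_sqrt D hx.le).mono_fun'
      (hmeas (H.continuousOn_hyperlogWord_div_sub ht i v))
      ((ae_restrict_mem measurableSet_uIoc).mono fun y hy => hD t ht y (hpos y hy))
  have hderiv := (intervalIntegral.hasDerivAt_integral_of_dominated_loc_of_deriv_le
    (F := fun s y => hyperlogWord (v.map (a · s)) y / ((y : ℂ) - a i s))
    (F' := fun s y => paramDerivIntegrand a a' i v y s) hV
    (eventually_of_mem hV fun s hs => hmeas (H.continuousOn_hyperlogWord_div_sub hs i v)) hint
    (hmeas (H.continuousOn_paramDerivIntegrand ht i v))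
    (Eventually.of_forall fun y hy s hs => hK' s hs y (hpos y hy))
    (intervalIntegrable_div_sqrt K' hx.le)
    (Eventually.of_forall fun y hy s hs =>
      H.hasDerivAt_hyperlogWord_div_sub i hs (hpos y hy) (hv s hs y (hpos y hy)))).2
  rw [eq_integral_of_hasDerivAt_of_hasRegLimAtZero
    (fun x hx => H.hasDerivAt_paramDeriv i v ht hx) (H.hasRegLimAtZero_paramDeriv i v ht)
    (H.continuousOn_paramDerivIntegrand ht i v) (hK' t ht) hx]
  refine hderiv.congr_of_eventuallyEq (eventually_of_mem hV fun s hs => ?_)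
  exact hyperlogWord_cons ((H.isSeparatedWord hs hw).exists_mem_ne_zero H.pos) x

theorem hasDerivAt_hyperlogWord_map (w : List ι) (ht : t ∈ V) (hx : 0 < x) :
    HasDerivAt (fun t => hyperlogWord (w.map (a · t)) x) (paramDeriv a a' w x t) t := by
  induction w generalizing t x with
  | nil => exact H.hasDerivAt_hyperlogWord_map_of_forall_eq_zero (by simp) ht x
  | cons i v ih =>
    rcases H.exists_ne_zero_or_forall_eq_zero (i :: v) with hw | hw
    · exact H.hasDerivAt_hyperlogWord_map_cons hw (fun t ht x hx => ih ht hx) ht hx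
    · exact H.hasDerivAt_hyperlogWord_map_of_forall_eq_zero hw ht x

lemma norm_boundaryTerm_le {n : ℕ} {C : ℝ} (hC0 : 0 ≤ C)
    (hC : ∀ w : List ℂ, w.length ≤ n → IsTameWord c w → ∀ x, 1 ≤ x → ‖hyperlogWord w x‖ ≤ C * √x)
    {w : List ι} (hw : w.length ≤ n) (ht : t ∈ V) (hx : 1 ≤ x) :
    ‖boundaryTerm a a' w x t‖ ≤ M / c * x⁻¹ * (C * √x) := by
  have hM := H.nonneg
  have hc := H.pos
  have hx0 : 0 < x := one_pos.trans_le hx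
  cases w with
  | nil =>
    rw [boundaryTerm, norm_zero]
    positivity
  | cons i v =>
    rw [boundaryTerm, norm_mul, norm_div, norm_neg, ← div_eq_mul_inv, div_div]
    refine mul_le_mul ?_ (hC _ ?_ (H.isTameWord ht v) x hx) (norm_nonneg _) (by positivity)
    · exact div_le_div₀ hM (H.norm_deriv_le t ht i) (by positivity)
        (H.isConicallySeparated ht i x hx0)
    · rw [List.length_map]
      exact (Nat.le_succ _).trans hw

lemma exists_norm_suffixSum_boundaryTerm_le (w : List ι) :
    ∃ K, ∀ t ∈ V, ∀ z : ℝ, 1 ≤ z →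
      ‖suffixSum (boundaryTerm a a' · z t) (dividedPow (-(Real.log z : ℂ))) w‖ ≤
        K * z ^ (-(1 / 4) : ℝ) := by
  obtain ⟨C, hC0, hC⟩ := exists_norm_hyperlogWord_le_of_isTameWord H.pos H.le_one w.length
  refine ⟨∑ j ∈ Finset.range (w.length + 1), 4 ^ j * (M / c * C), fun t ht z hz => ?_⟩
  have hz0 : 0 < z := one_pos.trans_le hz
  have hexp : z ^ (1 / 4 : ℝ) * (z⁻¹ * √z) = z ^ (-(1 / 4) : ℝ) := by
    rw [Real.sqrt_eq_rpow, ← Real.rpow_neg_one, ← Real.rpow_add hz0, ← Real.rpow_add hz0]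
    norm_num
  rw [suffixSum, Finset.sum_mul]
  refine norm_sum_le_of_le _ fun j _ => ?_
  rw [norm_mul]
  calc _ ≤ 4 ^ j * z ^ (1 / 4 : ℝ) * (M / c * z⁻¹ * (C * √z)) :=
        mul_le_mul (norm_dividedPow_neg_log_le j hz)
          (H.norm_boundaryTerm_le hC0 hC (List.length_drop.trans_le (Nat.sub_le ..)) ht hz)
          (norm_nonneg _)
          (by positivity)
    _ = 4 ^ j * (M / c * C) * (z ^ (1 / 4 : ℝ) * (z⁻¹ * √z)) := by ring
    _ = _ := by rw [hexp]

lemma exists_norm_letterDifferential_sub_suffixSum_paramDeriv_le (w : List ι) :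
    ∃ K, ∀ t ∈ V, ∀ z : ℝ, 1 ≤ z →
      ‖letterDifferential (logDiff a a' t) (logDiffZero a a' t) w
          (fun v => regValue (v.map (a · t))) -
        suffixSum (paramDeriv a a' · z t) (dividedPow (-(Real.log z : ℂ))) w‖ ≤
          K * z ^ (-(1 / 4) : ℝ) := by
  obtain ⟨K, -, hK⟩ :=
    exists_norm_regValue_sub_regHyperlog_le H.pos H.le_one H.nonneg w.length
  obtain ⟨B, hB⟩ := H.exists_norm_suffixSum_boundaryTerm_le w
  refine ⟨w.length * (2 * M * K) + B, fun t ht z hz => ?_⟩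
  have hdiff : ‖letterDifferential (logDiff a a' t) (logDiffZero a a' t) w
      ((fun v => regValue (v.map (a · t))) - fun v => regHyperlog (v.map (a · t)) z)‖ ≤
        w.length * (2 * M * (K * z ^ (-(1 / 4) : ℝ))) := by
    refine norm_letterDifferential_le (H.norm_logDiff_le t ht) (H.norm_logDiffZero_le t ht)
      H.nonneg fun v hv => ?_
    exact hK _ (by rw [List.length_map]; lia) (H.isTameWord ht v)
      (List.forall_mem_map.2 fun i _ => H.norm_le t ht i) z hz
  rw [suffixSum_paramDeriv, add_comm, ← sub_sub, ← map_sub]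
  refine (norm_sub_le_of_le hdiff (hB t ht z hz)).trans_eq ?_
  ring

theorem hasDerivAt_regValue (w : List ι) (ht : t ∈ V) :
    HasDerivAt (fun t => regValue (w.map (a · t)))
      (letterDifferential (logDiff a a' t) (logDiffZero a a' t) w
        fun v => regValue (v.map (a · t))) t := by
  obtain ⟨K, hK⟩ := H.exists_norm_letterDifferential_sub_suffixSum_paramDeriv_le w
  refine hasDerivAt_of_tendstoUniformlyOn (l := atTop) H.isOpen
    (f := fun z t => regHyperlog (w.map (a · t)) z)
    (f' := fun z t => suffixSum (paramDeriv a a' · z t) (dividedPow (-(Real.log z : ℂ))) w)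
    (g' := fun t => letterDifferential (logDiff a a' t) (logDiffZero a a' t) w
      fun v => regValue (v.map (a · t))) ?_ ?_ ?_ ht
  · rw [Metric.tendstoUniformlyOn_iff]
    intro ε hε
    filter_upwards [eventually_ge_atTop (1 : ℝ),
      (tendsto_mul_rpow_neg_quarter K).eventually_lt_const hε] with z hz hzε s hs
    exact (dist_eq_norm_sub _ _).trans_lt ((hK s hs z hz).trans_lt hzε)
  · filter_upwards [eventually_gt_atTop (0 : ℝ)] with z hz s hs
    simp only [regHyperlog_map]
    exact HasDerivAt.fun_sum fun j _ =>
      (H.hasDerivAt_hyperlogWord_map (w.drop j) hs hz).const_mul _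
  · exact fun s hs => tendsto_regHyperlog (H.forall_mem_map_admissible hs w)

end UniformLetterFamily

theorem LetterFamily.hasDerivAt_regValue [Finite ι] (H : LetterFamily U a a') (w : List ι) {t : ℝ}
    (ht : t ∈ U) :
    HasDerivAt (fun t => regValue (w.map (a · t)))
      (letterDifferential (logDiff a a' t) (logDiffZero a a' t) w
        fun v => regValue (v.map (a · t))) t := by
  obtain ⟨V, c, M, htV, HV⟩ := H.exists_uniformLetterFamily ht
  exact HV.hasDerivAt_regValue w htV

theorem LetterFamily.exists_hasRegLimAtZero_regValue [Finite ι] {δ : ℝ} (hδ : 0 < δ)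
    (H : LetterFamily (Set.Ioo 0 δ) a a')
    (hq : ∀ i j, ∃ d, HasRegLimAtZero (fun t => t * logDiff a a' t i j) d)
    (hq₀ : ∀ i, ∃ d, HasRegLimAtZero (fun t => t * logDiffZero a a' t i) d) (w : List ι) :
    ∃ d, HasRegLimAtZero (fun t => regValue (w.map (a · t))) d := by
  choose d hd using hq
  choose d₀ hd₀ using hq₀
  induction hn : w.length generalizing w with
  | zero =>
    rw [List.eq_nil_of_length_eq_zero hn]
    exact ⟨_, HasRegLimAtZero.const (regValue [])⟩
  | succ n ih =>
    have hΛ : ∀ v : List ι, ∃ e, v.length + 1 = w.length →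
        HasRegLimAtZero (fun t => regValue (v.map (a · t))) e := fun v => by
      by_cases hv : v.length + 1 = w.length
      · exact (ih v (by lia)).imp fun e he _ => he
      · exact ⟨0, fun h => absurd h hv⟩
    choose e he using hΛ
    refine exists_hasRegLimAtZero_of_hasDerivAt
      (eventually_of_mem (Ioo_mem_nhdsGT hδ) fun t ht => H.hasDerivAt_regValue w ht)
      ((hasRegLimAtZero_letterDifferential hd hd₀ he).congr (Eventually.of_forall fun t => ?_))
    exact letterDifferential_mul_coeff ..

end LetterFamily

/-! ### Meromorphic letters -/

lemma tendsto_ofReal_nhdsGT_nhdsNE :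
    Tendsto (fun t : ℝ => (t : ℂ)) (𝓝[>] 0) (𝓝[≠] 0) :=
  tendsto_nhdsWithin_of_tendsto_nhds_of_eventually_within _ tendsto_ofReal_nhdsGT_zero <| by
    filter_upwards [self_mem_nhdsWithin] with t ht
    exact Complex.ofReal_ne_zero.2 (ne_of_gt ht)

lemma HasRegLimAtZero.of_meromorphicOrderAt_nonneg {f : ℂ → ℂ} (hf : MeromorphicAt f 0)
    (h : 0 ≤ meromorphicOrderAt f 0) :
    HasRegLimAtZero (fun t => f t) (toMeromorphicNFAt f 0 0) :=
  (of_analyticAt (hf.meromorphicOrderAt_nonneg_iff_analyticAt_toMeromorphicNFAt.1 h)).congr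
    (tendsto_ofReal_nhdsGT_nhdsNE.eventually (hf.eq_nhdsNE_toMeromorphicNFAt.mono fun _ => Eq.symm))

lemma meromorphicOrderAt_id_mul_logDeriv_nonneg {f : ℂ → ℂ} (hf : MeromorphicAt f 0) :
    0 ≤ meromorphicOrderAt (id * logDeriv f) 0 := by
  rw [meromorphicOrderAt_mul (MeromorphicAt.id 0) hf.logDeriv, meromorphicOrderAt_id]
  by_cases h₀ : meromorphicOrderAt f 0 = 0
  · exact add_nonneg zero_le_one (meromorphicOrderAt_logDeriv_nonneg hf h₀)
  by_cases htop : meromorphicOrderAt f 0 = ⊤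
  · have hlog : logDeriv f =ᶠ[𝓝[≠] 0] logDeriv fun _ => 0 :=
      logDeriv_congr_nhdsNE (meromorphicOrderAt_eq_top_iff.1 htop)
    have : meromorphicOrderAt (logDeriv f) 0 = ⊤ :=
      meromorphicOrderAt_eq_top_iff.2 (hlog.mono fun z hz => by rw [hz, logDeriv_const]; rfl)
    simp [this]
  · rw [meromorphicOrderAt_logDeriv_eq_neg_one hf h₀ htop]
    decide

lemma exists_hasRegLimAtZero_mul_logDeriv {f : ℂ → ℂ} (hf : MeromorphicAt f 0) :
    ∃ d, HasRegLimAtZero (fun t : ℝ => t * logDeriv f t) d :=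
  ⟨_, .of_meromorphicOrderAt_nonneg ((MeromorphicAt.id 0).mul hf.logDeriv)
    (meromorphicOrderAt_id_mul_logDeriv_nonneg hf)⟩

lemma eventually_forall_mem_Ioo {p : ℝ → Prop} (h : ∀ᶠ t in 𝓝[>] 0, p t) :
    ∀ᶠ δ : ℝ in 𝓝[>] 0, ∀ t ∈ Set.Ioo 0 δ, p t := by
  obtain ⟨u, hu, hsub⟩ := mem_nhdsGT_iff_exists_Ioo_subset.1 h
  filter_upwards [Ioo_mem_nhdsGT hu] with δ hδ t ht
  exact hsub ⟨ht.1, ht.2.trans hδ.2⟩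

lemma eventually_forall_eq_zero_or_forall_ne_zero {f : ℂ → ℂ} (hf : MeromorphicAt f 0) :
    ∀ᶠ δ : ℝ in 𝓝[>] 0, (∀ t ∈ Set.Ioo 0 δ, f t = 0) ∨ ∀ t ∈ Set.Ioo 0 δ, f t ≠ 0 :=
  hf.eventually_eq_zero_or_eventually_ne_zero.elim
    (fun h => (eventually_forall_mem_Ioo (tendsto_ofReal_nhdsGT_nhdsNE.eventually h)).mono
      fun _ => Or.inl)
    (fun h => (eventually_forall_mem_Ioo (tendsto_ofReal_nhdsGT_nhdsNE.eventually h)).mono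
      fun _ => Or.inr)

lemma eventually_letterFamily {ι : Type*} [Finite ι] {g : ι → ℂ → ℂ}
    (hg : ∀ i, MeromorphicAt (g i) 0) (hadm : ∀ i, ∀ᶠ t : ℝ in 𝓝[>] 0, Admissible (g i t)) :
    ∀ᶠ δ : ℝ in 𝓝[>] 0, (∀ i, ∀ t ∈ Set.Ioo 0 δ, AnalyticAt ℂ (g i) (t : ℂ)) ∧
      LetterFamily (Set.Ioo 0 δ) (fun i t => g i t) (fun i t => deriv (g i) t) := by
  filter_upwards [
    eventually_all.2 fun i => eventually_forall_mem_Ioo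
      (tendsto_ofReal_nhdsGT_nhdsNE.eventually (hg i).eventually_analyticAt),
    eventually_all.2 fun i => eventually_forall_mem_Ioo (hadm i),
    eventually_all.2 fun i => eventually_forall_eq_zero_or_forall_ne_zero (hg i),
    eventually_all.2 fun i => eventually_all.2 fun j =>
      eventually_forall_eq_zero_or_forall_ne_zero ((hg i).sub (hg j))] with δ han had h₀ hsub
  exact ⟨han,
    { isOpen := isOpen_Ioo
      hasDerivAt := fun i t ht => (han i t ht).differentiableAt.hasDerivAt.comp_ofReal
      continuousOn_deriv := fun i t ht =>
        ((han i t ht).deriv.continuousAt.comp (f := fun t : ℝ => (t : ℂ))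
          Complex.continuous_ofReal.continuousAt).continuousWithinAt
      admissible := had
      eq_zero_or_ne_zero := h₀
      eq_or_ne := fun i j => (hsub i j).imp (fun h t ht => sub_eq_zero.1 (h t ht))
        (fun h t ht => sub_ne_zero.1 (h t ht)) }⟩

theorem exists_hasRegLimAtZero_regValue_of_meromorphicAt {κ : Type*} {g : κ → ℂ → ℂ} {w : List κ}
    (hg : ∀ k ∈ w, MeromorphicAt (g k) 0)
    (hadm : ∀ k ∈ w, ∀ᶠ t : ℝ in 𝓝[>] 0, Admissible (g k t)) :
    ∃ d, HasRegLimAtZero (fun t => regValue (w.map (g · t))) d := by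
  have : Finite {k // k ∈ w} := List.finite_toSet w
  obtain ⟨δ, ⟨han, H⟩, hδ⟩ := ((eventually_letterFamily (fun k : {k // k ∈ w} => hg k k.2)
    fun k => hadm k k.2).and self_mem_nhdsWithin).exists
  obtain ⟨d, hd⟩ := H.exists_hasRegLimAtZero_regValue hδ
    (fun i j => by
      obtain ⟨d, hd⟩ := exists_hasRegLimAtZero_mul_logDeriv ((hg i i.2).sub (hg j j.2))
      refine ⟨d, hd.congr ?_⟩
      filter_upwards [Ioo_mem_nhdsGT hδ] with t ht
      rw [logDeriv_apply, deriv_sub (han i t ht).differentiableAt (han j t ht).differentiableAt]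
      rfl)
    (fun i => exists_hasRegLimAtZero_mul_logDeriv (hg i i.2)) w.attach
  refine ⟨d, hd.congr (Eventually.of_forall fun t => ?_)⟩
  rw [List.attach_map_val (f := (g · t))]

/-! ### Rational functions at the origin -/

lemma exists_eq_X_pow_mul {p : Polynomial ℂ} (hp : p ≠ 0) :
    ∃ (n : ℕ) (q : Polynomial ℂ), q.eval 0 ≠ 0 ∧ p = Polynomial.X ^ n * q := by
  obtain ⟨q, hq, hd⟩ := p.exists_eq_pow_rootMultiplicity_mul_and_not_dvd hp 0
  exact ⟨_, q, fun h => hd (Polynomial.dvd_iff_isRoot.2 h), by simpa using hq⟩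

lemma laurent_mul (σ τ : RatFunc ℂ) : laurent (σ * τ) = laurent σ * laurent τ :=
  map_mul _ σ τ

lemma vanishingDeg_mul (σ τ : RatFunc ℂ) :
    vanishingDeg (σ * τ) = vanishingDeg σ + vanishingDeg τ := by
  rw [vanishingDeg, laurent_mul, HahnSeries.orderTop_mul, vanishingDeg, vanishingDeg]

lemma leadingCoeff_mul (σ τ : RatFunc ℂ) :
    leadingCoeff (σ * τ) = leadingCoeff σ * leadingCoeff τ := by
  rw [leadingCoeff, laurent_mul, HahnSeries.leadingCoeff_mul, leadingCoeff, leadingCoeff]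

lemma vanishingDeg_eq_top_iff {σ : RatFunc ℂ} : vanishingDeg σ = ⊤ ↔ σ = 0 := by
  rw [vanishingDeg, HahnSeries.orderTop_eq_top, laurent, map_eq_zero]

lemma rescaledLimit_of_eq {σ : RatFunc ℂ} {d : ℤ} (h : vanishingDeg σ = d) :
    rescaledLimit d σ = leadingCoeff σ := by
  rw [leadingCoeff, HahnSeries.leadingCoeff, ← vanishingDeg, h]
  rfl

lemma rescaledLimit_of_lt {σ : RatFunc ℂ} {d : ℤ} (h : d < vanishingDeg σ) :
    rescaledLimit d σ = 0 :=
  HahnSeries.coeff_eq_zero_of_lt_orderTop h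

lemma laurent_algebraMap (p : Polynomial ℂ) :
    laurent (algebraMap _ _ p) = HahnSeries.ofPowerSeries ℤ ℂ p :=
  (RatFunc.coe_coe p).symm

lemma laurent_X_pow (n : ℕ) :
    laurent (algebraMap (Polynomial ℂ) _ (Polynomial.X ^ n)) = HahnSeries.single (n : ℤ) 1 := by
  rw [laurent_algebraMap, Polynomial.coe_pow, Polynomial.coe_X, map_pow,
    HahnSeries.ofPowerSeries_X, HahnSeries.single_pow, one_pow, nsmul_one]

lemma coeff_zero_laurent_algebraMap (p : Polynomial ℂ) :
    (laurent (algebraMap _ _ p)).coeff 0 = p.eval 0 := by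
  rw [laurent_algebraMap, ← Nat.cast_zero (R := ℤ), HahnSeries.ofPowerSeries_apply_coeff,
    Polynomial.coeff_coe, Polynomial.coeff_zero_eq_eval_zero]

lemma vanishingDeg_algebraMap {p : Polynomial ℂ} (hp : p.eval 0 ≠ 0) :
    vanishingDeg (algebraMap _ _ p) = (0 : ℤ) := by
  refine le_antisymm (HahnSeries.orderTop_le_of_coeff_ne_zero
    ((coeff_zero_laurent_algebraMap p).trans_ne hp)) ?_
  rw [vanishingDeg, laurent_algebraMap, HahnSeries.ofPowerSeries_apply,
    HahnSeries.orderTop_embDomain]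
  cases (HahnSeries.toPowerSeries.symm (p : PowerSeries ℂ)).orderTop with
  | top => exact le_top
  | coe n => exact WithTop.coe_le_coe.2 (Int.natCast_nonneg n)

lemma leadingCoeff_algebraMap {p : Polynomial ℂ} (hp : p.eval 0 ≠ 0) :
    leadingCoeff (algebraMap _ _ p) = p.eval 0 := by
  rw [← rescaledLimit_of_eq (vanishingDeg_algebraMap hp), rescaledLimit,
    coeff_zero_laurent_algebraMap]

lemma vanishingDeg_X_pow_mul (n : ℕ) {p : Polynomial ℂ} (hp : p.eval 0 ≠ 0) :
    vanishingDeg (algebraMap _ _ (Polynomial.X ^ n * p)) = (n : ℤ) := by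
  rw [map_mul, vanishingDeg_mul, vanishingDeg_algebraMap hp, vanishingDeg, laurent_X_pow,
    HahnSeries.orderTop_single one_ne_zero, ← WithTop.coe_add, add_zero]

lemma leadingCoeff_X_pow_mul (n : ℕ) {p : Polynomial ℂ} (hp : p.eval 0 ≠ 0) :
    leadingCoeff (algebraMap _ _ (Polynomial.X ^ n * p)) = p.eval 0 := by
  rw [map_mul, leadingCoeff_mul, leadingCoeff_algebraMap hp, leadingCoeff, laurent_X_pow,
    HahnSeries.leadingCoeff_of_single, one_mul]

lemma exists_eval_eq_zpow_mul {σ : RatFunc ℂ} (hσ : σ ≠ 0) :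
    ∃ (N : ℤ) (h : ℂ → ℂ), vanishingDeg σ = N ∧ AnalyticAt ℂ h 0 ∧ h 0 = leadingCoeff σ ∧
      ∀ᶠ z in 𝓝[≠] 0, RatFunc.eval (RingHom.id ℂ) z σ = z ^ N * h z := by
  obtain ⟨m, p, hp, hnum⟩ := exists_eq_X_pow_mul (RatFunc.num_ne_zero hσ)
  obtain ⟨n, q, hq, hdenom⟩ := exists_eq_X_pow_mul (RatFunc.denom_ne_zero σ)
  have hmul : σ * algebraMap _ _ (Polynomial.X ^ n * q) =
      algebraMap _ _ (Polynomial.X ^ m * p) := by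
    rw [← hnum, ← hdenom]
    exact (eq_div_iff (RatFunc.algebraMap_ne_zero σ.denom_ne_zero)).1 σ.num_div_denom.symm
  have hdeg : vanishingDeg σ + (n : ℤ) = (m : ℤ) := by
    rw [← vanishingDeg_X_pow_mul m hp, ← hmul, vanishingDeg_mul, vanishingDeg_X_pow_mul n hq]
  have hlc : leadingCoeff σ * q.eval 0 = p.eval 0 := by
    rw [← leadingCoeff_X_pow_mul m hp, ← hmul, leadingCoeff_mul, leadingCoeff_X_pow_mul n hq]
  refine ⟨m - n, fun z => p.eval z / q.eval z, ?_,
    (p.differentiable.analyticAt 0).div (q.differentiable.analyticAt 0) hq,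
    (div_eq_iff hq).2 hlc.symm, ?_⟩
  · lift vanishingDeg σ to ℤ using vanishingDeg_eq_top_iff.not.2 hσ with N
    rw [← WithTop.coe_add, WithTop.coe_inj] at hdeg
    exact WithTop.coe_inj.2 (eq_sub_of_add_eq hdeg)
  · filter_upwards [self_mem_nhdsWithin] with z hz
    simp only [RatFunc.eval, hnum, hdenom, Polynomial.eval₂_id, Polynomial.eval_mul,
      Polynomial.eval_pow, Polynomial.eval_X]
    rw [zpow_sub₀ hz, zpow_natCast, zpow_natCast, mul_div_mul_comm]

lemma meromorphicAt_eval (σ : RatFunc ℂ) :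
    MeromorphicAt (fun z => RatFunc.eval (RingHom.id ℂ) z σ) 0 := by
  simp only [RatFunc.eval, Polynomial.eval₂_id]
  exact (σ.num.differentiable.analyticAt 0).meromorphicAt.div
    (σ.denom.differentiable.analyticAt 0).meromorphicAt

lemma le_wordDeg_iff {w : List (RatFunc ℂ)} {d : WithTop ℤ} :
    d ≤ wordDeg w ↔ ∀ σ ∈ w, d ≤ vanishingDeg σ := by
  induction w with
  | nil => simp [wordDeg]
  | cons τ w ih =>
    rw [List.forall_mem_cons, ← ih]
    exact le_min_iff

/-- The value at `t` of the rescaled letter `t ^ (-d) * σ`, which tends to `rescaledLimit d σ` as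
`t → 0`. -/
def rescaledEval (d : ℤ) (t : ℂ) (σ : RatFunc ℂ) : ℂ :=
  t ^ (-d) * RatFunc.eval (RingHom.id ℂ) t σ

lemma meromorphicAt_rescaledEval (d : ℤ) (σ : RatFunc ℂ) :
    MeromorphicAt (fun z => rescaledEval d z σ) 0 :=
  ((MeromorphicAt.id 0).zpow _).mul (meromorphicAt_eval σ)

lemma tendsto_rescaledEval {σ : RatFunc ℂ} {d : ℤ} (h : d ≤ vanishingDeg σ) :
    Tendsto (fun t : ℝ => rescaledEval d t σ) (𝓝[>] 0) (𝓝 (rescaledLimit d σ)) := by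
  rcases eq_or_ne σ 0 with rfl | hσ
  · simp [rescaledEval, rescaledLimit, laurent]
  obtain ⟨N, g, hN, hg, hg₀, hσg⟩ := exists_eval_eq_zpow_mul hσ
  obtain ⟨k, rfl⟩ := Int.le.dest (WithTop.coe_le_coe.1 (h.trans_eq hN))
  have hlim : Tendsto (fun t : ℝ => (t : ℂ) ^ k * g t) (𝓝[>] 0) (𝓝 (0 ^ k * leadingCoeff σ)) :=
    (tendsto_ofReal_nhdsGT_zero.pow k).mul
      (hg₀ ▸ hg.continuousAt.tendsto.comp tendsto_ofReal_nhdsGT_zero)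
  have hval : rescaledLimit d σ = 0 ^ k * leadingCoeff σ := by
    rcases k.eq_zero_or_pos with rfl | hk
    · rw [rescaledLimit_of_eq (by simpa using hN), pow_zero, one_mul]
    · rw [rescaledLimit_of_lt (hN ▸ WithTop.coe_lt_coe.2 (by lia)), zero_pow hk.ne', zero_mul]
  rw [hval]
  refine hlim.congr' ?_
  filter_upwards [tendsto_ofReal_nhdsGT_nhdsNE.eventually hσg,
    tendsto_ofReal_nhdsGT_nhdsNE.eventually self_mem_nhdsWithin] with t ht ht₀
  rw [rescaledEval, ht, ← mul_assoc, ← zpow_add₀ ht₀, neg_add_cancel_left, zpow_natCast]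

/-! ### Regularized values as a character of the shuffle algebra -/

section RegularizedCharacter

variable {α β : Type*} {ev : α → ℂ} {x y : WordSpace α}

/-- The linear extension of `regValue`, with letters read through `ev`. -/
def regValueₗ (ev : α → ℂ) : WordSpace α →ₗ[ℚ] ℂ :=
  Finsupp.linearCombination ℚ fun w => regValue (w.map ev)

lemma regValueₗ_ofWord (ev : α → ℂ) (w : List α) :
    regValueₗ ev (ofWord w) = regValue (w.map ev) := by
  simp [regValueₗ, ofWord]

lemma regValueₗ_mapDomain (f : α → β) (ev : β → ℂ) (x : WordSpace α) :
    regValueₗ ev (Finsupp.mapDomain (List.map f) x) = regValueₗ (ev ∘ f) x := by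
  simp [regValueₗ, Finsupp.linearCombination_mapDomain, Function.comp_def]

lemma regValue_singleton_zero : regValue [0] = 0 := by
  refine HasRegLimAtTop.regLimAtTop_eq
    ⟨1, fun i _ => if i = 0 then 0 else 1, fun i => analyticAt_const, .of_forall fun z => ?_, rfl⟩
  rw [← List.replicate_one, hyperlogWord_replicate]
  simp [Finset.sum_range_succ]

theorem hasRegLimAtTop_hyperlog (hx : x ∈ admissibleSpan ev) :
    HasRegLimAtTop (hyperlog ev x) (regValueₗ ev x) := by
  simp only [hasRegLimAtTop_iff, hyperlog_eq_hyperlogₗ]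
  induction hx using Submodule.span_induction with
  | mem x hx =>
    obtain ⟨w, hw, rfl⟩ := hx
    simp only [hyperlogₗ_ofWord, regValueₗ_ofWord]
    exact hasRegLimAtTop_iff.1 (hasRegLimAtTop_regValue hw)
  | zero => simpa using HasRegLimAtZero.const 0
  | add x y _ _ hx hy => simpa using hx.add hy
  | smul q x _ hx => simpa [Rat.smul_def] using hx.const_mul q

theorem regValueₗ_shuffleₗ (hx : x ∈ admissibleSpan ev) (hy : y ∈ admissibleSpan ev) :
    regValueₗ ev (shuffleₗ x y) = regValueₗ ev x * regValueₗ ev y := by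
  induction hx, hy using Submodule.span_induction₂ with
  | mem_mem x y hx hy =>
    obtain ⟨u, hu, rfl⟩ := hx
    obtain ⟨v, hv, rfl⟩ := hy
    have hu' := hasRegLimAtTop_iff.1 (hasRegLimAtTop_regValue hu)
    have hv' := hasRegLimAtTop_iff.1 (hasRegLimAtTop_regValue hv)
    have huv := hasRegLimAtTop_iff.1
      (hasRegLimAtTop_hyperlog (shuffleWord_mem_admissibleSpan hu hv))
    rw [shuffleₗ_ofWord, regValueₗ_ofWord, regValueₗ_ofWord]
    refine huv.unique ((hu'.mul hv').congr ?_)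
    filter_upwards [self_mem_nhdsWithin] with s hs
    rw [hyperlog_eq_hyperlogₗ, hyperlogₗ_shuffleWord hu hv (inv_pos.2 hs)]
  | zero_left => simp
  | zero_right => simp
  | add_left x y z _ _ _ h₁ h₂ => simp [h₁, h₂, add_mul]
  | add_right x y z _ _ _ h₁ h₂ => simp [h₁, h₂, mul_add]
  | smul_left q x y _ _ h => simp [h]
  | smul_right q x y _ _ h => simp [h]

lemma mem_admissibleSpan_of_support (h : ∀ w ∈ x.support, ∀ a ∈ w, Admissible (ev a)) :
    x ∈ admissibleSpan ev := by
  rw [← x.sum_single]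
  refine Submodule.sum_mem _ fun w hw => ?_
  rw [← mul_one (x w), ← smul_eq_mul, ← Finsupp.smul_single]
  exact Submodule.smul_mem _ _ (Submodule.subset_span ⟨w, List.forall_mem_map.2 (h w hw), rfl⟩)

lemma eventually_mem_admissibleSpan {T : Type*} {l : Filter T} {e : T → α → ℂ}
    (he : ∀ a, ∀ᶠ t in l, Admissible (e t a)) (x : WordSpace α) :
    ∀ᶠ t in l, x ∈ admissibleSpan (e t) := by
  have h : ∀ᶠ t in l, ∀ w ∈ x.support, ∀ a ∈ w, Admissible (e t a) :=
    (Finset.eventually_all _).2 fun w _ => (List.finite_toSet w).eventually_all.2 fun a _ => he a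
  exact h.mono fun t => mem_admissibleSpan_of_support

end RegularizedCharacter

/-! ### Words whose last letter has minimal degree -/

section MinimalWords

variable {T : Type*} {l : Filter T} {f : T → ℂ} {a : ℂ} {c : ℝ}

lemma IsConicallySeparated.of_tendsto [l.NeBot] (hf : Tendsto f l (𝓝 a))
    (h : ∀ᶠ t in l, IsConicallySeparated c (f t)) : IsConicallySeparated c a := fun x hx =>
  ge_of_tendsto (tendsto_const_nhds.sub hf).norm (h.mono fun _ ht => ht x hx)

lemma IsSeparated.eventually_of_tendsto (hc : 0 < c) (h : IsSeparated (2 * c) a)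
    (hf : Tendsto f l (𝓝 a)) : ∀ᶠ t in l, IsSeparated c (f t) := by
  filter_upwards [Metric.tendsto_nhds.1 hf c hc] with t ht
  exact h.of_norm_sub_le hc.le (dist_eq_norm (f t) a ▸ ht.le)

variable {σ : RatFunc ℂ} {u : List (RatFunc ℂ)} {d : ℤ}

lemma leadingCoeff_ne_zero (hσ : σ ≠ 0) : leadingCoeff σ ≠ 0 :=
  HahnSeries.leadingCoeff_ne_zero.2 ((map_ne_zero _).2 hσ)

lemma exists_isSeparated_rescaledEval (hadm : Admissible (leadingCoeff σ))
    (hσ : vanishingDeg σ = d) :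
    ∃ c, 0 < c ∧ c ≤ 1 ∧ IsSeparated c (leadingCoeff σ) ∧
      ∀ᶠ t : ℝ in 𝓝[>] 0, IsSeparated c (rescaledEval d t σ) := by
  have hσ₀ : σ ≠ 0 := fun h => by simp [vanishingDeg_eq_top_iff.2 h] at hσ
  obtain ⟨c, hc, hc1, hsep⟩ := hadm.exists_isSeparated (leadingCoeff_ne_zero hσ₀)
  refine ⟨c / 2, by positivity, by linarith, hsep.mono (by linarith),
    IsSeparated.eventually_of_tendsto (by positivity) (hsep.mono (by linarith)) ?_⟩
  exact rescaledLimit_of_eq hσ ▸ tendsto_rescaledEval hσ.ge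

lemma rescaledEval_eq_zpow_mul {t : ℝ} (ht : t ≠ 0) (d N : ℤ) (σ : RatFunc ℂ) :
    rescaledEval d t σ = (t ^ (N - d) : ℝ) * rescaledEval N t σ := by
  rw [rescaledEval, rescaledEval, Complex.ofReal_zpow, ← mul_assoc,
    ← zpow_add₀ (Complex.ofReal_ne_zero.2 ht), sub_add_eq_add_sub, add_neg_cancel, zero_sub]

lemma exists_isConicallySeparated_rescaledEval (hadm : Admissible (leadingCoeff σ)) (d : ℤ) :
    ∃ c, 0 < c ∧ c ≤ 1 ∧ ∀ᶠ t : ℝ in 𝓝[>] 0, IsConicallySeparated c (rescaledEval d t σ) := by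
  rcases eq_or_ne σ 0 with rfl | hσ
  · exact ⟨1, one_pos, le_rfl, .of_forall fun t => by
      simpa [rescaledEval] using IsConicallySeparated.zero le_rfl⟩
  obtain ⟨N, hN⟩ := WithTop.ne_top_iff_exists.1 (vanishingDeg_eq_top_iff.not.2 hσ)
  obtain ⟨c, hc, hc1, -, hsep⟩ := exists_isSeparated_rescaledEval hadm hN.symm
  refine ⟨c, hc, hc1, ?_⟩
  filter_upwards [hsep, self_mem_nhdsWithin] with t ht ht₀
  rw [rescaledEval_eq_zpow_mul (ne_of_gt ht₀) d N]
  exact (ht.isConicallySeparated hc).mul_left (zpow_pos ht₀ _)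

lemma exists_forall_isConicallySeparated_rescaledEval
    (hadm : ∀ σ ∈ u, Admissible (leadingCoeff σ)) (d : ℤ) :
    ∃ c, 0 < c ∧ c ≤ 1 ∧
      ∀ σ ∈ u, ∀ᶠ t : ℝ in 𝓝[>] 0, IsConicallySeparated c (rescaledEval d t σ) := by
  induction u with
  | nil => exact ⟨1, one_pos, le_rfl, by simp⟩
  | cons σ u ih =>
    obtain ⟨hσ, hu⟩ := List.forall_mem_cons.1 hadm
    obtain ⟨c, hc, hc1, h⟩ := exists_isConicallySeparated_rescaledEval hσ d
    obtain ⟨c', hc', -, h'⟩ := ih hu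
    exact ⟨min c c', lt_min hc hc', (min_le_left _ _).trans hc1, List.forall_mem_cons.2
      ⟨h.mono fun t ht => ht.mono (min_le_left _ _),
        fun τ hτ => (h' τ hτ).mono fun t ht => ht.mono (min_le_right _ _)⟩⟩

lemma eventually_admissible_rescaledEval (hadm : Admissible (leadingCoeff σ)) (d : ℤ) :
    ∀ᶠ t : ℝ in 𝓝[>] 0, Admissible (rescaledEval d t σ) := by
  obtain ⟨c, hc, -, h⟩ := exists_isConicallySeparated_rescaledEval hadm d
  exact h.mono fun t ht => ht.admissible hc

lemma tendsto_regValue_rescaledEval (hadm : ∀ τ ∈ u ++ [σ], Admissible (leadingCoeff τ))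
    (hσ : vanishingDeg σ = d) (hu : ∀ τ ∈ u, d ≤ vanishingDeg τ) :
    Tendsto (fun t : ℝ => regValue ((u ++ [σ]).map (rescaledEval d t))) (𝓝[>] 0)
      (𝓝 (regValue ((u ++ [σ]).map (rescaledLimit d)))) := by
  obtain ⟨hadm_u, hadm_σ⟩ := List.forall_mem_append.1 hadm
  obtain ⟨c, hc, hc1, hcone⟩ := exists_forall_isConicallySeparated_rescaledEval hadm_u d
  obtain ⟨c', hc', -, hlc, hsep⟩ :=
    exists_isSeparated_rescaledEval (hadm_σ σ (by simp)) hσ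
  have hu' : ∀ τ ∈ u, ∀ᶠ t : ℝ in 𝓝[>] 0, IsConicallySeparated (min c c') (rescaledEval d t τ) :=
    fun τ hτ => (hcone τ hτ).mono fun t ht => ht.mono (min_le_left _ _)
  have hle : ∀ τ ∈ u ++ [σ], d ≤ vanishingDeg τ :=
    List.forall_mem_append.2 ⟨hu, List.forall_mem_singleton.2 hσ.ge⟩
  refine tendsto_regValue (lt_min hc hc') ((min_le_left _ _).trans hc1)
    (fun τ hτ => tendsto_rescaledEval (hle τ hτ)) ((List.finite_toSet u).eventually_all.2 hu')
    (hsep.mono fun t ht => ht.mono (min_le_right _ _))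
    (fun τ hτ => .of_tendsto (tendsto_rescaledEval (hu τ hτ)) (hu' τ hτ)) ?_
  exact rescaledLimit_of_eq hσ ▸ hlc.mono (min_le_right _ _)

lemma hasRegLimAtZero_suffixSum_dividedPow {κ : Type*} {Λ : List ℂ → ℂ} {g : ℝ → κ → ℂ}
    {w : List κ} {D : ℕ → ℂ} (hD : ∀ j, HasRegLimAtZero (fun t => Λ ((w.drop j).map (g t))) (D j))
    (y : ℂ) :
    HasRegLimAtZero (fun t => suffixSum Λ (dividedPow (y * (Real.log t : ℂ))) (w.map (g t)))
      (D 0) := by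
  have h := HasRegLimAtZero.sum (Finset.range (w.length + 1)) fun j _ =>
    ((hD j).log_pow_mul j).const_mul (dividedPow y j)
  rw [Finset.sum_eq_single_of_mem 0 (by simp) fun j _ hj => by simp [hj], if_pos rfl,
    dividedPow_zero, one_mul] at h
  refine h.congr (.of_forall fun t => ?_)
  rw [suffixSum, List.length_map]
  refine Finset.sum_congr rfl fun j _ => ?_
  rw [List.map_drop, dividedPow, dividedPow, mul_pow]
  ring

lemma regValue_map_eval_eq_suffixSum {t : ℝ} (ht : 0 < t) (hσ : rescaledEval d t σ ≠ 0)
    (hadm : ∀ τ ∈ u ++ [σ], Admissible (rescaledEval d t τ)) :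
    regValue ((u ++ [σ]).map (RatFunc.eval (RingHom.id ℂ) (t : ℂ))) =
      suffixSum regValue (dividedPow (-(d : ℂ) * (Real.log t : ℂ)))
        ((u ++ [σ]).map (rescaledEval d t)) := by
  have hscale := regValue_map_mul (zpow_pos ht d) (u.map (rescaledEval d t)) hσ
    (by simpa [or_imp, forall_and] using hadm)
  have heval : (fun τ => (t ^ d : ℝ) * rescaledEval d t τ) = RatFunc.eval (RingHom.id ℂ) t := by
    funext τ
    have h := rescaledEval_eq_zpow_mul ht.ne' 0 d τ
    rw [sub_zero] at h
    rw [← h]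
    simp [rescaledEval]
  rw [Real.log_zpow, Complex.ofReal_mul, Complex.ofReal_intCast, ← neg_mul] at hscale
  simpa [← heval, Function.comp_def] using hscale

theorem hasRegLimAtZero_regValue_map_eval (hadm : ∀ τ ∈ u ++ [σ], Admissible (leadingCoeff τ))
    (hσ : vanishingDeg σ = d) (hu : ∀ τ ∈ u, d ≤ vanishingDeg τ) :
    HasRegLimAtZero (fun t : ℝ => regValue ((u ++ [σ]).map (RatFunc.eval (RingHom.id ℂ) (t : ℂ))))
      (regValue ((u ++ [σ]).map (rescaledLimit d))) := by
  have hadm' : ∀ τ ∈ u ++ [σ], ∀ᶠ t : ℝ in 𝓝[>] 0, Admissible (rescaledEval d t τ) :=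
    fun τ hτ => eventually_admissible_rescaledEval (hadm τ hτ) d
  have hex (j : ℕ) : ∃ c, HasRegLimAtZero
      (fun t : ℝ => regValue (((u ++ [σ]).drop j).map (rescaledEval d t))) c :=
    exists_hasRegLimAtZero_regValue_of_meromorphicAt (g := fun τ z => rescaledEval d z τ)
      (fun τ _ => meromorphicAt_rescaledEval d τ) fun τ hτ => hadm' τ (List.mem_of_mem_drop hτ)
  choose D hD using hex
  have hD₀ : D 0 = regValue ((u ++ [σ]).map (rescaledLimit d)) :=
    (hD 0).eq_of_tendsto (tendsto_regValue_rescaledEval hadm hσ hu)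
  obtain ⟨c, hc, -, -, hsep⟩ := exists_isSeparated_rescaledEval (hadm σ (by simp)) hσ
  rw [← hD₀]
  refine (hasRegLimAtZero_suffixSum_dividedPow hD (-(d : ℂ))).congr ?_
  filter_upwards [(List.finite_toSet (u ++ [σ])).eventually_all.2 hadm', hsep, self_mem_nhdsWithin]
    with t htadm htsep ht
  exact (regValue_map_eval_eq_suffixSum ht (htsep.ne_zero hc) htadm).symm

end MinimalWords

/-! ### The regularized limit of words -/

section ReglimWord

variable {S : Set (RatFunc ℂ)} {ℓ ℓ' : WordSpace S →ₗ[ℚ] WordSpace (leadingAlphabet S)}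

lemma eq_of_vanishingDeg_eq_top (a b : S) (ha : vanishingDeg (a : RatFunc ℂ) = ⊤)
    (hb : vanishingDeg (b : RatFunc ℂ) = ⊤) : a = b :=
  Subtype.ext ((vanishingDeg_eq_top_iff.1 ha).trans (vanishingDeg_eq_top_iff.1 hb).symm)

lemma wordDeg_append_singleton_eq_iff {u : List (RatFunc ℂ)} {σ : RatFunc ℂ} :
    wordDeg (u ++ [σ]) = vanishingDeg σ ↔ ∀ τ ∈ u, vanishingDeg σ ≤ vanishingDeg τ := by
  have hle : wordDeg (u ++ [σ]) ≤ vanishingDeg σ := le_wordDeg_iff.1 le_rfl σ (by simp)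
  rw [le_antisymm_iff, and_iff_right hle, le_wordDeg_iff, List.forall_mem_append]
  simp

namespace IsReglimWord

lemma map_shuffleₗ (h : IsReglimWord ℓ) (x y : WordSpace S) :
    ℓ (shuffleₗ x y) = shuffleₗ (ℓ x) (ℓ y) := by
  rw [shuffleₗ_apply, h.map_shuffle, shuffleₗ_apply]

lemma map_snoc (h : IsReglimWord ℓ) {u : List S} {a : S} {d : ℤ}
    (ha : vanishingDeg (a : RatFunc ℂ) = d) (hu : ∀ b ∈ u, d ≤ vanishingDeg (b : RatFunc ℂ)) :
    Finsupp.mapDomain (List.map Subtype.val) (ℓ (ofWord (u ++ [a]))) =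
      ofWord ((u ++ [a]).map fun τ => rescaledLimit d (τ : RatFunc ℂ)) := by
  refine h.map_minimal u a d ha ?_
  rw [List.map_append, List.map_singleton, ← ha, wordDeg_append_singleton_eq_iff]
  exact List.forall_mem_map.2 fun b hb => ha.trans_le (hu b hb)

theorem ext (h : IsReglimWord ℓ) (h' : IsReglimWord ℓ') : ℓ = ℓ' := by
  have hinj : Function.Injective
      (Finsupp.mapDomain (M := ℚ) (List.map (Subtype.val : leadingAlphabet S → ℂ))) :=
    Finsupp.mapDomain_injective (List.map_injective_iff.2 Subtype.val_injective)
  refine LinearMap.eqLocus_eq_top.1 (eq_top_of_minimal_mem (fun a : S => vanishingDeg a)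
    eq_of_vanishingDeg_eq_top (fun x hx y hy => ?_) (h.map_one.trans h'.map_one.symm)
    (fun a ha => ?_) fun u a d ha hu => hinj ((h.map_snoc ha hu).trans (h'.map_snoc ha hu).symm))
  · rw [LinearMap.mem_eqLocus] at hx hy ⊢
    rw [h.map_shuffleₗ, h'.map_shuffleₗ, hx, hy]
  · have ha₀ := vanishingDeg_eq_top_iff.1 ha
    exact (h.map_zero_letter a ha₀).trans (h'.map_zero_letter a ha₀).symm

end IsReglimWord

lemma zero_mem_leadingAlphabet : 0 ∈ leadingAlphabet S :=
  Or.inl rfl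

lemma leadingCoeff_mem_leadingAlphabet (a : S) : leadingCoeff a ∈ leadingAlphabet S := by
  by_cases ha : (a : RatFunc ℂ) = 0
  · exact Or.inl (by simp [ha, leadingCoeff, laurent])
  · exact Or.inr ⟨a, ⟨a.2, ha⟩, rfl⟩

variable (S) in
/-- The map `ℓ` of the theorem: the leading-word morphism of the alphabet `S` with respect to the
vanishing degrees and the leading coefficients. -/
def reglimWord : WordSpace S →ₗ[ℚ] WordSpace (leadingAlphabet S) :=
  leadingHom (fun a : S => vanishingDeg a) (fun a => ⟨_, leadingCoeff_mem_leadingAlphabet a⟩)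
    ⟨0, zero_mem_leadingAlphabet⟩

lemma coe_limitLetter {a : S} {d : ℤ} (h : d ≤ vanishingDeg (a : RatFunc ℂ)) :
    ((limitLetter (fun a : S => vanishingDeg a)
      (fun a => ⟨_, leadingCoeff_mem_leadingAlphabet a⟩) ⟨0, zero_mem_leadingAlphabet⟩ d a :
        leadingAlphabet S) : ℂ) = rescaledLimit d a := by
  rw [limitLetter]
  split_ifs with heq
  · exact (rescaledLimit_of_eq heq).symm
  · exact (rescaledLimit_of_lt (lt_of_le_of_ne h (Ne.symm heq))).symm

theorem isReglimWord_reglimWord : IsReglimWord (reglimWord S) where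
  map_one := (isShuffleHom_leadingHom _ _ _).map_one
  map_shuffle x y := by
    rw [← shuffleₗ_apply, ← shuffleₗ_apply, reglimWord,
      (isShuffleHom_leadingHom _ _ _).map_shuffleₗ]
  map_zero_letter a ha := leadingHom_of_top (vanishingDeg_eq_top_iff.2 ha)
  map_minimal u a d ha hd := by
    have hle : ∀ b ∈ u ++ [a], d ≤ vanishingDeg (b : RatFunc ℂ) :=
      fun b hb => le_wordDeg_iff.1 hd.ge _ (List.mem_map_of_mem hb)
    rw [reglimWord, leadingHom_minimal (deg := fun a : S => vanishingDeg a) ha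
      fun b hb => hle b (List.mem_append_left _ hb), ofWord, Finsupp.mapDomain_single, ← ofWord]
    simp only [bind_pure_comp, List.map_eq_map, List.map_map]
    congr 1
    exact List.map_congr_left fun b hb => coe_limitLetter (hle b hb)

/-- The elements `x` at which the linear functionals `F t` have the regularized limit `G x` as
`t → 0`. -/
def regLimLocus {M : Type*} [AddCommGroup M] [Module ℚ M] (F : ℝ → M →ₗ[ℚ] ℂ) (G : M →ₗ[ℚ] ℂ) :
    Submodule ℚ M where
  carrier := {x | HasRegLimAtZero (fun t => F t x) (G x)}
  add_mem' hx hy := by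
    simp only [Set.mem_ofPred_eq, map_add] at hx hy ⊢
    exact hx.add hy
  zero_mem' := by
    simp only [Set.mem_ofPred_eq, map_zero]
    exact HasRegLimAtZero.const 0
  smul_mem' q x hx := by
    simp only [Set.mem_ofPred_eq, map_smul, Rat.smul_def] at hx ⊢
    exact hx.const_mul q

lemma eventually_admissible_evalAt {a : S} (ha : Admissible (leadingCoeff a)) :
    ∀ᶠ t : ℝ in 𝓝[>] 0, Admissible (evalAt t a) := by
  simpa [rescaledEval, evalAt] using eventually_admissible_rescaledEval ha 0

lemma IsReglimWord.regValueₗ_snoc (hℓ : IsReglimWord ℓ) {u : List S} {a : S} {d : ℤ}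
    (ha : vanishingDeg (a : RatFunc ℂ) = d) (hu : ∀ b ∈ u, d ≤ vanishingDeg (b : RatFunc ℂ)) :
    regValueₗ Subtype.val (ℓ (ofWord (u ++ [a]))) =
      regValue (((u ++ [a]).map Subtype.val).map (rescaledLimit d)) := by
  have h := congrArg (regValueₗ id) (hℓ.map_snoc ha hu)
  rw [regValueₗ_mapDomain, regValueₗ_ofWord] at h
  simpa using h

theorem IsReglimWord.hasRegLimAtZero_regValueₗ (hℓ : IsReglimWord ℓ)
    (hadm : ∀ a : leadingAlphabet S, Admissible (a : ℂ)) (x : WordSpace S) :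
    HasRegLimAtZero (fun t => regValueₗ (evalAt t) x) (regValueₗ Subtype.val (ℓ x)) := by
  have hlc (a : S) : Admissible (leadingCoeff a) := hadm ⟨_, leadingCoeff_mem_leadingAlphabet a⟩
  have hlim (y : WordSpace (leadingAlphabet S)) : y ∈ admissibleSpan Subtype.val :=
    mem_admissibleSpan_of_support fun _ _ a _ => hadm a
  have heval := eventually_mem_admissibleSpan fun a : S => eventually_admissible_evalAt (hlc a)
  suffices h : regLimLocus (fun t => regValueₗ (evalAt t)) (regValueₗ Subtype.val ∘ₗ ℓ) = ⊤ from
    (Submodule.eq_top_iff'.1 h x :)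
  refine eq_top_of_minimal_mem (fun a : S => vanishingDeg a) eq_of_vanishingDeg_eq_top
    (fun x hx y hy => ?_) ?_ (fun a ha => ?_) fun u a d ha hu => ?_
  · change HasRegLimAtZero _ (regValueₗ _ (ℓ (shuffleₗ x y)))
    rw [hℓ.map_shuffleₗ, regValueₗ_shuffleₗ (hlim _) (hlim _)]
    refine (HasRegLimAtZero.mul hx hy).congr ?_
    filter_upwards [heval x, heval y] with t hx hy
    exact (regValueₗ_shuffleₗ hx hy).symm
  · change HasRegLimAtZero _ (regValueₗ _ (ℓ (ofWord [])))
    simp only [hℓ.map_one, regValueₗ_ofWord, List.map_nil]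
    exact .const _
  · have ha₀ := vanishingDeg_eq_top_iff.1 ha
    change HasRegLimAtZero _ (regValueₗ _ (ℓ (ofWord [a])))
    simp only [hℓ.map_zero_letter a ha₀, regValueₗ_ofWord, List.map_singleton, evalAt, ha₀,
      RatFunc.eval_zero, regValue_singleton_zero, map_zero]
    exact .const 0
  · change HasRegLimAtZero _ (regValueₗ _ (ℓ (ofWord (u ++ [a]))))
    rw [hℓ.regValueₗ_snoc ha hu, List.map_append, List.map_singleton]
    simp only [regValueₗ_ofWord]
    refine (hasRegLimAtZero_regValue_map_eval ?_ ha (List.forall_mem_map.2 hu)).congr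
      (.of_forall fun t => by simp [evalAt])
    exact List.forall_mem_append.2
      ⟨List.forall_mem_map.2 fun b _ => hlc b, List.forall_mem_singleton.2 (hlc a)⟩

end ReglimWord

end

end Hyperlogarithm

theorem mainTheorem1 (S : Set (RatFunc ℂ))
    (hS : Disjoint S ((fun r : ℝ => RatFunc.C (r : ℂ)) '' Set.Ioi 0))
    (hlead : Disjoint (Hyperlogarithm.leadingAlphabet S) ((fun r : ℝ => (r : ℂ)) '' Set.Ioi 0)) :
    ∃ ℓ : Hyperlogarithm.WordSpace S →ₗ[ℚ]
        Hyperlogarithm.WordSpace (Hyperlogarithm.leadingAlphabet S),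
      Hyperlogarithm.IsReglimWord ℓ ∧
      (∀ ℓ', Hyperlogarithm.IsReglimWord ℓ' → ℓ' = ℓ) ∧
      ∀ w : Hyperlogarithm.WordSpace S,
        (∀ᶠ t : ℝ in nhdsWithin 0 (Set.Ioi 0),
          ∃ c, Hyperlogarithm.HasRegLimAtTop
            (Hyperlogarithm.hyperlog (Hyperlogarithm.evalAt t) w) c) ∧
        (∃ c, Hyperlogarithm.HasRegLimAtZero
          (fun t => Hyperlogarithm.regLimAtTop
            (Hyperlogarithm.hyperlog (Hyperlogarithm.evalAt t) w)) c) ∧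
        (∃ c, Hyperlogarithm.HasRegLimAtTop (Hyperlogarithm.hyperlog Subtype.val (ℓ w)) c) ∧
        Hyperlogarithm.regLimAtZero
            (fun t => Hyperlogarithm.regLimAtTop
              (Hyperlogarithm.hyperlog (Hyperlogarithm.evalAt t) w)) =
          Hyperlogarithm.regLimAtTop (Hyperlogarithm.hyperlog Subtype.val (ℓ w)) := by
  have hadm (a : Hyperlogarithm.leadingAlphabet S) : Hyperlogarithm.Admissible (a : ℂ) :=
    fun x hx hax => Set.disjoint_left.1 hlead a.2 ⟨x, hx, hax.symm⟩
  refine ⟨Hyperlogarithm.reglimWord S, Hyperlogarithm.isReglimWord_reglimWord,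
    fun ℓ' hℓ' => hℓ'.ext Hyperlogarithm.isReglimWord_reglimWord, fun w => ?_⟩
  have hspan := Hyperlogarithm.eventually_mem_admissibleSpan (fun a : S =>
    Hyperlogarithm.eventually_admissible_evalAt
      (hadm ⟨_, Hyperlogarithm.leadingCoeff_mem_leadingAlphabet a⟩)) w
  have hinner := hspan.mono fun t ht => Hyperlogarithm.hasRegLimAtTop_hyperlog ht
  have houter :=
    (Hyperlogarithm.isReglimWord_reglimWord.hasRegLimAtZero_regValueₗ hadm w).congr
      (hinner.mono fun t ht => ht.regLimAtTop_eq.symm)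
  have hleading := Hyperlogarithm.hasRegLimAtTop_hyperlog
    (Hyperlogarithm.mem_admissibleSpan_of_support (x := Hyperlogarithm.reglimWord S w)
      fun _ _ a _ => hadm a)
  exact ⟨hinner.mono fun t ht => ⟨_, ht⟩, ⟨_, houter⟩, ⟨_, hleading⟩,
    houter.regLimAtZero_eq.trans hleading.regLimAtTop_eq.symm⟩
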